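/- Let $\mathsf{PrA}^-$ be the theory in the language $0,1,+,=$ whose axioms say that $+$ is associative, commutative and cancellative with neutral element $0$, that $\forall x\,(x+1\neq 0)$, that $\forall x\,(x\ne 0\to\exists y\;x=y+1)$, and that $\forall x\forall y\,(x\le y\vee y\le x)$, where $x\le y$ abbreviates $\exists z\;x+z=y$. For a natural number $k$ and a term $t$ let $kt$ denote the term $t+(\dots+(t+t)\dots)$ with $k$ summands ($0$ if $k=0$), and let a natural number $r$ also denote the term $r1$. For $m\ge 1$ let $x\equiv_m y$ abbreviate $\exists z\,(mz+y=x\,\vee\, mz+x=y)$. Let $\mathsf{PrA}_{\mathit{alt}}$ be $\mathsf{PrA}^-$ together with the axioms $\forall x\,(x\equiv_p 0\vee\dots\vee x\equiv_p p-1)$ for all primes $p$. Let $F(x)$ be a quantifier-free formula, possibly with further variables, in the signature $0,1,+,=,\le,\equiv_m$ ($m\ge1$). The modified Cooper algorithm transforms $\exists x\,F(x)$ into a quantifier-free formula $F'$ as follows. 1. In each atomic formula, occurrences of $x$ are taken off both sides until one side contains no $x$. 2. A positive integer $C$ is chosen that is divisible by the number of occurrences of $x$ in each atomic formula that still contains $x$.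 Each such atomic formula $t=u$, $t\le u$, $t\equiv_m u$ is replaced by $kt=ku$, $kt\le ku$, $kt\equiv_{mk}ku$ respectively, with the factor $k$ for which $x$ occurs exactly $C$ times, and the side with $x$ is written as $Cx+t_i$, where $t_i$ does not contain $x$ ($i$ indexes the atomic formulas that contain $x$). 3. To both sides of the $i$-th of these atomic formulas all $t_j$ with $j\neq i$ are added, so that the side with $x$ becomes $Cx+t$ with $t=\sum_j t_j$. Thus $F(x)$ takes the form $F''(Cx+t)$, where in $F''(y)$ the variable $y$ occurs only as a whole side of an atomic formula, and at most once in each atomic formula. 4. $F'''(y)$ is the formula $t\le y\wedge y\equiv_C t\wedge F''(y)$. 5. $F'$ is the formula $\bigvee_{s\in T}\bigvee_{0\le r\le D}F'''(s+r)$, where $D$ is the least common multiple of all $m$ such that $\equiv_m$ occurs in $F'''(y)$, and $T$ consists of $0$ and of all terms $s$ such that $s\le y$, $y\le s$, $s=y$ or $y=s$ is an atomic formula of $F'''(y)$. **Theorem.** There is a polynomial $P$ such that for every such $F(x)$, and every choice of $C$ as in step 2, the formula $\exists x\,F(x)\leftrightarrow F'$ (with $\le$ and $\equiv_m$ expanded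 according to their definitions) has a proof in $\mathsf{PrA}_{\mathit{alt}}$, in classical natural deduction with equality, of size at most $P(n)$, where $n$ is the size of the formula $\exists x\,F(x)\leftrightarrow F'$. The size of a formula or of a proof is its number of symbols. -/

import Mathlib

/-! # Presburger arithmetic: syntax, natural deduction, the axioms, and the modified Cooper algorithm

Variables are de Bruijn indices: inside the scope of a quantifier, `var 0` is the quantified
variable and `var (i + 1)` is the variable called `var i` outside. -/

namespace PrA

/-- Terms of the language `0, 1, +`. -/
inductive Term : Type
  | var : ℕ → Term
  | zero : Term
  | one : Term
  | add : Term → Term → Term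
  deriving DecidableEq

/-- First-order formulas with equality in the language `0, 1, +`. -/
inductive Fml : Type
  | eq : Term → Term → Fml
  | bot : Fml
  | imp : Fml → Fml → Fml
  | and : Fml → Fml → Fml
  | or : Fml → Fml → Fml
  | all : Fml → Fml
  | ex : Fml → Fml

namespace Term

/-- Simultaneous substitution. -/
def subst (σ : ℕ → Term) : Term → Term
  | var i => σ i
  | zero => zero
  | one => one
  | add t u => add (t.subst σ) (u.subst σ)

/-- Renaming `var i` to `var (i + 1)`: the same term, read inside one more quantifier. -/
def lift (t : Term) : Term := t.subst fun i => var (i + 1)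

/-- The substitution `var 0 ↦ t`, `var (i + 1) ↦ var i`. -/
def single (t : Term) : ℕ → Term
  | 0 => t
  | i + 1 => var i

/-- A substitution passing under a quantifier. -/
def up (σ : ℕ → Term) : ℕ → Term
  | 0 => var 0
  | i + 1 => (σ i).lift

/-- Substituting `s` for `var 0` and lowering all other variables. -/
def inst (t s : Term) : Term := t.subst (single s)

/-- The sum `t₁ + (t₂ + (⋯ + tₙ))` of a list of terms; the empty sum is `0`. -/
def sum : List Term → Term
  | [] => zero
  | [t] => t
  | t :: s :: l => add t (sum (s :: l))

/-- The term `t + (⋯ + (t + t))` with `k` summands. -/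
def smul (k : ℕ) (t : Term) : Term := sum (List.replicate k t)

/-- The numeral `1 + (⋯ + (1 + 1))` with `n` summands. -/
def num (n : ℕ) : Term := smul n one

/-- The number of symbols of a term. -/
def size : Term → ℕ
  | var _ => 1
  | zero => 1
  | one => 1
  | add t u => t.size + u.size + 1

/-- The number of occurrences of `var 0`. -/
def count : Term → ℕ
  | var 0 => 1
  | var (_ + 1) => 0
  | zero => 0
  | one => 0
  | add t u => t.count + u.count

/-- Deleting all occurrences of `var 0`; `none` if nothing remains. -/
def strip? : Term → Option Term
  | var 0 => none
  | var (i + 1) => some (var (i + 1))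
  | zero => some zero
  | one => some one
  | add t u =>
    match t.strip?, u.strip? with
    | none, s => s
    | some s, none => some s
    | some s, some s' => some (add s s')

/-- Deleting all occurrences of `var 0`; the result is `0` if nothing remains. -/
def strip (t : Term) : Term := t.strip?.getD zero

end Term

namespace Fml

/-- Simultaneous (capture-avoiding) substitution. -/
def subst (σ : ℕ → Term) : Fml → Fml
  | eq t u => eq (t.subst σ) (u.subst σ)
  | bot => bot
  | imp A B => imp (A.subst σ) (B.subst σ)
  | and A B => and (A.subst σ) (B.subst σ)
  | or A B => or (A.subst σ) (B.subst σ)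
  | all A => all (A.subst (Term.up σ))
  | ex A => ex (A.subst (Term.up σ))

/-- The same formula, read inside one more quantifier. -/
def lift (A : Fml) : Fml := A.subst fun i => Term.var (i + 1)

/-- `A(t)`, where `A = A(var 0)`. -/
def inst (A : Fml) (t : Term) : Fml := A.subst (Term.single t)

def neg (A : Fml) : Fml := imp A bot

def iff (A B : Fml) : Fml := and (imp A B) (imp B A)

/-- `t ≤ u`, that is `∃ z, t + z = u`. -/
def le (t u : Term) : Fml := ex (eq (.add t.lift (.var 0)) u.lift)

/-- `t ≡ u` modulo `m`, that is `∃ z, (z + ⋯ + z) + u = t ∨ (z + ⋯ + z) + t = u`, with `m`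
summands `z`. -/
def modEq (m : ℕ) (t u : Term) : Fml :=
  ex (or (eq (.add (.smul m (.var 0)) u.lift) t.lift)
    (eq (.add (.smul m (.var 0)) t.lift) u.lift))

/-- The number of symbols of a formula (in prefix notation, so without parentheses). -/
def size : Fml → ℕ
  | eq t u => t.size + u.size + 1
  | bot => 1
  | imp A B => A.size + B.size + 1
  | and A B => A.size + B.size + 1
  | or A B => A.size + B.size + 1
  | all A => A.size + 2
  | ex A => A.size + 2

/-- The disjunction `A₁ ∨ (A₂ ∨ (⋯ ∨ Aₙ))` of a list of formulas. -/
def disj : List Fml → Fml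
  | [] => bot
  | [A] => A
  | A :: B :: l => or A (disj (B :: l))

end Fml

/-! ## Natural deduction -/

/-- Classical first-order natural deduction with equality, in sequent style. `Derivation Ax Γ A` is
the type of derivation trees of the sequent `Γ ⊢ A` from the set `Ax` of nonlogical axioms (which
are meant to be sentences). -/
inductive Derivation (Ax : Set Fml) : List Fml → Fml → Type
  | hyp {Γ : List Fml} {A : Fml} : A ∈ Γ → Derivation Ax Γ A
  | ax {Γ : List Fml} {A : Fml} : A ∈ Ax → Derivation Ax Γ A
  | weaken {Γ Δ : List Fml} {A : Fml} : Γ ⊆ Δ → Derivation Ax Γ A → Derivation Ax Δ A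
  | impI {Γ : List Fml} {A B : Fml} : Derivation Ax (A :: Γ) B → Derivation Ax Γ (.imp A B)
  | impE {Γ : List Fml} {A B : Fml} :
      Derivation Ax Γ (.imp A B) → Derivation Ax Γ A → Derivation Ax Γ B
  | andI {Γ : List Fml} {A B : Fml} :
      Derivation Ax Γ A → Derivation Ax Γ B → Derivation Ax Γ (.and A B)
  | andE₁ {Γ : List Fml} {A B : Fml} : Derivation Ax Γ (.and A B) → Derivation Ax Γ A
  | andE₂ {Γ : List Fml} {A B : Fml} : Derivation Ax Γ (.and A B) → Derivation Ax Γ B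
  | orI₁ {Γ : List Fml} {A B : Fml} : Derivation Ax Γ A → Derivation Ax Γ (.or A B)
  | orI₂ {Γ : List Fml} {A B : Fml} : Derivation Ax Γ B → Derivation Ax Γ (.or A B)
  | orE {Γ : List Fml} {A B C : Fml} : Derivation Ax Γ (.or A B) →
      Derivation Ax (A :: Γ) C → Derivation Ax (B :: Γ) C → Derivation Ax Γ C
  | raa {Γ : List Fml} {A : Fml} : Derivation Ax (A.neg :: Γ) .bot → Derivation Ax Γ A
  | allI {Γ : List Fml} {A : Fml} :
      Derivation Ax (Γ.map Fml.lift) A → Derivation Ax Γ (.all A)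
  | allE {Γ : List Fml} {A : Fml} (t : Term) :
      Derivation Ax Γ (.all A) → Derivation Ax Γ (A.inst t)
  | exI {Γ : List Fml} {A : Fml} (t : Term) :
      Derivation Ax Γ (A.inst t) → Derivation Ax Γ (.ex A)
  | exE {Γ : List Fml} {A B : Fml} : Derivation Ax Γ (.ex A) →
      Derivation Ax (A :: Γ.map Fml.lift) B.lift → Derivation Ax Γ B
  | eqI {Γ : List Fml} (t : Term) : Derivation Ax Γ (.eq t t)
  | eqE {Γ : List Fml} (A : Fml) {s t : Term} :
      Derivation Ax Γ (.eq s t) → Derivation Ax Γ (A.inst s) → Derivation Ax Γ (A.inst t)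

/-- The number of symbols of the sequent `Γ ⊢ A`. -/
def seqSize (Γ : List Fml) (A : Fml) : ℕ := (Γ.map fun B => B.size + 1).sum + A.size + 1

/-- The size of a derivation: the total number of symbols of all the sequents occurring in the
derivation tree (one sequent per node, counted as often as it occurs). -/
def Derivation.size {Ax : Set Fml} {Γ : List Fml} {A : Fml} (d : Derivation Ax Γ A) : ℕ :=
  seqSize Γ A +
    match d with
    | .hyp _ => 0
    | .ax _ => 0
    | .weaken _ d₁ => d₁.size
    | .impI d₁ => d₁.size
    | .impE d₁ d₂ => d₁.size + d₂.size
    | .andI d₁ d₂ => d₁.size + d₂.size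
    | .andE₁ d₁ => d₁.size
    | .andE₂ d₁ => d₁.size
    | .orI₁ d₁ => d₁.size
    | .orI₂ d₁ => d₁.size
    | .orE d₁ d₂ d₃ => d₁.size + d₂.size + d₃.size
    | .raa d₁ => d₁.size
    | .allI d₁ => d₁.size
    | .allE _ d₁ => d₁.size
    | .exI _ d₁ => d₁.size
    | .exE d₁ d₂ => d₁.size + d₂.size
    | .eqI _ => 0
    | .eqE _ d₁ d₂ => d₁.size + d₂.size

/-! ## The theories -/

open Term Fml in
/-- The axioms of `PrA⁻`. -/
inductive AxMinus : Fml → Prop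
  /-- `∀ x y z, (x + y) + z = x + (y + z)` -/
  | add_assoc : AxMinus (all (all (all
      (eq (add (add (var 2) (var 1)) (var 0)) (add (var 2) (add (var 1) (var 0)))))))
  /-- `∀ x y, x + y = y + x` -/
  | add_comm : AxMinus (all (all (eq (add (var 1) (var 0)) (add (var 0) (var 1)))))
  /-- `∀ x, x + 0 = x` -/
  | add_zero : AxMinus (all (eq (add (var 0) zero) (var 0)))
  /-- `∀ x y z, x + z = y + z → x = y` -/
  | add_cancel : AxMinus (all (all (all
      (imp (eq (add (var 2) (var 0)) (add (var 1) (var 0))) (eq (var 2) (var 1))))))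
  /-- `∀ x, x + 1 ≠ 0` -/
  | succ_ne_zero : AxMinus (all (neg (eq (add (var 0) one) zero)))
  /-- `∀ x, x ≠ 0 → ∃ y, x = y + 1` -/
  | exists_pred : AxMinus (all
      (imp (neg (eq (var 0) zero)) (ex (eq (var 1) (add (var 0) one)))))
  /-- `∀ x y, x ≤ y ∨ y ≤ x` -/
  | le_total : AxMinus (all (all (or (le (var 1) (var 0)) (le (var 0) (var 1)))))

/-- The axiom `∀ x, x ≡ 0 ∨ ⋯ ∨ x ≡ p - 1` modulo `p`. -/
def axMod (p : ℕ) : Fml :=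
  .all (.disj ((List.range p).map fun i => .modEq p (.var 0) (.num i)))

/-- The axioms of `PrA_alt`: those of `PrA⁻` together with `axMod p` for all primes `p`. -/
def PrAalt : Set Fml := {A | AxMinus A ∨ ∃ p : ℕ, p.Prime ∧ A = axMod p}

/-! ## Quantifier-free formulas of the signature extended by `≤` and `≡ₘ` -/

/-- The relation symbols `=`, `≤`, `≡ₘ` of the extended signature. -/
inductive Rel : Type
  | eq : Rel
  | le : Rel
  | mod : ℕ → Rel

/-- The relation between `k t` and `k u` which expresses that `t` and `u` are in the given
relation. -/
def Rel.scale (k : ℕ) : Rel → Rel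
  | eq => eq
  | le => le
  | mod m => mod (m * k)

/-- Quantifier-free formulas of the extended signature. -/
inductive QF : Type
  | rel : Rel → Term → Term → QF
  | bot : QF
  | imp : QF → QF → QF
  | and : QF → QF → QF
  | or : QF → QF → QF

namespace QF

/-- The formula in the language `0, 1, +` for which a quantifier-free formula of the extended
signature is a shorthand. -/
def toFml : QF → Fml
  | rel .eq t u => .eq t u
  | rel .le t u => .le t u
  | rel (.mod m) t u => .modEq m t u
  | bot => .bot
  | imp A B => .imp A.toFml B.toFml
  | and A B => .and A.toFml B.toFml
  | or A B => .or A.toFml B.toFml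

def subst (σ : ℕ → Term) : QF → QF
  | rel R t u => rel R (t.subst σ) (u.subst σ)
  | bot => bot
  | imp A B => imp (A.subst σ) (B.subst σ)
  | and A B => and (A.subst σ) (B.subst σ)
  | or A B => or (A.subst σ) (B.subst σ)

/-- `A(t)`, where `A = A(var 0)`. -/
def inst (A : QF) (t : Term) : QF := A.subst (Term.single t)

def disj : List QF → QF
  | [] => bot
  | [A] => A
  | A :: B :: l => or A (disj (B :: l))

/-- The moduli `m` of the relation symbols `≡ₘ` used in a formula. -/
def moduli : QF → List ℕ
  | rel (.mod m) _ _ => [m]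
  | rel .eq _ _ => []
  | rel .le _ _ => []
  | bot => []
  | imp A B => A.moduli ++ B.moduli
  | and A B => A.moduli ++ B.moduli
  | or A B => A.moduli ++ B.moduli

/-! ## The algorithm

`x` is `var 0`. When the `x`s common to both sides of an atomic formula `R(t, u)` are taken off,
there remain, up to the order of summation, `R(c x + t.strip, u.strip)` if
`t.count = u.count + c`, and `R(t.strip, c x + u.strip)` if `u.count = t.count + c`. -/

/-- The numbers of `x`s in the atomic formulas that still involve `x` after the `x`s common to both
sides are taken off. -/
def coeffs : QF → List ℕ
  | rel _ t u =>
    if u.count < t.count then [t.count - u.count]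
    else if t.count < u.count then [u.count - t.count]
    else []
  | bot => []
  | imp A B => A.coeffs ++ B.coeffs
  | and A B => A.coeffs ++ B.coeffs
  | or A B => A.coeffs ++ B.coeffs

/-- After multiplication by suitable factors, the side with `x` of every atomic formula which
involves `x` has the form `C x + tᵢ`. This is the list of the terms `tᵢ`, one for each such atomic
formula. -/
def rests (C : ℕ) : QF → List Term
  | rel _ t u =>
    if u.count < t.count then [.smul (C / (t.count - u.count)) t.strip]
    else if t.count < u.count then [.smul (C / (u.count - t.count)) u.strip]
    else []
  | bot => []
  | imp A B => A.rests C ++ B.rests C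
  | and A B => A.rests C ++ B.rests C
  | or A B => A.rests C ++ B.rests C

/-- Multiply the two sides of every atomic formula which involves `x` by the factor `k` that makes
the number of `x`s equal to `C`, add to both sides the terms `tⱼ` of all the other such atomic
formulas, and write `y` for the side `C x + t`, where `t` is the sum of all `tⱼ`. In the result,
`var 0` is `y`. The arguments `pre` and `post` are the lists of the `tⱼ` coming from the atomic
formulas to the left and to the right of the subformula under consideration. -/
def unify (C : ℕ) (pre post : List Term) : QF → QF
  | rel R t u =>
    if u.count < t.count then
      let k := C / (t.count - u.count)
      rel (R.scale k) (.var 0) (.sum (.smul k u.strip :: (pre ++ post)))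
    else if t.count < u.count then
      let k := C / (u.count - t.count)
      rel (R.scale k) (.sum (.smul k t.strip :: (pre ++ post))) (.var 0)
    else rel R t.strip u.strip
  | bot => bot
  | imp A B => imp (A.unify C pre (B.rests C ++ post)) (B.unify C (pre ++ A.rests C) post)
  | and A B => and (A.unify C pre (B.rests C ++ post)) (B.unify C (pre ++ A.rests C) post)
  | or A B => or (A.unify C pre (B.rests C ++ post)) (B.unify C (pre ++ A.rests C) post)

/-- The formula `t ≤ y ∧ y ≡ t (mod C) ∧ F''(y)`, where `t` is the sum of all `tᵢ` and
`F''(C x + t)` is equivalent to `F(x)`. -/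
def solved (C : ℕ) (F : QF) : QF :=
  let t := Term.sum (F.rests C)
  and (rel .le t (.var 0)) (and (rel (.mod C) (.var 0) t) (F.unify C [] []))

/-- The terms `t` of the atomic formulas `t ≤ y`, `y ≤ t`, `t = y`, `y = t`, where `y` is `var 0`.
As these terms do not contain `y`, instantiating `y` only renames their variables so that they are
read outside the quantifier on `y`. -/
def bounds : QF → List Term
  | rel (.mod _) _ _ => []
  | rel .eq t u =>
    if t = .var 0 then [u.inst .zero] else if u = .var 0 then [t.inst .zero] else []
  | rel .le t u =>
    if t = .var 0 then [u.inst .zero] else if u = .var 0 then [t.inst .zero] else []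
  | bot => []
  | imp A B => A.bounds ++ B.bounds
  | and A B => A.bounds ++ B.bounds
  | or A B => A.bounds ++ B.bounds

/-- The result of the elimination of `∃ x` from `∃ x, F(x)`: the disjunction of
`F'''(t + r)` over all `t ∈ T` and `0 ≤ r ≤ D`, where `F''' = F.solved C`, the set `T` consists of
`0` and of `F'''.bounds`, and `D` is the least common multiple of the moduli used in `F'''`. -/
def cooper (C : ℕ) (F : QF) : QF :=
  let G := F.solved C
  let T := (Term.zero :: G.bounds).dedup
  let D := G.moduli.foldr Nat.lcm 1
  disj (T.map fun t => disj ((List.range (D + 1)).map fun r => G.inst (.add t (.num r))))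

end QF

end PrA

/-! Write `t` for the sum of all `tᵢ` and `D` for the least common multiple of the moduli of `F'''`.
Two things are needed: an argument for the equivalence that `PrA_alt` can follow, and a polynomial
bound on its cost.

The equivalence. The conditions `t ≤ y` and `y ≡ t` modulo `C` say exactly that `y = C x + t` for
some `x` (`shift_of_modEq`). An atomic formula keeps its truth value when both sides are multiplied
by `k > 0`, with the modulus multiplied as well, and equal summands are added (`rel_scale_iff`). So
`∃ x, F(x)` amounts to `∃ y, F'''(y)` (`unify_iff`), and every instance of `F'''` yields a solution
of `F` (`ex_of_inst`). Conversely, let `F'''(y)` hold and let `s` be a greatest element of `T` with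
`s ≤ y`; there is one because `0` is in `T` (`gap_exists`). If `y = s`, the instance `s + 0` holds.
Otherwise division of `y - s - 1` by `D` gives `y' = s + r` with `1 ≤ r ≤ D`, `s < y' ≤ y` and `y' ≡
y` modulo `D` (`shift_exists`). Every bound is at most `s` or above `y`, so equations and
inequalities do not distinguish `y'` from `y`, and neither do the congruences. Hence `F'''(s + r)`
holds (`repl_iff`, `disj_of_solved`).

The cost. The numbers `C`, `D`, the length of `T` and all moduli are at most the size of `F'`, since
they are spelled out there in unary or as lists of disjuncts. Terms with the same values in `ℕ` are
provably equal with quadratically many nodes (`eq_of_eval`), and each linear step is one such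
identity followed by a cancellation (`lincomb`). A factor `k` is cancelled by means of the linear
order instead of an induction on `k` (`le_of_smul`, `eq_of_smul`). The greatest lower bound is found
by inserting one term after another, with a disjunction over `T` as invariant, so no orderings of
`T` are enumerated. Division by a composite `D` is not an axiom; it is obtained one prime factor at
a time. Each factor `p` opens `p` branches, and these numbers multiply to `D`, so the cost stays
polynomial in `D` (`division_mul`, `division`).

The bookkeeping. `Pf S n Γ A` records only the number of nodes and the size of the formulas on the
right. As each rule adds at most one assumption, taken up to a negation from a formula already
bounded, this bounds the contexts too, and with them the whole derivation (`Pf.exists_derivation`).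
-/

namespace PrA

/-! ## Substitution, size and evaluation of terms -/

namespace Term

@[simp] theorem up_zero (σ : ℕ → Term) : up σ 0 = var 0 := rfl
@[simp] theorem up_succ (σ : ℕ → Term) (i : ℕ) : up σ (i + 1) = (σ i).lift := rfl
@[simp] theorem single_zero (s : Term) : single s 0 = s := rfl
@[simp] theorem single_succ (s : Term) (i : ℕ) : single s (i + 1) = var i := rfl

theorem subst_subst (t : Term) (σ τ : ℕ → Term) :
    (t.subst σ).subst τ = t.subst fun i => (σ i).subst τ := by
  induction t <;> simp_all [subst]

@[simp] theorem subst_var (t : Term) : t.subst var = t := by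
  induction t <;> simp_all [subst]

@[simp] theorem lift_subst_up (t : Term) (σ : ℕ → Term) :
    t.lift.subst (up σ) = (t.subst σ).lift := by
  simp [lift, subst_subst, subst, up]

@[simp] theorem lift_inst (t s : Term) : t.lift.inst s = t := by
  simp [lift, inst, subst_subst, subst]

@[simp] theorem lift_subst_single (t s : Term) : t.lift.subst (single s) = t := lift_inst t s

@[simp] theorem inst_var_zero (s : Term) : (var 0).inst s = s := rfl
@[simp] theorem inst_zero (s : Term) : zero.inst s = zero := rfl
@[simp] theorem inst_one (s : Term) : one.inst s = one := rfl
@[simp] theorem inst_add (t u s : Term) : (add t u).inst s = add (t.inst s) (u.inst s) := rfl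

@[simp] theorem lift_var (i : ℕ) : (var i).lift = var (i + 1) := rfl
@[simp] theorem lift_zero : zero.lift = zero := rfl
@[simp] theorem lift_one : one.lift = one := rfl
@[simp] theorem lift_add (t u : Term) : (add t u).lift = add t.lift u.lift := rfl

@[simp] theorem subst_sum (l : List Term) (σ : ℕ → Term) :
    (sum l).subst σ = sum (l.map fun t => t.subst σ) := by
  induction l with
  | nil => rfl
  | cons a l ih => cases l <;> simp_all [sum, subst]

@[simp] theorem subst_smul (k : ℕ) (t : Term) (σ : ℕ → Term) :
    (smul k t).subst σ = smul k (t.subst σ) := by simp [smul]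

@[simp] theorem subst_num (k : ℕ) (σ : ℕ → Term) : (num k).subst σ = num k := by
  simp [num, subst]

@[simp] theorem lift_smul (k : ℕ) (t : Term) : (smul k t).lift = smul k t.lift := by simp [lift]
@[simp] theorem lift_num (k : ℕ) : (num k).lift = num k := by simp [lift]
@[simp] theorem inst_smul (k : ℕ) (t s : Term) : (smul k t).inst s = smul k (t.inst s) := by
  simp [inst]
@[simp] theorem inst_num (k : ℕ) (s : Term) : (num k).inst s = num k := by simp [inst]

theorem size_pos (t : Term) : 0 < t.size := by cases t <;> simp [size]

@[simp] theorem size_lift (t : Term) : t.lift.size = t.size := by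
  induction t <;> simp_all [size]

theorem size_le_size_subst (t : Term) (σ : ℕ → Term) : t.size ≤ (t.subst σ).size := by
  induction t with
  | var i => exact size_pos _
  | zero => simp [subst]
  | one => simp [subst]
  | add t u => simp only [subst, size]; omega

theorem size_subst_le (t : Term) {σ : ℕ → Term} {b : ℕ} (h : ∀ i, (σ i).size ≤ b) :
    (t.subst σ).size ≤ t.size * b := by
  have hb : 0 < b := (size_pos _).trans_le (h 0)
  induction t with
  | var i => simpa [subst, size] using h i
  | zero => simpa [subst, size, Nat.one_le_iff_ne_zero] using hb.ne'
  | one => simpa [subst, size, Nat.one_le_iff_ne_zero] using hb.ne'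
  | add t u h1 h2 =>
    simp only [subst, size, add_mul]
    omega

theorem size_sum_le (l : List Term) : (sum l).size ≤ (l.map fun t => t.size + 1).sum + 1 := by
  induction l with
  | nil => simp [sum, size]
  | cons a l ih =>
    cases l with
    | nil => simp [sum]; omega
    | cons b l => simp only [sum, size, List.map_cons, List.sum_cons] at *; omega

theorem size_smul_le (k : ℕ) (t : Term) : (smul k t).size ≤ k * (t.size + 1) + 1 := by
  simpa [smul] using size_sum_le (List.replicate k t)

theorem size_num_le (k : ℕ) : (num k).size ≤ 2 * k + 1 := by
  have := size_smul_le k one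
  simp only [size] at this
  rw [num]; omega

/-- The value of a term in `ℕ`. -/
def eval (ρ : ℕ → ℕ) : Term → ℕ
  | var i => ρ i
  | zero => 0
  | one => 1
  | add t u => t.eval ρ + u.eval ρ

theorem eval_subst (ρ : ℕ → ℕ) (σ : ℕ → Term) (t : Term) :
    (t.subst σ).eval ρ = t.eval fun i => (σ i).eval ρ := by
  induction t <;> simp_all [subst, eval]

theorem eval_lift (ρ : ℕ → ℕ) (t : Term) : t.lift.eval ρ = t.eval fun i => ρ (i + 1) := by
  simp [lift, eval_subst, eval]

@[simp] theorem eval_sum (ρ : ℕ → ℕ) (l : List Term) :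
    (sum l).eval ρ = (l.map fun t => t.eval ρ).sum := by
  induction l with
  | nil => rfl
  | cons a l ih => cases l <;> simp_all [sum, eval]

@[simp] theorem eval_smul (ρ : ℕ → ℕ) (k : ℕ) (t : Term) :
    (smul k t).eval ρ = k * t.eval ρ := by
  simp [smul]

@[simp] theorem eval_num (ρ : ℕ → ℕ) (k : ℕ) : (num k).eval ρ = k := by simp [num, eval]

end Term

/-! ### Substitution into formulas, and sizes of formulas -/

namespace Fml

theorem up_comp (σ τ : ℕ → Term) :
    (fun i => (Term.up σ i).subst (Term.up τ)) = Term.up fun i => (σ i).subst τ := by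
  funext i
  cases i <;> simp [Term.subst]

theorem subst_subst (A : Fml) (σ τ : ℕ → Term) :
    (A.subst σ).subst τ = A.subst fun i => (σ i).subst τ := by
  induction A generalizing σ τ <;> simp_all [subst, Term.subst_subst, up_comp]

@[simp] theorem up_var : Term.up Term.var = Term.var := by
  funext i
  cases i <;> simp

@[simp] theorem subst_var (A : Fml) : A.subst Term.var = A := by
  induction A <;> simp_all [subst]

@[simp] theorem lift_eq (t u : Term) : (eq t u).lift = eq t.lift u.lift := rfl
@[simp] theorem lift_bot : bot.lift = bot := rfl
@[simp] theorem lift_imp (A B : Fml) : (imp A B).lift = imp A.lift B.lift := rfl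
@[simp] theorem lift_and (A B : Fml) : (and A B).lift = and A.lift B.lift := rfl
@[simp] theorem lift_or (A B : Fml) : (or A B).lift = or A.lift B.lift := rfl
@[simp] theorem lift_neg (A : Fml) : (neg A).lift = neg A.lift := rfl
@[simp] theorem inst_eq (t u s : Term) : (eq t u).inst s = eq (t.inst s) (u.inst s) := rfl
@[simp] theorem inst_bot (s : Term) : bot.inst s = bot := rfl
@[simp] theorem inst_imp (A B : Fml) (s : Term) : (imp A B).inst s = imp (A.inst s) (B.inst s) := rfl
@[simp] theorem inst_or (A B : Fml) (s : Term) : (or A B).inst s = or (A.inst s) (B.inst s) := rfl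

@[simp] theorem subst_le (t u : Term) (σ : ℕ → Term) :
    (le t u).subst σ = le (t.subst σ) (u.subst σ) := by
  simp [le, subst, Term.subst]

@[simp] theorem subst_modEq (m : ℕ) (t u : Term) (σ : ℕ → Term) :
    (modEq m t u).subst σ = modEq m (t.subst σ) (u.subst σ) := by
  simp [modEq, subst, Term.subst]

@[simp] theorem lift_le (t u : Term) : (le t u).lift = le t.lift u.lift := subst_le t u _
@[simp] theorem lift_modEq (m : ℕ) (t u : Term) : (modEq m t u).lift = modEq m t.lift u.lift :=
  subst_modEq m t u _
@[simp] theorem inst_le (t u s : Term) : (le t u).inst s = le (t.inst s) (u.inst s) :=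
  subst_le t u _
@[simp] theorem inst_modEq (m : ℕ) (t u s : Term) :
    (modEq m t u).inst s = modEq m (t.inst s) (u.inst s) := subst_modEq m t u _

theorem subst_disj (l : List Fml) (σ : ℕ → Term) :
    (disj l).subst σ = disj (l.map fun A => A.subst σ) := by
  induction l with
  | nil => rfl
  | cons a l ih => cases l <;> simp_all [disj, subst]

@[simp] theorem lift_disj (l : List Fml) : (disj l).lift = disj (l.map lift) := subst_disj l _
@[simp] theorem inst_disj (l : List Fml) (s : Term) :
    (disj l).inst s = disj (l.map fun A => A.inst s) := subst_disj l _

@[simp] theorem size_neg (A : Fml) : A.neg.size = A.size + 2 := rfl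

theorem size_pos (A : Fml) : 0 < A.size := by cases A <;> simp [size]

theorem size_le_size_subst (A : Fml) (σ : ℕ → Term) : A.size ≤ (A.subst σ).size := by
  induction A generalizing σ with
  | eq t u =>
    have := t.size_le_size_subst σ
    have := u.size_le_size_subst σ
    simp only [subst, size]; omega
  | bot => simp [subst]
  | imp A B h1 h2 | and A B h1 h2 | or A B h1 h2 =>
    have := h1 σ
    have := h2 σ
    simp only [subst, size]; omega
  | all A h | ex A h =>
    have := h (Term.up σ)
    simp only [subst, size]; omega

theorem size_subst_le (A : Fml) {σ : ℕ → Term} {b : ℕ} (h : ∀ i, (σ i).size ≤ b) :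
    (A.subst σ).size ≤ A.size * b := by
  have hb : 0 < b := (Term.size_pos _).trans_le (h 0)
  have hup : ∀ σ : ℕ → Term, (∀ i, (σ i).size ≤ b) → ∀ i, (Term.up σ i).size ≤ b := by
    rintro σ h (_ | i)
    · exact hb
    · simpa using h i
  induction A generalizing σ with
  | eq t u =>
    have := t.size_subst_le h
    have := u.size_subst_le h
    simp only [subst, size, add_mul]; omega
  | bot => simp only [subst, size]; omega
  | imp A B h1 h2 | and A B h1 h2 | or A B h1 h2 =>
    have := h1 h
    have := h2 h
    simp only [subst, size, add_mul]; omega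
  | all A ih | ex A ih =>
    have := ih (hup σ h)
    simp only [subst, size, add_mul]; omega

@[simp] theorem size_lift (A : Fml) : A.lift.size = A.size :=
  le_antisymm (by
    have := A.size_subst_le (σ := fun i => Term.var (i + 1)) (b := 1) (by simp [Term.size])
    simpa [lift] using this) (A.size_le_size_subst _)

@[simp] theorem size_le (t u : Term) : (le t u).size = t.size + u.size + 5 := by
  simp [le, size, Term.size]; omega

theorem size_modEq_le (m : ℕ) (t u : Term) :
    (modEq m t u).size ≤ 2 * t.size + 2 * u.size + 4 * m + 20 := by
  have := Term.size_smul_le m (.var 0)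
  simp only [modEq, size, Term.size, Term.size_lift] at *
  omega

theorem size_le_size_disj {l : List Fml} {A : Fml} (h : A ∈ l) : A.size ≤ (disj l).size := by
  induction l with
  | nil => simp at h
  | cons a l ih =>
    cases l with
    | nil => simp_all [disj]
    | cons b l =>
      rcases List.mem_cons.1 h with rfl | h
      · simp only [disj, size]; omega
      · have := ih h
        simp only [disj, size]; omega

theorem length_le_size_disj (l : List Fml) : l.length ≤ (disj l).size := by
  induction l with
  | nil => simp
  | cons a l ih =>
    have := a.size_pos
    cases l with
    | nil => simp only [disj, List.length_cons, List.length_nil]; omega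
    | cons b l => simp only [disj, size, List.length_cons] at *; omega

theorem size_disj_le {l : List Fml} {b : ℕ} (h : ∀ A ∈ l, A.size ≤ b) :
    (disj l).size ≤ l.length * (b + 1) + 1 := by
  induction l with
  | nil => simp [disj, size]
  | cons a l ih =>
    have h1 := h a (by simp)
    have h2 := ih fun A hA => h A (by simp [hA])
    cases l with
    | nil => simp [disj]; omega
    | cons c l => simp only [disj, size, List.length_cons, add_mul] at *; omega

end Fml

/-! ## Derivations with few nodes and small formulas -/

/-- `Pf S n Γ A` states that there is a derivation of `Γ ⊢ A` with at most `n` nodes in which the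
formula on the right-hand side of every sequent has size at most `S`. -/
inductive Pf (S : ℕ) : ℕ → List Fml → Fml → Prop
  | mono {n m : ℕ} {Γ : List Fml} {A : Fml} : Pf S n Γ A → n ≤ m → Pf S m Γ A
  | hyp {Γ : List Fml} {A : Fml} : A ∈ Γ → A.size ≤ S → Pf S 1 Γ A
  | ax {Γ : List Fml} {A : Fml} : A ∈ PrAalt → A.size ≤ S → Pf S 1 Γ A
  | weaken {n : ℕ} {Γ Δ : List Fml} {A : Fml} :
      Γ ⊆ Δ → Γ.length ≤ Δ.length → Pf S n Γ A → Pf S (n + 1) Δ A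
  | impI {n : ℕ} {Γ : List Fml} {A B : Fml} :
      (Fml.imp A B).size ≤ S → Pf S n (A :: Γ) B → Pf S (n + 1) Γ (.imp A B)
  | impE {n m : ℕ} {Γ : List Fml} {A B : Fml} :
      Pf S n Γ (.imp A B) → Pf S m Γ A → Pf S (n + m + 1) Γ B
  | andI {n m : ℕ} {Γ : List Fml} {A B : Fml} :
      (Fml.and A B).size ≤ S → Pf S n Γ A → Pf S m Γ B → Pf S (n + m + 1) Γ (.and A B)
  | andE₁ {n : ℕ} {Γ : List Fml} {A B : Fml} : Pf S n Γ (.and A B) → Pf S (n + 1) Γ A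
  | andE₂ {n : ℕ} {Γ : List Fml} {A B : Fml} : Pf S n Γ (.and A B) → Pf S (n + 1) Γ B
  | orI₁ {n : ℕ} {Γ : List Fml} {A B : Fml} :
      (Fml.or A B).size ≤ S → Pf S n Γ A → Pf S (n + 1) Γ (.or A B)
  | orI₂ {n : ℕ} {Γ : List Fml} {A B : Fml} :
      (Fml.or A B).size ≤ S → Pf S n Γ B → Pf S (n + 1) Γ (.or A B)
  | orE {n m k : ℕ} {Γ : List Fml} {A B C : Fml} : Pf S n Γ (.or A B) →
      Pf S m (A :: Γ) C → Pf S k (B :: Γ) C → Pf S (n + m + k + 1) Γ C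
  | raa {n : ℕ} {Γ : List Fml} {A : Fml} :
      A.size ≤ S → Pf S n (A.neg :: Γ) .bot → Pf S (n + 1) Γ A
  | allE {n : ℕ} {Γ : List Fml} {A : Fml} (t : Term) :
      (A.inst t).size ≤ S → Pf S n Γ (.all A) → Pf S (n + 1) Γ (A.inst t)
  | exI {n : ℕ} {Γ : List Fml} {A : Fml} (t : Term) :
      A.size + 2 ≤ S → Pf S n Γ (A.inst t) → Pf S (n + 1) Γ (.ex A)
  | exE {n m : ℕ} {Γ : List Fml} {A B : Fml} : Pf S n Γ (.ex A) →
      Pf S m (A :: Γ.map Fml.lift) B.lift → Pf S (n + m + 1) Γ B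
  | eqI {Γ : List Fml} (t : Term) : (Fml.eq t t).size ≤ S → Pf S 1 Γ (.eq t t)
  | eqE {n m : ℕ} {Γ : List Fml} (A : Fml) {s t : Term} : (A.inst t).size ≤ S →
      Pf S n Γ (.eq s t) → Pf S m Γ (A.inst s) → Pf S (n + m + 1) Γ (A.inst t)

namespace Pf

variable {S n m k : ℕ} {Γ Δ : List Fml} {A B C : Fml} {a b c d t u : Term}

/-- Rules without an explicit size condition conclude a formula that is no larger than the
right-hand side of one of their premises. -/
theorem size_le (h : Pf S n Γ A) : A.size ≤ S := by
  induction h <;> (try simp only [Fml.size, Fml.size_lift] at *) <;> omega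

/-- The slack of `2` for the context pays for the negation assumed by `raa`, the only assumption
that need not be part of a formula already bounded by `S`. -/
theorem seqSize_le {L : ℕ} (hA : A.size ≤ S) (hΓ : ∀ B ∈ Γ, B.size ≤ S + 2)
    (hL : Γ.length ≤ L) : seqSize Γ A ≤ (L + 1) * (S + 3) := by
  have h1 : (Γ.map fun B => B.size + 1).sum ≤ Γ.length * (S + 3) := by
    simpa only [List.length_map, smul_eq_mul] using List.sum_le_card_nsmul (Γ.map fun B => B.size + 1) (S + 3) (by
      simp only [List.mem_map]
      rintro _ ⟨B, hB, rfl⟩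
      have := hΓ B hB
      omega)
  have h2 : Γ.length * (S + 3) ≤ L * (S + 3) := Nat.mul_le_mul_right _ hL
  rw [seqSize, add_mul]
  omega

/-- A derivation with few nodes and small formulas is small. -/
theorem exists_derivation (h : Pf S n Γ A) : ∀ L : ℕ, (∀ B ∈ Γ, B.size ≤ S + 2) →
    Γ.length + n ≤ L → ∃ d : Derivation PrAalt Γ A, d.size ≤ n * ((L + 1) * (S + 3)) := by
  -- `L` stays fixed: a premise has at most one assumption more than the conclusion and at least one
  -- node fewer, so context length plus number of nodes does not increase towards the leaves.
  induction h with
  | mono h hnm ih =>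
    intro L hΓ hL
    obtain ⟨d, hd⟩ := ih L hΓ (by omega)
    exact ⟨d, hd.trans (Nat.mul_le_mul_right _ hnm)⟩
  | hyp h hS =>
    intro L hΓ hL
    refine ⟨.hyp h, ?_⟩
    have := seqSize_le hS hΓ (L := L) (by omega)
    simpa [Derivation.size] using this
  | ax h hS =>
    intro L hΓ hL
    refine ⟨.ax h, ?_⟩
    have := seqSize_le hS hΓ (L := L) (by omega)
    simpa [Derivation.size] using this
  | weaken hs hl h ih =>
    intro L hΓ hL
    obtain ⟨d, hd⟩ := ih L (fun B hB => hΓ B (hs hB)) (by omega)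
    refine ⟨.weaken hs d, ?_⟩
    have := seqSize_le h.size_le hΓ (L := L) (by omega)
    rw [Derivation.size, add_mul]
    omega
  | impI hS h ih =>
    intro L hΓ hL
    obtain ⟨d, hd⟩ := ih L (by
      simp only [List.mem_cons, forall_eq_or_imp, Fml.size] at *
      exact ⟨by omega, hΓ⟩) (by simp only [List.length_cons]; omega)
    refine ⟨.impI d, ?_⟩
    have := seqSize_le hS hΓ (L := L) (by omega)
    rw [Derivation.size, add_mul]
    omega
  | impE h1 h2 ih1 ih2 =>
    intro L hΓ hL
    obtain ⟨d1, hd1⟩ := ih1 L hΓ (by omega)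
    obtain ⟨d2, hd2⟩ := ih2 L hΓ (by omega)
    refine ⟨.impE d1 d2, ?_⟩
    have := seqSize_le (impE h1 h2).size_le hΓ (L := L) (by omega)
    rw [Derivation.size, add_mul, add_mul]
    omega
  | andI hS h1 h2 ih1 ih2 =>
    intro L hΓ hL
    obtain ⟨d1, hd1⟩ := ih1 L hΓ (by omega)
    obtain ⟨d2, hd2⟩ := ih2 L hΓ (by omega)
    refine ⟨.andI d1 d2, ?_⟩
    have := seqSize_le hS hΓ (L := L) (by omega)
    rw [Derivation.size, add_mul, add_mul]
    omega
  | andE₁ h ih =>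
    intro L hΓ hL
    obtain ⟨d, hd⟩ := ih L hΓ (by omega)
    refine ⟨.andE₁ d, ?_⟩
    have := seqSize_le (andE₁ h).size_le hΓ (L := L) (by omega)
    rw [Derivation.size, add_mul]
    omega
  | andE₂ h ih =>
    intro L hΓ hL
    obtain ⟨d, hd⟩ := ih L hΓ (by omega)
    refine ⟨.andE₂ d, ?_⟩
    have := seqSize_le (andE₂ h).size_le hΓ (L := L) (by omega)
    rw [Derivation.size, add_mul]
    omega
  | orI₁ hS h ih =>
    intro L hΓ hL
    obtain ⟨d, hd⟩ := ih L hΓ (by omega)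
    refine ⟨.orI₁ d, ?_⟩
    have := seqSize_le hS hΓ (L := L) (by omega)
    rw [Derivation.size, add_mul]
    omega
  | orI₂ hS h ih =>
    intro L hΓ hL
    obtain ⟨d, hd⟩ := ih L hΓ (by omega)
    refine ⟨.orI₂ d, ?_⟩
    have := seqSize_le hS hΓ (L := L) (by omega)
    rw [Derivation.size, add_mul]
    omega
  | orE h1 h2 h3 ih1 ih2 ih3 =>
    intro L hΓ hL
    have hAB := h1.size_le
    simp only [Fml.size] at hAB
    obtain ⟨d1, hd1⟩ := ih1 L hΓ (by omega)
    obtain ⟨d2, hd2⟩ := ih2 L (by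
      simp only [List.mem_cons, forall_eq_or_imp]
      exact ⟨by omega, hΓ⟩) (by simp only [List.length_cons]; omega)
    obtain ⟨d3, hd3⟩ := ih3 L (by
      simp only [List.mem_cons, forall_eq_or_imp]
      exact ⟨by omega, hΓ⟩) (by simp only [List.length_cons]; omega)
    refine ⟨.orE d1 d2 d3, ?_⟩
    have := seqSize_le h2.size_le hΓ (L := L) (by omega)
    rw [Derivation.size, add_mul, add_mul, add_mul]
    omega
  | raa hS h ih =>
    intro L hΓ hL
    obtain ⟨d, hd⟩ := ih L (by
      simp only [List.mem_cons, forall_eq_or_imp, Fml.size_neg]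
      exact ⟨by omega, hΓ⟩) (by simp only [List.length_cons]; omega)
    refine ⟨.raa d, ?_⟩
    have := seqSize_le hS hΓ (L := L) (by omega)
    rw [Derivation.size, add_mul]
    omega
  | allE t hS h ih =>
    intro L hΓ hL
    obtain ⟨d, hd⟩ := ih L hΓ (by omega)
    refine ⟨.allE t d, ?_⟩
    have := seqSize_le hS hΓ (L := L) (by omega)
    rw [Derivation.size, add_mul]
    omega
  | @exI _ _ A t hS h ih =>
    intro L hΓ hL
    obtain ⟨d, hd⟩ := ih L hΓ (by omega)
    refine ⟨.exI t d, ?_⟩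
    have := seqSize_le (A := .ex A) hS hΓ (L := L) (by omega)
    rw [Derivation.size, add_mul]
    omega
  | exE h1 h2 ih1 ih2 =>
    intro L hΓ hL
    have hA := h1.size_le
    have hB := h2.size_le
    simp only [Fml.size, Fml.size_lift] at hA hB
    obtain ⟨d1, hd1⟩ := ih1 L hΓ (by omega)
    obtain ⟨d2, hd2⟩ := ih2 L (by
      simp only [List.mem_cons, forall_eq_or_imp, List.forall_mem_map, Fml.size_lift]
      exact ⟨by omega, hΓ⟩) (by simp only [List.length_cons, List.length_map]; omega)
    refine ⟨.exE d1 d2, ?_⟩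
    have := seqSize_le hB hΓ (L := L) (by omega)
    rw [Derivation.size, add_mul, add_mul]
    omega
  | eqI t hS =>
    intro L hΓ hL
    refine ⟨.eqI t, ?_⟩
    have := seqSize_le hS hΓ (L := L) (by omega)
    simpa [Derivation.size] using this
  | eqE A hS h1 h2 ih1 ih2 =>
    intro L hΓ hL
    obtain ⟨d1, hd1⟩ := ih1 L hΓ (by omega)
    obtain ⟨d2, hd2⟩ := ih2 L hΓ (by omega)
    refine ⟨.eqE A d1 d2, ?_⟩
    have := seqSize_le hS hΓ (L := L) (by omega)
    rw [Derivation.size, add_mul, add_mul]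
    omega

end Pf
end PrA

namespace PrA
namespace Pf

variable {S B n m k : ℕ} {Γ Δ : List Fml} {A A' C : Fml} {a b c d t u : Term}

/-! ## Structural rules -/

theorem cut (hS : A.size + C.size + 1 ≤ S) (h1 : Pf S n Γ A) (h2 : Pf S m (A :: Γ) C) :
    Pf S (n + m + 2) Γ C :=
  (impE (impI hS h2) h1).mono (by omega)

/-- With this, a rule on arbitrary premises is proved from hypotheses in an explicit short context.
The premise is then derived only once however often it is used, and the lifts of the context can be
computed. -/
theorem app₁ (hS : A.size + C.size + 1 ≤ S) (h : Pf S m [A] C) (h1 : Pf S n Γ A) :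
    Pf S (n + m + 3) Γ C :=
  (cut hS h1 (weaken (by simp) (by simp) h)).mono (by omega)

theorem app₂ (hS : A.size + (A'.size + C.size + 1) + 1 ≤ S) (h : Pf S m [A, A'] C)
    (h1 : Pf S n Γ A) (h2 : Pf S k Γ A') : Pf S (n + k + m + 5) Γ C :=
  (impE (impE (weaken (Γ := []) (by simp) (by simp)
    (impI (A := A') (B := .imp A C) (by simp only [Fml.size]; omega)
      (impI (by simp only [Fml.size]; omega) h))) h2) h1).mono (by omega)

/-! ## Equality -/

theorem eqE' (A : Fml) (hA : A.inst a = C) (hA' : A.inst b = A') (hS : A'.size ≤ S)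
    (h : Pf S n Γ (.eq a b)) (h' : Pf S m Γ C) : Pf S (n + m + 1) Γ A' := by
  subst hA hA'
  exact eqE A hS h h'

theorem symm (h : Pf S n Γ (.eq a b)) (ha : 2 * a.size + 1 ≤ S) : Pf S (n + 2) Γ (.eq b a) :=
  eqE' (.eq (.var 0) a.lift) (C := .eq a a) (by simp) (by simp)
    (by have := h.size_le; simp only [Fml.size] at *; omega) h
    (eqI a (by simp only [Fml.size]; omega))

theorem trans (h : Pf S n Γ (.eq a b)) (h' : Pf S m Γ (.eq b c)) (hS : a.size + c.size + 1 ≤ S) :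
    Pf S (n + m + 1) Γ (.eq a c) :=
  (eqE' (.eq a.lift (.var 0)) (by simp) (by simp) hS h' h).mono (by omega)

theorem add_congr (h : Pf S n Γ (.eq a b)) (h' : Pf S m Γ (.eq c d))
    (hS : 2 * a.size + 2 * b.size + 2 * c.size + d.size + 3 ≤ S) :
    Pf S (n + m + 3) Γ (.eq (.add a c) (.add b d)) :=
  (eqE' (.eq (Term.add a c).lift (Term.add b.lift (.var 0))) (by simp; rfl) (by simp)
    (by simp only [Fml.size, Term.size]; omega) h'
    (eqE' (.eq (Term.add a c).lift (Term.add (.var 0) c.lift)) (by simp) (by simp)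
      (by simp only [Fml.size, Term.size]; omega) h
      (eqI (.add a c) (by simp only [Fml.size, Term.size]; omega)))).mono (by omega)

/-- A single use of `eqE` replaces all `k` summands at once, so the number of nodes does not depend
on `k`. -/
theorem smul_congr (k : ℕ) (h : Pf S n Γ (.eq a b))
    (hS : 2 * (Term.smul k a).size + 1 ≤ S) (hS' : (Term.smul k a).size + (Term.smul k b).size + 1 ≤ S) :
    Pf S (n + 2) Γ (.eq (.smul k a) (.smul k b)) :=
  eqE' (.eq (Term.smul k a).lift (.smul k (.var 0))) (by simp) (by simp) hS' h
    (eqI (.smul k a) (by simp only [Fml.size]; omega))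

/-! ## The axioms of `PrA⁻` -/

theorem add_assoc (hS : 2 * a.size + 2 * b.size + 2 * c.size + 20 ≤ S) :
    Pf S 4 Γ (.eq (.add (.add a b) c) (.add a (.add b c))) := by
  have h0 := ax (S := S) (Γ := Γ) (.inl .add_assoc) (by simp [Fml.size, Term.size]; omega)
  have h1 := allE a (by simp [Fml.size, Term.size, Fml.inst, Fml.subst, Term.subst]; omega) h0
  simp only [Fml.inst, Fml.subst, Term.subst, Term.up_zero, Term.up_succ, Term.single] at h1
  have h2 := allE b (by simp [Fml.size, Term.size, Fml.inst, Fml.subst, Term.subst]; omega) h1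
  simp only [Fml.inst, Fml.subst, Term.subst, Term.up_zero] at h2
  have h3 := allE c (by simp [Fml.size, Term.size, Fml.inst, Fml.subst, Term.subst]; omega) h2
  simpa [Fml.inst, Fml.subst, Term.subst] using h3

theorem add_comm (hS : 2 * a.size + 2 * b.size + 20 ≤ S) :
    Pf S 3 Γ (.eq (.add a b) (.add b a)) := by
  have h0 := ax (S := S) (Γ := Γ) (.inl .add_comm) (by simp [Fml.size, Term.size]; omega)
  have h1 := allE a (by simp [Fml.size, Term.size, Fml.inst, Fml.subst, Term.subst]; omega) h0
  simp only [Fml.inst, Fml.subst, Term.subst, Term.up_zero, Term.up_succ, Term.single] at h1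
  have h2 := allE b (by simp [Fml.size, Term.size, Fml.inst, Fml.subst, Term.subst]; omega) h1
  simpa [Fml.inst, Fml.subst, Term.subst] using h2

theorem add_zero (hS : 2 * a.size + 20 ≤ S) : Pf S 2 Γ (.eq (.add a .zero) a) := by
  have h0 := ax (S := S) (Γ := Γ) (.inl .add_zero) (by simp [Fml.size, Term.size]; omega)
  have h1 := allE a (by simp [Fml.size, Term.size, Fml.inst, Fml.subst, Term.subst]; omega) h0
  simpa [Fml.inst, Fml.subst, Term.subst] using h1

theorem add_cancel (hS : 2 * a.size + 2 * b.size + 2 * c.size + 20 ≤ S)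
    (h : Pf S n Γ (.eq (.add a c) (.add b c))) : Pf S (n + 5) Γ (.eq a b) := by
  have h0 := ax (S := S) (Γ := Γ) (.inl .add_cancel) (by simp [Fml.size, Term.size]; omega)
  have h1 := allE a (by simp [Fml.size, Term.size, Fml.inst, Fml.subst, Term.subst]; omega) h0
  simp only [Fml.inst, Fml.subst, Term.subst, Term.up_zero, Term.up_succ, Term.single] at h1
  have h2 := allE b (by simp [Fml.size, Term.size, Fml.inst, Fml.subst, Term.subst]; omega) h1
  simp only [Fml.inst, Fml.subst, Term.subst, Term.up_zero] at h2
  have h3 := allE c (by simp [Fml.size, Term.size, Fml.inst, Fml.subst, Term.subst]; omega) h2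
  refine (impE (A := .eq (.add a c) (.add b c)) (n := 4) ?_ h).mono (by omega)
  simpa [Fml.inst, Fml.subst, Term.subst] using h3

theorem succ_ne_zero (hS : a.size + 20 ≤ S) (h : Pf S n Γ (.eq (.add a .one) .zero)) :
    Pf S (n + 3) Γ .bot := by
  have h0 := ax (S := S) (Γ := Γ) (.inl .succ_ne_zero) (by simp [Fml.size, Term.size]; omega)
  have h1 := allE a (by simp [Fml.size, Term.size, Fml.inst, Fml.subst, Term.subst, Fml.neg]; omega) h0
  refine (impE (A := .eq (.add a .one) .zero) (n := 2) ?_ h).mono (by omega)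
  simpa [Fml.inst, Fml.subst, Term.subst, Fml.neg] using h1

theorem exists_pred (hS : 2 * a.size + 20 ≤ S) (h : Pf S n Γ (.neg (.eq a .zero))) :
    Pf S (n + 3) Γ (.ex (.eq a.lift (.add (.var 0) .one))) := by
  have h0 := ax (S := S) (Γ := Γ) (.inl .exists_pred) (by simp [Fml.size, Term.size]; omega)
  have h1 := allE a (by simp [Fml.size, Term.size, Fml.inst, Fml.subst, Term.subst, Fml.neg]; omega) h0
  refine (impE (A := .neg (.eq a .zero)) (n := 2) ?_ h).mono (by omega)
  simpa [Fml.inst, Fml.subst, Term.subst, Fml.neg] using h1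

theorem le_total (hS : 3 * a.size + 3 * b.size + 30 ≤ S) :
    Pf S 3 Γ (.or (.le a b) (.le b a)) := by
  have h0 := ax (S := S) (Γ := Γ) (.inl .le_total) (by simp [Fml.size, Term.size]; omega)
  have h1 := allE a (by simp [Fml.size, Term.size, Fml.inst, Fml.subst, Term.subst]; omega) h0
  simp only [Fml.inst, Fml.subst, Fml.subst_le, Term.subst, Term.up_zero, Term.up_succ,
    Term.single] at h1
  have h2 := allE b (by simp [Fml.size, Fml.inst, Fml.subst, Term.subst]; omega) h1
  simpa [Fml.inst, Fml.subst, Term.subst] using h2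

end Pf

/-! ## Terms with the same value are provably equal -/

namespace Term

/-- The list of the variables and ones occurring in a term. -/
def atoms : Term → List Term
  | var i => [var i]
  | zero => []
  | one => [one]
  | add t u => t.atoms ++ u.atoms

/-- The sum `t₁ + (⋯ + (tₙ + 0))`. -/
def sum₀ : List Term → Term
  | [] => zero
  | t :: l => add t (sum₀ l)

theorem length_atoms_le (t : Term) : t.atoms.length ≤ t.size := by
  induction t <;> simp [atoms, size] at *; omega

theorem size_of_mem_atoms {t a : Term} (h : a ∈ t.atoms) : a.size = 1 := by
  induction t <;> simp [atoms] at h <;> try simp [h, size]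
  all_goals grind

theorem size_sum₀ {l : List Term} (h : ∀ a ∈ l, a.size = 1) : (sum₀ l).size = 2 * l.length + 1 := by
  induction l with
  | nil => rfl
  | cons a l ih => simp_all [sum₀, size]; omega

theorem count_one_atoms (t : Term) : t.atoms.count one = t.eval fun _ => 0 := by
  induction t <;> simp_all [atoms, eval]

theorem count_var_atoms (t : Term) (i : ℕ) :
    t.eval (fun j => if j = i then 1 else 0) = t.atoms.count (var i) + t.eval fun _ => 0 := by
  induction t with
  | var j => by_cases h : j = i <;> simp [atoms, eval, h]
  | zero => simp [atoms, eval]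
  | one => simp [atoms, eval]
  | add t u h1 h2 => simp [atoms, eval, h1, h2]; omega

/-- The zero valuation counts the ones, and the indicator valuation of a variable adds to this the
number of its occurrences, so the values determine the multiset of atoms. -/
theorem atoms_perm {t u : Term} (h : ∀ ρ, t.eval ρ = u.eval ρ) : t.atoms.Perm u.atoms := by
  have h0 : ∀ (t : Term), t.atoms.count zero = 0 := by
    intro t; induction t <;> simp_all [atoms]
  have h1 : ∀ (t a b : Term), t.atoms.count (add a b) = 0 := by
    intro t; induction t <;> simp_all [atoms]
  rw [List.perm_iff_count]
  rintro (i | _ | _ | ⟨a, b⟩)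
  · have := count_var_atoms t i
    have := count_var_atoms u i
    have := h fun j => if j = i then 1 else 0
    have := h fun _ => 0
    omega
  · rw [h0, h0]
  · rw [count_one_atoms, count_one_atoms, h]
  · rw [h1, h1]

end Term

namespace Pf

open Term

variable {S n m k : ℕ} {Γ : List Fml} {t u : Term}

theorem sum₀_append (l₁ l₂ : List Term) (h : ∀ a ∈ l₁ ++ l₂, a.size = 1)
    (hS : 20 * (l₁ ++ l₂).length + 40 ≤ S) :
    Pf S (10 * l₁.length + 10) Γ (.eq (add (sum₀ l₁) (sum₀ l₂)) (sum₀ (l₁ ++ l₂))) := by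
  have hl₂ : (sum₀ l₂).size = 2 * l₂.length + 1 := size_sum₀ fun a ha => h a (by simp [ha])
  induction l₁ with
  | nil =>
    simp only [List.nil_append, sum₀] at *
    exact (trans (add_comm (by simp only [size]; omega)) (add_zero (by omega))
      (by simp only [size]; omega)).mono (by simp)
  | cons a l₁ ih =>
    have ha : a.size = 1 := h a (by simp)
    have hl₁ : (sum₀ l₁).size = 2 * l₁.length + 1 := size_sum₀ fun a ha => h a (by simp [ha])
    have hl : (sum₀ (l₁ ++ l₂)).size = 2 * (l₁ ++ l₂).length + 1 :=
      size_sum₀ fun a ha => h a (by simp at *; tauto)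
    simp only [List.cons_append, sum₀, List.length_cons, List.length_append] at *
    have h1 := ih (fun a ha => h a (by simp at *; tauto)) (by omega)
    exact (trans (add_assoc (by omega)) (add_congr (eqI a (by simp only [Fml.size]; omega)) h1
      (by simp only [size]; omega)) (by simp only [size]; omega)).mono (by omega)

theorem eq_sum₀_atoms (t : Term) (hS : 20 * t.size + 40 ≤ S) :
    Pf S (20 * t.size * t.size) Γ (.eq t (sum₀ t.atoms)) := by
  induction t with
  | var i | one =>
    simp only [size] at hS
    exact (symm (add_zero (by simp only [size]; omega)) (by simp only [size]; omega)).mono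
      (by simp [size])
  | zero => exact (eqI _ (by simp only [Fml.size, size]; omega)).mono (by simp [size])
  | add t u h1 h2 =>
    simp only [size] at hS
    have ht := t.length_atoms_le
    have hu := u.length_atoms_le
    have htu : ∀ a ∈ t.atoms ++ u.atoms, a.size = 1 := fun a ha =>
      size_of_mem_atoms (t := add t u) ha
    have hst : (sum₀ t.atoms).size = _ := size_sum₀ fun _ => size_of_mem_atoms
    have hsu : (sum₀ u.atoms).size = _ := size_sum₀ fun _ => size_of_mem_atoms
    have hs : (sum₀ (t.atoms ++ u.atoms)).size = _ := size_sum₀ htu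
    simp only [List.length_append] at hs
    refine (trans (add_congr (h1 (by omega)) (h2 (by omega)) (by omega))
      (sum₀_append _ _ htu (by simp only [List.length_append]; omega))
      (by simp only [size]; omega)).mono ?_
    simp only [size]
    nlinarith [t.size_pos, u.size_pos]

theorem sum₀_middle (a : Term) (l₁ l₂ : List Term) (ha : a.size = 1)
    (h : ∀ a ∈ l₁ ++ l₂, a.size = 1) (hS : 20 * (l₁ ++ l₂).length + 60 ≤ S) :
    Pf S (30 * l₁.length + 1) Γ
      (.eq (sum₀ (l₁ ++ a :: l₂)) (add a (sum₀ (l₁ ++ l₂)))) := by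
  induction l₁ with
  | nil =>
    have hl : (sum₀ l₂).size = _ := size_sum₀ fun a ha => h a (by simp [ha])
    simp only [List.nil_append, sum₀] at *
    exact (eqI _ (by simp only [Fml.size, size]; omega)).mono (by omega)
  | cons b l₁ ih =>
    have hb : b.size = 1 := h b (by simp)
    have hl : (sum₀ (l₁ ++ l₂)).size = _ := size_sum₀ fun a ha => h a (by simp at *; tauto)
    have hl' : (sum₀ (l₁ ++ a :: l₂)).size = _ := size_sum₀ fun c hc => by
      simp at hc h
      grind
    simp only [List.cons_append, sum₀, List.length_cons, List.length_append] at *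
    have h1 := ih (fun a ha => h a (by simp at *; tauto)) (by omega)
    have hS' := (eqI (S := S) (Γ := Γ) b (by simp only [Fml.size]; omega))
    have h2 := add_congr hS' h1 (by simp only [size]; omega)
    have h3 := add_congr (add_comm (S := S) (Γ := Γ) (a := b) (b := a) (by omega))
      (eqI (sum₀ (l₁ ++ l₂)) (by simp only [Fml.size]; omega)) (by simp only [size]; omega)
    have h4 := symm (add_assoc (S := S) (Γ := Γ) (a := b) (b := a) (c := sum₀ (l₁ ++ l₂)) (by omega))
      (by simp only [size]; omega)
    have h5 := add_assoc (S := S) (Γ := Γ) (a := a) (b := b) (c := sum₀ (l₁ ++ l₂)) (by omega)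
    exact (trans h2 (trans h4 (trans h3 h5 (by simp only [size]; omega))
      (by simp only [size]; omega)) (by simp only [size]; omega)).mono (by omega)

/-- The head of `l` is moved to the front of `l'` at linear cost, and the tails are treated by
induction, which makes the total cost quadratic. -/
theorem sum₀_perm {l l' : List Term} (hl : l.Perm l') (h : ∀ a ∈ l, a.size = 1)
    (hS : 20 * l.length + 60 ≤ S) :
    Pf S (50 * l.length * l.length + 1) Γ (.eq (sum₀ l) (sum₀ l')) := by
  induction l generalizing l' with
  | nil =>
    obtain rfl := hl.nil_eq
    exact (eqI _ (by simp only [Fml.size, sum₀, size]; omega)).mono (by simp)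
  | cons a l ih =>
    obtain ⟨l₁, l₂, rfl⟩ := List.append_of_mem (hl.subset (List.mem_cons_self (a := a)))
    have hp : l.Perm (l₁ ++ l₂) := (hl.trans List.perm_middle).cons_inv
    have ha : a.size = 1 := h a (by simp)
    have hll : ∀ a ∈ l, a.size = 1 := fun b hb => h b (by simp [hb])
    have h12 : ∀ a ∈ l₁ ++ l₂, a.size = 1 := fun b hb => hll b (hp.mem_iff.2 hb)
    have e1 : (sum₀ l).size = _ := size_sum₀ hll
    have e2 : (sum₀ (l₁ ++ l₂)).size = _ := size_sum₀ h12
    have e3 : (sum₀ (l₁ ++ a :: l₂)).size = _ := size_sum₀ fun b hb => h b (hl.mem_iff.2 hb)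
    have hlen := hp.length_eq
    simp only [List.length_cons, List.length_append] at *
    have h1 := symm (sum₀_middle (S := S) (Γ := Γ) a l₁ l₂ ha h12
      (by simp only [List.length_append]; omega)) (by omega)
    have h2 := add_congr (eqI (S := S) (Γ := Γ) a (by simp only [Fml.size]; omega))
      (ih hp hll (by omega)) (by omega)
    refine (trans h2 h1 (by simp only [size]; omega)).mono ?_
    nlinarith

/-- Two terms with the same values are provably equal. -/
theorem eq_of_eval {B : ℕ} (h : ∀ ρ, t.eval ρ = u.eval ρ) (ht : t.size ≤ B) (hu : u.size ≤ B)
    (hS : 100 * B ≤ S) : Pf S (200 * B * B) Γ (.eq t u) := by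
  have := t.size_pos
  have hlt := t.length_atoms_le
  have hlu := u.length_atoms_le
  have e1 : (sum₀ t.atoms).size = _ := size_sum₀ fun _ => size_of_mem_atoms
  have e2 : (sum₀ u.atoms).size = _ := size_sum₀ fun _ => size_of_mem_atoms
  have h1 := eq_sum₀_atoms (S := S) (Γ := Γ) t (by omega)
  have h2 := symm (eq_sum₀_atoms (S := S) (Γ := Γ) u (by omega)) (by omega)
  have h3 := sum₀_perm (S := S) (Γ := Γ) (atoms_perm h) (fun _ => size_of_mem_atoms) (by omega)
  refine (trans h1 (trans h3 h2 (by omega)) (by omega)).mono ?_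
  have : t.size * t.size ≤ B * B := Nat.mul_le_mul ht ht
  have : u.size * u.size ≤ B * B := Nat.mul_le_mul hu hu
  have : t.atoms.length * t.atoms.length ≤ B * B := Nat.mul_le_mul (by omega) (by omega)
  have : 1 ≤ B * B := Nat.mul_pos (by omega) (by omega)
  simp only [mul_assoc]
  omega

end Pf
end PrA

/-! ### Arithmetic within fixed budgets for terms, formulas and nodes -/

namespace PrA

/-- Sizes `S` of formulas and numbers `K` of nodes that suffice to derive all equations between
terms of size at most `B` which have the same values. -/
structure Calc (B S K : ℕ) : Prop where
  formula : 100 * B ≤ S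
  nodes : 100 ≤ K
  eval_eq : ∀ {Γ : List Fml} {t u : Term}, (∀ ρ, t.eval ρ = u.eval ρ) → t.size ≤ B → u.size ≤ B →
    Pf S K Γ (.eq t u)

theorem calc_of_le {B S : ℕ} (hB : 1 ≤ B) (hS : 100 * B ≤ S) : Calc B S (200 * B * B) where
  formula := hS
  nodes := by nlinarith
  eval_eq h ht hu := Pf.eq_of_eval h ht hu hS

namespace Calc

open Pf Fml Term

variable {B S K n m k : ℕ} {Γ : List Fml} {A C : Fml} {a b c d t u v z z' : Term}

/-! ## Linear arithmetic -/

/-- The condition `he` is `t - u = a - b` written without subtraction. It makes `t + b = u + a`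
provable outright; replacing `a` by `b` and cancelling `b` leaves `t = u`. -/
theorem lincomb (hc : Calc B S K) (h : Pf S n Γ (eq a b))
    (he : ∀ ρ, t.eval ρ + b.eval ρ = u.eval ρ + a.eval ρ)
    (h1 : t.size + b.size < B) (h2 : u.size + a.size < B) : Pf S (n + 2 * K) Γ (eq t u) := by
  have := hc.formula
  have := hc.nodes
  have e1 := hc.eval_eq (Γ := Γ) (t := add t b) (u := add u a) he
    (by simp only [Term.size]; omega) (by simp only [Term.size]; omega)
  have e2 := add_congr (eqI (S := S) (Γ := Γ) u (by simp only [Fml.size]; omega)) h (by omega)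
  exact (add_cancel (by omega) (trans e1 e2 (by simp only [Term.size]; omega))).mono (by omega)

theorem lincomb₂ (hc : Calc B S K) (h : Pf S n Γ (eq a b)) (h' : Pf S m Γ (eq c d))
    (he : ∀ ρ, t.eval ρ + (b.eval ρ + d.eval ρ) = u.eval ρ + (a.eval ρ + c.eval ρ))
    (h1 : t.size + b.size + d.size + 1 < B) (h2 : u.size + a.size + c.size + 1 < B) :
    Pf S (n + m + 3 * K) Γ (eq t u) := by
  have := hc.formula
  have := hc.nodes
  exact (hc.lincomb (add_congr h h' (by omega)) he (by simp only [Term.size]; omega)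
    (by simp only [Term.size]; omega)).mono (by omega)

theorem lincomb_smul (hc : Calc B S K) (k : ℕ) (h : Pf S n Γ (eq a b))
    (he : ∀ ρ, t.eval ρ + k * b.eval ρ = u.eval ρ + k * a.eval ρ)
    (h1 : t.size + (smul k b).size < B) (h2 : u.size + (smul k a).size < B) :
    Pf S (n + 3 * K) Γ (eq t u) := by
  have := hc.formula
  have := hc.nodes
  exact (hc.lincomb (smul_congr k h (by omega) (by omega)) (by simpa using he)
    (by omega) (by omega)).mono (by omega)

/-- A nonzero `a` would be a successor, and then so would the sum `a + b`. -/
theorem zero_of_add (hc : Calc B S K) (h : Pf S n Γ (eq (add a b) zero))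
    (hB : 10 * (a.size + b.size + 1) ≤ B) : Pf S (n + 4 * K) Γ (eq a zero) := by
  have hS := hc.formula
  have hK := hc.nodes
  have := a.size_pos
  have := b.size_pos
  refine (app₁ (m := 3 * K + 20) ?_ ?_ h).mono (by omega)
  · simp only [Fml.size, Term.size]; omega
  have e1 := exists_pred (S := S) (Γ := [(eq a zero).neg, eq (add a b) zero]) (a := a) (by omega)
    (hyp (by simp) (by simp [Fml.size, Term.size]; omega))
  have e2 := symm (hyp (S := S)
    (Γ := [eq a.lift (add (var 0) one), (eq a zero).neg.lift, eq (add a.lift b.lift) zero])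
    (A := eq a.lift (add (var 0) one)) (by simp) (by simp [Fml.size, Term.size]; omega))
    (by simp; omega)
  have e3 := hyp (S := S)
    (Γ := [eq a.lift (add (var 0) one), (eq a zero).neg.lift, eq (add a.lift b.lift) zero])
    (A := eq (add a.lift b.lift) zero) (by simp) (by simp [Fml.size, Term.size]; omega)
  have e4 := hc.lincomb₂ e2 e3 (t := add (add (var 0) b.lift) one) (u := zero)
    (fun ρ => by simp only [eval]; ring) (by simp [Term.size]; omega) (by simp [Term.size]; omega)
  have e5 := exE (B := bot) e1 (succ_ne_zero (by simp [Term.size]; omega) e4)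
  exact (raa (by simp [Fml.size, Term.size]; omega) e5).mono (by omega)

/-! ## The order -/

theorem le_intro (z : Term) (h : Pf S n Γ (eq (add t z) u)) (hS : t.size + u.size + 5 ≤ S) :
    Pf S (n + 1) Γ (le t u) :=
  exI z (by simp [Fml.size, Term.size]; omega) (by simpa using h)

/-- Two inequalities may be added. -/
theorem le_lincomb₂ (hc : Calc B S K) (z : Term) (h : Pf S n Γ (le a b)) (h' : Pf S m Γ (le c d))
    (he : ∀ ρ, t.eval ρ + z.eval ρ + (b.eval ρ + d.eval ρ) = u.eval ρ + (a.eval ρ + c.eval ρ))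
    (hB : 10 * (a.size + b.size + c.size + d.size + t.size + u.size + z.size + 1) ≤ B) :
    Pf S (n + m + 4 * K) Γ (le t u) := by
  have hS := hc.formula
  have hK := hc.nodes
  refine (app₂ (m := 3 * K + 20) ?_ ?_ h h').mono (by omega)
  · simp only [Fml.size_le]; omega
  have e1 := hyp (S := S) (Γ := [le a b, le c d]) (A := le a b) (by simp) (by simp; omega)
  have e2 := hyp (S := S) (Γ := [eq (add a.lift (var 0)) b.lift, (le a b).lift, (le c d).lift])
    (A := le c.lift d.lift) (by simp) (by simp; omega)
  let Δ := [eq (add c.lift.lift (var 0)) d.lift.lift, eq (add a.lift.lift (var 1)) b.lift.lift,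
    le a.lift.lift b.lift.lift, le c.lift.lift d.lift.lift]
  have e3 := hyp (S := S) (Γ := Δ) (A := eq (add a.lift.lift (var 1)) b.lift.lift) (by simp [Δ])
    (by simp [Fml.size, Term.size]; omega)
  have e4 := hyp (S := S) (Γ := Δ) (A := eq (add c.lift.lift (var 0)) d.lift.lift) (by simp [Δ])
    (by simp [Fml.size, Term.size]; omega)
  -- The difference of `t` and `u` is the slack `z` plus the differences `var 1` and `var 0` from
  -- the two given inequalities.
  have e5 := hc.lincomb₂ e3 e4 (t := add t.lift.lift (add z.lift.lift (add (var 1) (var 0))))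
    (u := u.lift.lift) (fun ρ => by
      have := he fun i => ρ (i + 1 + 1)
      simp only [eval, eval_lift]; linarith) (by simp [Term.size]; omega) (by simp [Term.size]; omega)
  have e6 := le_intro _ e5 (by simp; omega)
  have e7 := exE (B := le t.lift u.lift) e2 (by simpa [Δ] using e6)
  have e8 := exE (B := le t u) e1 (by simpa using e7)
  exact e8.mono (by omega)

theorem le_of_eval (hc : Calc B S K) (z : Term) (he : ∀ ρ, t.eval ρ + z.eval ρ = u.eval ρ)
    (hB : 10 * (t.size + u.size + z.size + 1) ≤ B) : Pf S (K + 1) Γ (le t u) := by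
  have := hc.formula
  exact le_intro z (hc.eval_eq he (by simp only [Term.size]; omega) (by omega)) (by omega)

theorem le_of_eq (hc : Calc B S K) (h : Pf S n Γ (eq t u)) (hB : 10 * (t.size + u.size + 1) ≤ B) :
    Pf S (n + 3 * K) Γ (le t u) := by
  have := hc.formula
  have := hc.nodes
  have := t.size_pos
  have := u.size_pos
  exact (le_intro zero (hc.lincomb h (fun ρ => by simp only [eval]; ring)
    (by simp only [Term.size]; omega) (by omega)) (by omega)).mono (by omega)

theorem le_lincomb (hc : Calc B S K) (z : Term) (h : Pf S n Γ (le a b))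
    (he : ∀ ρ, t.eval ρ + z.eval ρ + b.eval ρ = u.eval ρ + a.eval ρ)
    (hB : 20 * (a.size + b.size + t.size + u.size + z.size + 1) ≤ B) :
    Pf S (n + 6 * K) Γ (le t u) := by
  have := hc.nodes
  have := a.size_pos
  have := b.size_pos
  exact (hc.le_lincomb₂ z h (hc.le_of_eval (t := zero) (u := zero) zero (fun _ => rfl)
    (by simp only [Term.size]; omega)) (fun ρ => by simp only [eval]; linarith [he ρ])
    (by simp only [Term.size]; omega)).mono (by omega)

/-- By `he` the two inequalities add up to `1 ≤ 0`, which makes `0` a successor. -/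
theorem false_of_le (hc : Calc B S K) (z : Term) (h : Pf S n Γ (le a b)) (h' : Pf S m Γ (le c d))
    (he : ∀ ρ, 1 + z.eval ρ + (b.eval ρ + d.eval ρ) = a.eval ρ + c.eval ρ)
    (hB : 20 * (a.size + b.size + c.size + d.size + z.size + 1) ≤ B) :
    Pf S (n + m + 8 * K) Γ bot := by
  have hS := hc.formula
  have hK := hc.nodes
  have := a.size_pos
  have e1 := hc.le_lincomb₂ (t := one) (u := zero) z h h'
    (fun ρ => by simp only [eval]; linarith [he ρ]) (by simp only [Term.size]; omega)
  have e2 := hc.lincomb (hyp (S := S) (Γ := eq (add one (var 0)) zero :: Γ.map lift)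
    (A := eq (add one (var 0)) zero) (by simp) (by simp [Fml.size, Term.size]; omega))
    (t := add (var 0) one) (u := zero) (fun ρ => by simp only [eval]; ring)
    (by simp only [Term.size]; omega) (by simp only [Term.size]; omega)
  exact (exE (B := bot) e1 (succ_ne_zero (by simp only [Term.size]; omega) e2)).mono (by omega)

/-- The two differences add up to zero, so the first one vanishes by `zero_of_add`. -/
theorem le_antisymm (hc : Calc B S K) (h : Pf S n Γ (le a b)) (h' : Pf S m Γ (le b a))
    (hB : 40 * (a.size + b.size + 1) ≤ B) : Pf S (n + m + 12 * K) Γ (eq a b) := by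
  have hS := hc.formula
  have hK := hc.nodes
  have := a.size_pos
  have := b.size_pos
  refine (app₂ (m := 11 * K + 20) ?_ ?_ h h').mono (by omega)
  · simp only [Fml.size_le, Fml.size]; omega
  have e1 := hyp (S := S) (Γ := [le a b, le b a]) (A := le a b) (by simp) (by simp; omega)
  have e2 := hyp (S := S) (Γ := [eq (add a.lift (var 0)) b.lift, (le a b).lift, (le b a).lift])
    (A := le b.lift a.lift) (by simp) (by simp; omega)
  let Δ := [eq (add b.lift.lift (var 0)) a.lift.lift, eq (add a.lift.lift (var 1)) b.lift.lift,
    le a.lift.lift b.lift.lift, le b.lift.lift a.lift.lift]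
  have e3 := hyp (S := S) (Γ := Δ) (A := eq (add a.lift.lift (var 1)) b.lift.lift) (by simp [Δ])
    (by simp [Fml.size, Term.size]; omega)
  have e4 := hyp (S := S) (Γ := Δ) (A := eq (add b.lift.lift (var 0)) a.lift.lift) (by simp [Δ])
    (by simp [Fml.size, Term.size]; omega)
  have e5 := hc.zero_of_add (hc.lincomb₂ e3 e4 (t := add (var 1) (var 0)) (u := zero)
    (fun ρ => by simp only [eval, eval_lift]; ring) (by simp [Term.size]; omega)
    (by simp [Term.size]; omega)) (by simp [Term.size]; omega)
  have e6 := hc.lincomb₂ e3 (symm e5 (by simp [Term.size]; omega)) (t := a.lift.lift)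
    (u := b.lift.lift) (fun ρ => by simp only [eval, eval_lift]; ring)
    (by simp [Term.size]; omega) (by simp [Term.size]; omega)
  have e7 := exE (B := eq a.lift b.lift) e2 (by simpa [Δ] using e6)
  exact (exE (B := eq a b) e1 (by simpa using e7)).mono (by omega)

theorem em (hS : 4 * A.size + 20 ≤ S) : Pf S 10 Γ (or A A.neg) := by
  have e1 := hyp (S := S) (Γ := A :: (or A A.neg).neg :: Γ) (A := (or A A.neg).neg) (by simp)
    (by simp [Fml.size]; omega)
  have e2 := impE e1 (orI₁ (B := A.neg) (by simp [Fml.size]; omega)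
    (hyp (S := S) (A := A) (by simp) (by omega)))
  have e3 := orI₂ (A := A) (by simp [Fml.size]; omega)
    (impI (S := S) (by simp only [Fml.size]; omega) e2)
  exact (raa (by simp [Fml.size]; omega)
    (impE (hyp (S := S) (A := (or A A.neg).neg) (by simp) (by simp [Fml.size]; omega)) e3)).mono
      (by omega)

/-- Discreteness of the order: if `b ≤ a`, the difference is either zero or a successor. -/
theorem le_or_lt (hc : Calc B S K) (hB : 20 * (a.size + b.size + 1) ≤ B) :
    Pf S (12 * K) Γ (or (le a b) (le (add b one) a)) := by
  have hS := hc.formula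
  have hK := hc.nodes
  have := a.size_pos
  have := b.size_pos
  have e1 := Pf.le_total (S := S) (Γ := []) (a := a) (b := b) (by omega)
  have e2 := hyp (S := S) (Γ := [le a b]) (A := le a b) (by simp) (by simp; omega)
  have e3 := orI₁ (B := le (add b one) a) (by simp [Fml.size, Term.size]; omega) e2
  let Δ := [eq (add b.lift (var 0)) a.lift, le b.lift a.lift]
  have e4 := em (S := S) (Γ := Δ) (A := eq (var 0) zero) (by simp [Fml.size, Term.size]; omega)
  have e5 := hc.lincomb₂ (symm (hyp (S := S) (Γ := eq (var 0) zero :: Δ)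
      (A := eq (add b.lift (var 0)) a.lift) (by simp [Δ]) (by simp [Fml.size, Term.size]; omega))
      (by simp [Term.size]; omega))
    (hyp (S := S) (A := eq (var 0) zero) (by simp) (by simp [Fml.size, Term.size]; omega))
    (t := add a.lift zero) (u := b.lift) (fun ρ => by simp only [eval, eval_lift]; ring)
    (by simp [Term.size]; omega) (by simp [Term.size]; omega)
  have e6 := orI₁ (B := le (add b.lift one) a.lift) (by simp [Fml.size, Term.size]; omega)
    (le_intro _ e5 (by simp; omega))
  have e7 := exists_pred (S := S) (Γ := (eq (var 0) zero).neg :: Δ) (a := var 0)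
    (by simp [Term.size]; omega) (hyp (by simp) (by simp [Fml.size, Term.size]; omega))
  let Δ' := eq (var 1) (add (var 0) one) :: ((eq (var 0) zero).neg :: Δ).map lift
  have e8 := hc.lincomb₂ (hyp (S := S) (Γ := Δ')
      (A := eq (add b.lift.lift (var 1)) a.lift.lift) (by simp [Δ, Δ'])
      (by simp [Fml.size, Term.size]; omega))
    (symm (hyp (S := S) (A := eq (var 1) (add (var 0) one)) (by simp [Δ'])
      (by simp [Fml.size, Term.size]; omega)) (by simp [Term.size]; omega))
    (t := add (add b.lift.lift one) (var 0)) (u := a.lift.lift)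
    (fun ρ => by simp only [eval, eval_lift]; ring)
    (by simp [Term.size]; omega) (by simp [Term.size]; omega)
  have e9 := orI₂ (A := le a.lift b.lift) (by simp [Fml.size, Term.size]; omega)
    (exE (B := le (add b.lift one) a.lift) e7
      (by simpa [Δ'] using le_intro _ e8 (by simp [Term.size]; omega)))
  have e10 := exE (B := or (le a b) (le (add b one) a))
    (hyp (S := S) (Γ := [le b a]) (A := le b a) (by simp) (by simp; omega))
    (by simpa [Δ] using orE e4 e6 e9)
  exact ((orE e1 e3 e10).weaken (by simp) (by simp)).mono (by omega)

/-! ## Multiplying atomic formulas by a factor -/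

/-- Read `he` as `a - b = k (t - u)`. With `u = t + z` and `a = b + z'` it gives `k z + z' = 0`, and
`z` is a summand of the left-hand side because `k > 0`. -/
theorem zero_of_smul (hc : Calc B S K) (hk : 0 < k) (h : Pf S n Γ (eq (add t z) u))
    (h' : Pf S m Γ (eq (add b z') a))
    (he : ∀ ρ, a.eval ρ + k * u.eval ρ = b.eval ρ + k * t.eval ρ)
    (hB : 20 * (k * (t.size + z.size + u.size + 4) + a.size + b.size + z'.size + 1) ≤ B) :
    Pf S (n + m + 8 * K) Γ (eq z zero) := by
  have hS := hc.formula
  have hK := hc.nodes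
  have e0 := a.size_pos
  obtain ⟨k, rfl⟩ : ∃ l, k = l + 1 := ⟨k - 1, by omega⟩
  have e1 := size_smul_le (k + 1) (add t z)
  have e2 := size_smul_le (k + 1) u
  have e3 := size_smul_le k z
  simp only [Term.size, add_mul, mul_add] at *
  have e4 := smul_congr (k + 1) h (by omega) (by omega)
  have e5 := hc.lincomb₂ e4 h' (t := add z (add (smul k z) z')) (u := zero)
    (fun ρ => by have := he ρ; simp only [eval, eval_smul]; linarith)
    (by simp only [Term.size]; omega) (by simp only [Term.size]; omega)
  exact (hc.zero_of_add e5 (by simp only [Term.size]; omega)).mono (by omega)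

/-- By totality only the case `u ≤ t` needs an argument, and there `zero_of_smul` makes the
difference vanish. Thus the factor `k` is cancelled at a cost in nodes independent of `k`. -/
theorem le_of_smul (hc : Calc B S K) (hk : 0 < k) (h : Pf S n Γ (le a b))
    (he : ∀ ρ, a.eval ρ + k * u.eval ρ = b.eval ρ + k * t.eval ρ)
    (hB : 20 * (k * (t.size + u.size + 5) + a.size + b.size + 3) ≤ B) :
    Pf S (n + 13 * K) Γ (le t u) := by
  have hS := hc.formula
  have hK := hc.nodes
  have h0 : t.size + u.size + 5 ≤ k * (t.size + u.size + 5) := Nat.le_mul_of_pos_left _ hk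
  refine (app₁ (m := 11 * K + 20) ?_ ?_ h).mono (by omega)
  · simp only [Fml.size_le]; omega
  have e1 := Pf.le_total (S := S) (Γ := [le a b]) (a := t) (b := u) (by omega)
  have e2 := hyp (S := S) (Γ := [le t u, le a b]) (A := le t u) (by simp) (by simp; omega)
  have e3 := hyp (S := S) (Γ := [le u t, le a b]) (A := le u t) (by simp) (by simp; omega)
  have e4 := hyp (S := S) (Γ := [eq (add u.lift (var 0)) t.lift, (le u t).lift, (le a b).lift])
    (A := le a.lift b.lift) (by simp) (by simp; omega)
  let Δ := [eq (add a.lift.lift (var 0)) b.lift.lift, eq (add u.lift.lift (var 1)) t.lift.lift,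
    le u.lift.lift t.lift.lift, le a.lift.lift b.lift.lift]
  have e5 := hyp (S := S) (Γ := Δ) (A := eq (add u.lift.lift (var 1)) t.lift.lift) (by simp [Δ])
    (by simp [Fml.size, Term.size]; omega)
  have e6 := hyp (S := S) (Γ := Δ) (A := eq (add a.lift.lift (var 0)) b.lift.lift) (by simp [Δ])
    (by simp [Fml.size, Term.size]; omega)
  have e7 := hc.zero_of_smul hk e5 e6 (fun ρ => by
      have := he fun i => ρ (i + 1 + 1)
      simp only [eval_lift]; linarith)
    (by rw [show (Term.lift (Term.lift u)).size + (var 1).size + (Term.lift (Term.lift t)).size + 4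
          = t.size + u.size + 5 by simp [Term.size]; omega]
        simp [Term.size]; omega)
  have e8 := hc.lincomb₂ (symm e5 (by simp [Term.size]; omega)) e7 (t := add t.lift.lift zero)
    (u := u.lift.lift) (fun ρ => by simp only [eval, eval_lift]; ring)
    (by simp [Term.size]; omega) (by simp [Term.size]; omega)
  have e9 := exE (B := le t.lift u.lift) e4 (by simpa [Δ] using le_intro _ e8 (by simp; omega))
  have e10 := exE (B := le t u) e3 (by simpa using e9)
  exact (orE e1 e2 e10).mono (by omega)

theorem eq_of_smul (hc : Calc B S K) (hk : 0 < k) (h : Pf S n Γ (eq a b))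
    (he : ∀ ρ, a.eval ρ + k * u.eval ρ = b.eval ρ + k * t.eval ρ)
    (hB : 40 * (k * (t.size + u.size + 5) + a.size + b.size + 1) ≤ B) :
    Pf S (2 * n + 50 * K) Γ (eq t u) := by
  have hS := hc.formula
  have hK := hc.nodes
  have h0 : t.size + u.size + 5 ≤ k * (t.size + u.size + 5) := Nat.le_mul_of_pos_left _ hk
  have e1 := hc.le_of_eq h (by omega)
  have e2 := hc.le_of_eq (symm h (by omega)) (by omega)
  have e3 := hc.le_of_smul hk e1 he (by omega)
  have e4 := hc.le_of_smul (t := u) (u := t) hk e2 (fun ρ => (he ρ).symm)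
    (by rw [Nat.add_comm u.size]; omega)
  exact (hc.le_antisymm e3 e4 (by omega)).mono (by omega)

theorem le_smul (hc : Calc B S K) (h : Pf S n Γ (le t u))
    (he : ∀ ρ, a.eval ρ + k * u.eval ρ = b.eval ρ + k * t.eval ρ)
    (hB : 20 * (k * (t.size + u.size + 5) + a.size + b.size + t.size + u.size + 1) ≤ B) :
    Pf S (n + 5 * K) Γ (le a b) := by
  have hS := hc.formula
  have hK := hc.nodes
  have := a.size_pos
  refine (app₁ (m := 4 * K + 20) ?_ ?_ h).mono (by omega)
  · simp only [Fml.size_le]; omega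
  have e1 := hyp (S := S) (Γ := [le t u]) (A := le t u) (by simp) (by simp; omega)
  let Δ := [eq (add t.lift (var 0)) u.lift, le t.lift u.lift]
  have e2 := hyp (S := S) (Γ := Δ) (A := eq (add t.lift (var 0)) u.lift) (by simp [Δ])
    (by simp [Fml.size, Term.size]; omega)
  have e3 := size_smul_le k (add t.lift (var 0))
  have e4 := size_smul_le k u.lift
  have e5 := size_smul_le k (var 0)
  simp only [Term.size, mul_add, Term.size_lift] at *
  have e6 := hc.lincomb_smul k e2 (t := add a.lift (smul k (var 0))) (u := b.lift) (fun ρ => by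
      have := he fun i => ρ (i + 1)
      simp only [eval, eval_lift, eval_smul]; linarith)
    (by simp [Term.size]; omega) (by simp; omega)
  exact (exE (B := le a b) e1 (by simpa [Δ] using le_intro _ e6 (by simp; omega))).mono (by omega)

end Calc
end PrA

namespace PrA

namespace Pf

variable {S n m k : ℕ} {Γ : List Fml} {A A' B B' C : Fml}

/-! ## Biconditionals -/

theorem iffI (hS : 2 * A.size + 2 * C.size + 3 ≤ S) (h : Pf S n [A] C) (h' : Pf S m [C] A) :
    Pf S (n + m + 5) Γ (.iff A C) :=
  (andI (by simp only [Fml.size]; omega)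
    (impI (by simp only [Fml.size]; omega) (weaken (by simp) (by simp) h))
    (impI (by simp only [Fml.size]; omega) (weaken (by simp) (by simp) h'))).mono (by omega)

theorem iff_of_true (hS : 2 * A.size + 2 * C.size + 3 ≤ S) (h : Pf S n Γ A) (h' : Pf S m Γ C) :
    Pf S (n + m + 5) Γ (.iff A C) :=
  (andI (by simp only [Fml.size]; omega)
    (impI (by simp only [Fml.size]; omega) (weaken (by simp) (by simp) h'))
    (impI (by simp only [Fml.size]; omega) (weaken (by simp) (by simp) h))).mono (by omega)

theorem exfalso (hS : A.size ≤ S) (h : Pf S n Γ .bot) : Pf S (n + 2) Γ A :=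
  raa hS (weaken (by simp) (by simp) h)

theorem iff_of_false (hS : 2 * A.size + 2 * C.size + 3 ≤ S) (h : Pf S n (A :: Γ) .bot)
    (h' : Pf S m (C :: Γ) .bot) : Pf S (n + m + 7) Γ (.iff A C) :=
  (andI (by simp only [Fml.size]; omega)
    (impI (by simp only [Fml.size]; omega) (exfalso (by omega) h))
    (impI (by simp only [Fml.size]; omega) (exfalso (by omega) h'))).mono (by omega)

theorem iff_refl (hS : 4 * A.size + 3 ≤ S) : Pf S 7 Γ (.iff A A) :=
  (iffI (by omega) (hyp (by simp) (by omega)) (hyp (by simp) (by omega))).mono (by omega)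

theorem iff_mp (h : Pf S n Γ (.iff A C)) (h' : Pf S m Γ A) : Pf S (n + m + 2) Γ C :=
  (impE (andE₁ h) h').mono (by omega)

theorem iff_mpr (h : Pf S n Γ (.iff A C)) (h' : Pf S m Γ C) : Pf S (n + m + 2) Γ A :=
  (impE (andE₂ h) h').mono (by omega)

section Congr

variable (hS : 16 * (A.size + A'.size + B.size + B'.size + 1) ≤ S) (h : Pf S n Γ (.iff A A'))
  (h' : Pf S m Γ (.iff B B'))
include hS h h'

theorem iff_congr_of {E E' : Fml} (hE : E.size = A.size + B.size + 1)
    (hE' : E'.size = A'.size + B'.size + 1)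
    (e : Pf S k [E, .and (.iff A A') (.iff B B')] E')
    (e' : Pf S k [E', .and (.iff A A') (.iff B B')] E) :
    Pf S (n + m + 2 * k + 15) Γ (.iff E E') := by
  have e1 := impI (by simp only [Fml.size]; omega) e
  have e2 := impI (by simp only [Fml.size]; omega) e'
  have e3 := andI (by simp only [Fml.size]; omega) e1 e2
  exact (app₁ (by simp only [Fml.size, Fml.iff]; omega) e3
    (andI (by simp only [Fml.size, Fml.iff]; omega) h h')).mono (by omega)

theorem imp_congr : Pf S (n + m + 100) Γ (.iff (.imp A B) (.imp A' B')) := by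
  refine (iff_congr_of (k := 20) hS h h' rfl rfl ?_ ?_).mono (by omega)
  · have e1 := hyp (S := S) (Γ := [A', .imp A B, .and (.iff A A') (.iff B B')])
      (A := .and (.iff A A') (.iff B B')) (by simp) (by simp only [Fml.size, Fml.iff]; omega)
    have e2 := iff_mpr (andE₁ e1) (hyp (A := A') (by simp) (by omega))
    have e3 := impE (hyp (A := .imp A B) (by simp) (by simp only [Fml.size]; omega)) e2
    exact (impI (by simp only [Fml.size]; omega) (iff_mp (andE₂ e1) e3)).mono (by omega)
  · have e1 := hyp (S := S) (Γ := [A, .imp A' B', .and (.iff A A') (.iff B B')])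
      (A := .and (.iff A A') (.iff B B')) (by simp) (by simp only [Fml.size, Fml.iff]; omega)
    have e2 := iff_mp (andE₁ e1) (hyp (A := A) (by simp) (by omega))
    have e3 := impE (hyp (A := .imp A' B') (by simp) (by simp only [Fml.size]; omega)) e2
    exact (impI (by simp only [Fml.size]; omega) (iff_mpr (andE₂ e1) e3)).mono (by omega)

theorem and_congr : Pf S (n + m + 100) Γ (.iff (.and A B) (.and A' B')) := by
  refine (iff_congr_of (k := 20) hS h h' rfl rfl ?_ ?_).mono (by omega)
  · have e1 := hyp (S := S) (Γ := [.and A B, .and (.iff A A') (.iff B B')])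
      (A := .and (.iff A A') (.iff B B')) (by simp) (by simp only [Fml.size, Fml.iff]; omega)
    have e2 := hyp (S := S) (Γ := [.and A B, .and (.iff A A') (.iff B B')])
      (A := .and A B) (by simp) (by simp only [Fml.size]; omega)
    exact (andI (by simp only [Fml.size]; omega) (iff_mp (andE₁ e1) (andE₁ e2))
      (iff_mp (andE₂ e1) (andE₂ e2))).mono (by omega)
  · have e1 := hyp (S := S) (Γ := [.and A' B', .and (.iff A A') (.iff B B')])
      (A := .and (.iff A A') (.iff B B')) (by simp) (by simp only [Fml.size, Fml.iff]; omega)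
    have e2 := hyp (S := S) (Γ := [.and A' B', .and (.iff A A') (.iff B B')])
      (A := .and A' B') (by simp) (by simp only [Fml.size]; omega)
    exact (andI (by simp only [Fml.size]; omega) (iff_mpr (andE₁ e1) (andE₁ e2))
      (iff_mpr (andE₂ e1) (andE₂ e2))).mono (by omega)

theorem or_congr : Pf S (n + m + 100) Γ (.iff (.or A B) (.or A' B')) := by
  have e : ∀ D E : Fml, Pf S 1 [D, E, .and (.iff A A') (.iff B B')]
      (.and (.iff A A') (.iff B B')) := fun D E =>
    hyp (by simp) (by simp only [Fml.size, Fml.iff]; omega)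
  refine (iff_congr_of (k := 20) hS h h' rfl rfl ?_ ?_).mono (by omega)
  · exact (orE (hyp (A := .or A B) (by simp) (by simp only [Fml.size]; omega))
      (orI₁ (by simp only [Fml.size]; omega) (iff_mp (andE₁ (e _ _)) (hyp (by simp) (by omega))))
      (orI₂ (by simp only [Fml.size]; omega)
        (iff_mp (andE₂ (e _ _)) (hyp (by simp) (by omega))))).mono (by omega)
  · exact (orE (hyp (A := .or A' B') (by simp) (by simp only [Fml.size]; omega))
      (orI₁ (by simp only [Fml.size]; omega) (iff_mpr (andE₁ (e _ _)) (hyp (by simp) (by omega))))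
      (orI₂ (by simp only [Fml.size]; omega)
        (iff_mpr (andE₂ (e _ _)) (hyp (by simp) (by omega))))).mono (by omega)

end Congr

/-! ## Disjunctions and conjunctions of lists -/

theorem disjI {l : List Fml} (hA : A ∈ l) (hS : (Fml.disj l).size ≤ S) (h : Pf S n Γ A) :
    Pf S (n + l.length) Γ (.disj l) := by
  induction l with
  | nil => simp at hA
  | cons a l ih =>
    cases l with
    | nil =>
      obtain rfl : A = a := by simpa using hA
      exact h.mono (by simp)
    | cons b l =>
      rcases List.mem_cons.1 hA with rfl | hA
      · exact (orI₁ hS h).mono (by simp)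
      · simp only [Fml.disj, Fml.size] at hS
        exact (orI₂ (by simp only [Fml.size]; omega) (ih hA (by omega))).mono (by simp)

theorem disjE {l : List Fml} (hS : (Fml.disj l).size + C.size + 1 ≤ S) (h : Pf S n Γ (.disj l))
    (h' : ∀ A ∈ l, Pf S m (A :: Γ) C) : Pf S (n + l.length * (m + 5) + 10) Γ C := by
  -- The cut uses the derivation of the disjunction once; the induction over `l` then works from a
  -- hypothesis.
  suffices H : Pf S (l.length * (m + 5) + 5) (.disj l :: Γ) C from (cut hS h H).mono (by omega)
  clear h
  induction l with
  | nil => exact (exfalso (by omega) (hyp (A := .bot) (by simp [Fml.disj])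
      (by simp only [Fml.size, Fml.disj] at *; omega))).mono (by simp)
  | cons a l ih =>
    cases l with
    | nil => exact (h' a (by simp)).mono (by simp; omega)
    | cons b l =>
      simp only [Fml.disj, Fml.size] at hS
      refine (orE (hyp (A := .or a (.disj (b :: l))) (by simp [Fml.disj])
        (by simp only [Fml.size]; omega)) (weaken (Γ := a :: Γ) ?_ (by simp) (h' a (by simp)))
        (weaken (Γ := .disj (b :: l) :: Γ) ?_ (by simp)
          (ih (by omega) fun A hA => h' A (by simp [hA])))).mono ?_
      · exact List.cons_subset_cons _ (List.subset_cons_self _ _)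
      · exact List.cons_subset_cons _ (List.subset_cons_self _ _)
      · simp only [List.length_cons, add_mul, mul_add]; omega

end Pf

/-- The conjunction `A₁ ∧ (⋯ ∧ (Aₙ ∧ ⊤))` of a list of formulas. -/
def Fml.conj : List Fml → Fml
  | [] => imp bot bot
  | A :: l => and A (conj l)

theorem Fml.size_conj_le {l : List Fml} {b : ℕ} (h : ∀ A ∈ l, A.size ≤ b) :
    (conj l).size ≤ l.length * (b + 1) + 3 := by
  induction l with
  | nil => simp [conj, size]
  | cons a l ih =>
    have h1 := h a (by simp)
    have h2 := ih fun A hA => h A (by simp [hA])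
    simp only [conj, size, List.length_cons, add_mul] at *
    omega

namespace Pf

variable {S n m k : ℕ} {Γ : List Fml} {A A' B B' C : Fml}

theorem conjE {l : List Fml} (hA : A ∈ l) (h : Pf S n Γ (.conj l)) :
    Pf S (n + l.length) Γ A := by
  induction l generalizing n with
  | nil => simp at hA
  | cons a l ih =>
    rcases List.mem_cons.1 hA with rfl | hA
    · exact (andE₁ h).mono (by simp)
    · exact (ih hA (andE₂ h)).mono (by simp; omega)

theorem conj_map {α : Type} {l : List α} {f g : α → Fml} {b : ℕ} (hf : ∀ x ∈ l, (f x).size ≤ b)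
    (hg : ∀ x ∈ l, (g x).size ≤ b) (hS : 2 * (l.length * (b + 1)) + 2 * b + 10 ≤ S)
    (h : Pf S n Γ (.conj (l.map f))) (h' : ∀ x ∈ l, Pf S m (f x :: Γ) (g x)) :
    Pf S (n + l.length * (m + 15) + 10) Γ (.conj (l.map g)) := by
  have size_f : ∀ l : List α, (∀ x ∈ l, (f x).size ≤ b) →
      (Fml.conj (l.map f)).size ≤ l.length * (b + 1) + 3 := fun l h => by
    simpa using Fml.size_conj_le (l := l.map f) (by simpa using h)
  have size_g : ∀ l : List α, (∀ x ∈ l, (g x).size ≤ b) →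
      (Fml.conj (l.map g)).size ≤ l.length * (b + 1) + 3 := fun l h => by
    simpa using Fml.size_conj_le (l := l.map g) (by simpa using h)
  suffices H : Pf S (l.length * (m + 15) + 5) (.conj (l.map f) :: Γ) (.conj (l.map g)) by
    have := size_f l hf
    have := size_g l hg
    exact (cut (by omega) h H).mono (by omega)
  clear h
  induction l with
  | nil => exact (impI (by simp only [Fml.size]; omega) (hyp (A := .bot) (by simp)
      (by simp only [Fml.size]; omega))).mono (by simp)
  | cons a l ih =>
    have h1 := hf a (by simp)
    have h2 := hg a (by simp)
    have h3 := size_f l fun x hx => hf x (by simp [hx])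
    have h4 := size_g l fun x hx => hg x (by simp [hx])
    simp only [List.length_cons, add_mul] at hS
    have e := hyp (S := S) (Γ := .conj ((a :: l).map f) :: Γ)
      (A := .and (f a) (.conj (l.map f))) (by simp [Fml.conj]) (by simp only [Fml.size]; omega)
    have e1 := cut (by omega) (andE₁ e) (weaken (Γ := f a :: Γ)
      (List.cons_subset_cons _ (List.subset_cons_self _ _)) (by simp) (h' a (by simp)))
    have e2 := cut (by omega) (andE₂ e) (weaken (Γ := .conj (l.map f) :: Γ)
      (List.cons_subset_cons _ (List.subset_cons_self _ _)) (by simp)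
      (ih (fun x hx => hf x (by simp [hx])) (fun x hx => hg x (by simp [hx])) (by omega)
        fun x hx => h' x (by simp [hx])))
    refine (andI (by simp only [Fml.size]; omega) e1 e2).mono ?_
    simp only [List.length_cons, add_mul]
    omega

end Pf

namespace Calc

open Pf Fml Term

variable {B S K n m k w : ℕ} {Γ : List Fml} {A C : Fml} {a b c d s t u v y y' z z' : Term}

/-! ## Congruences -/

theorem modEq_intro₁ (z : Term) (hS : 2 * ((smul m z).size + t.size + u.size + 2 * m + 10) ≤ S)
    (h : Pf S n Γ (eq (add (smul m z) u) t)) : Pf S (n + 2) Γ (modEq m t u) := by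
  have := size_smul_le m (var 0)
  refine exI z (by simp [Fml.size, Term.size] at *; omega) ?_
  simpa using orI₁ (by simp [Fml.size, Term.size]; omega) h

theorem modEq_intro₂ (z : Term) (hS : 2 * ((smul m z).size + t.size + u.size + 2 * m + 10) ≤ S)
    (h : Pf S n Γ (eq (add (smul m z) t) u)) : Pf S (n + 2) Γ (modEq m t u) := by
  have := size_smul_le m (var 0)
  refine exI z (by simp [Fml.size, Term.size] at *; omega) ?_
  simpa using orI₂ (by simp [Fml.size, Term.size]; omega) h

theorem modEq_elim {l : ℕ} (h : Pf S n Γ (modEq m t u))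
    (h₁ : Pf S k (eq (add (smul m (var 0)) u.lift) t.lift :: Γ.map lift) A.lift)
    (h₂ : Pf S l (eq (add (smul m (var 0)) t.lift) u.lift :: Γ.map lift) A.lift) :
    Pf S (n + k + l + 5) Γ A := by
  have hS := h.size_le
  have h₀ : ∀ B C : Fml, B :: Γ.map lift ⊆ B :: C :: Γ.map lift := fun B C =>
    List.cons_subset_cons _ (List.subset_cons_self _ _)
  exact (exE h (orE (hyp (by simp) (by simp only [modEq, Fml.size] at *; omega))
    (weaken (h₀ _ _) (by simp) h₁) (weaken (h₀ _ _) (by simp) h₂))).mono (by omega)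

theorem modEq_symm (hc : Calc B S K) (h : Pf S n Γ (modEq m t u))
    (hB : 10 * (t.size + u.size + 2 * m + 1) ≤ B) : Pf S (n + K) Γ (modEq m u t) := by
  have hS := hc.formula
  have hK := hc.nodes
  have e1 := size_smul_le m (var 0)
  have e2 := size_modEq_le m t u
  have e3 := size_modEq_le m u t
  have e4 := size_smul_le m (var 0)
  simp only [Term.size] at *
  refine (app₁ (m := 20) (by omega) ?_ h).mono (by omega)
  have f1 := modEq_intro₂ (S := S)
    (Γ := eq (add (smul m (var 0)) u.lift) t.lift :: [modEq m t u].map lift)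
    (m := m) (t := u.lift) (u := t.lift) (var 0) (by simp; omega)
    (hyp (by simp) (by simp [Fml.size, Term.size]; omega))
  have f2 := modEq_intro₁ (S := S)
    (Γ := eq (add (smul m (var 0)) t.lift) u.lift :: [modEq m t u].map lift)
    (m := m) (t := u.lift) (u := t.lift) (var 0) (by simp; omega)
    (hyp (by simp) (by simp [Fml.size, Term.size]; omega))
  exact (modEq_elim (A := modEq m u t) (hyp (A := modEq m t u) (by simp) (by omega))
    (by simpa using f1) (by simpa using f2)).mono (by omega)

/-- By totality `z` and `z'` are comparable, and their difference is the witness. The two outcomes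
are the two disjuncts in the definition of `modEq`. -/
theorem modEq_of_eq (hc : Calc B S K) (h : Pf S n Γ (eq (add (smul m z) a) (add (smul m z') c)))
    (hB : 20 * (m * (z.size + z'.size + 5) + a.size + c.size + z.size + z'.size + 5) ≤ B) :
    Pf S (n + 9 * K) Γ (modEq m a c) := by
  have hS := hc.formula
  have hK := hc.nodes
  have e1 := size_smul_le m z
  have e2 := size_smul_le m z'
  have e3 := size_smul_le m (var 0)
  have e3' := size_smul_le m (add z.lift (var 0))
  have e3'' := size_smul_le m (add z'.lift (var 0))
  have e4 := size_modEq_le m a c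
  simp only [Term.size, mul_add, Term.size_lift] at *
  refine (app₁ (m := 8 * K + 50) (by simp only [Fml.size, Term.size]; omega) ?_ h).mono (by omega)
  let E := eq (add (smul m z) a) (add (smul m z') c)
  have f1 := Pf.le_total (S := S) (Γ := [E]) (a := z) (b := z') (by omega)
  let Δ := [eq (add z.lift (var 0)) z'.lift, le z.lift z'.lift, E.lift]
  have f2 := hyp (S := S) (Γ := Δ) (A := eq (add z.lift (var 0)) z'.lift) (by simp [Δ])
    (by simp [Fml.size, Term.size]; omega)
  have f3 := hyp (S := S) (Γ := Δ)
    (A := eq (add (smul m z.lift) a.lift) (add (smul m z'.lift) c.lift)) (by simp [Δ, E])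
    (by simp [Fml.size, Term.size, ← lift_smul]; omega)
  have f4 := hc.lincomb₂ (smul_congr m f2 (by simp [-lift_smul]; omega)
      (by simp [← lift_smul]; omega)) (symm f3 (by simp [Term.size, ← lift_smul]; omega))
    (t := add (smul m (var 0)) c.lift) (u := a.lift)
    (fun ρ => by simp only [eval, eval_smul, eval_lift]; ring)
    (by simp [Term.size, ← lift_smul]; omega) (by simp [Term.size, ← lift_smul]; omega)
  have f5 := exE (B := modEq m a c) (hyp (S := S) (Γ := [le z z', E]) (A := le z z') (by simp)
    (by simp; omega)) (by simpa [Δ] using modEq_intro₁ _ (by simp; omega) f4)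
  let Δ' := [eq (add z'.lift (var 0)) z.lift, le z'.lift z.lift, E.lift]
  have g2 := hyp (S := S) (Γ := Δ') (A := eq (add z'.lift (var 0)) z.lift) (by simp [Δ'])
    (by simp [Fml.size, Term.size]; omega)
  have g3 := hyp (S := S) (Γ := Δ')
    (A := eq (add (smul m z.lift) a.lift) (add (smul m z'.lift) c.lift)) (by simp [Δ', E])
    (by simp [Fml.size, Term.size, ← lift_smul]; omega)
  have g4 := hc.lincomb₂ (smul_congr m g2 (by simp [-lift_smul]; omega)
      (by simp [← lift_smul]; omega)) g3
    (t := add (smul m (var 0)) a.lift) (u := c.lift)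
    (fun ρ => by simp only [eval, eval_smul, eval_lift]; ring)
    (by simp [Term.size, ← lift_smul]; omega) (by simp [Term.size, ← lift_smul]; omega)
  have g5 := exE (B := modEq m a c) (hyp (S := S) (Γ := [le z' z, E]) (A := le z' z) (by simp)
    (by simp; omega)) (by simpa [Δ'] using modEq_intro₂ _ (by simp; omega) g4)
  exact (orE f1 f5 g5).mono (by omega)

end Calc
end PrA

/-! ### Transitivity of congruences, shifts by multiples of `D`, and invariance of atomic formulas
-/

namespace PrA

/-- The formula `∃ q, D q + y' = y`. -/
def Fml.shift (D : ℕ) (y y' : Term) : Fml :=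
  ex (eq (.add (.smul D (.var 0)) y'.lift) y.lift)

@[simp] theorem Fml.subst_shift (D : ℕ) (y y' : Term) (σ : ℕ → Term) :
    (shift D y y').subst σ = shift D (y.subst σ) (y'.subst σ) := by
  simp [shift, subst, Term.subst]

@[simp] theorem Fml.lift_shift (D : ℕ) (y y' : Term) :
    (shift D y y').lift = shift D y.lift y'.lift := subst_shift D y y' _

theorem Fml.size_shift_le (D : ℕ) (y y' : Term) :
    (shift D y y').size ≤ 2 * D + y.size + y'.size + 5 := by
  have := Term.size_smul_le D (.var 0)
  simp only [shift, size, Term.size, Term.size_lift] at *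
  omega

namespace Calc

open Pf Fml Term

variable {B S K D n m k w : ℕ} {Γ : List Fml} {A C : Fml} {a b c d s t u v y y' z z' : Term}

/-- Each hypothesis has two orientations, which makes four cases. In each of them `b` cancels from
the combined equations, and what remains has the form treated by `modEq_of_eq`. -/
theorem modEq_trans (hc : Calc B S K) (h : Pf S n Γ (modEq m a b)) (h' : Pf S k Γ (modEq m b c))
    (hB : 100 * (a.size + b.size + c.size + 2 * m + 5) ≤ B) :
    Pf S (n + k + 60 * K) Γ (modEq m a c) := by
  have hS := hc.formula
  have hK := hc.nodes
  have e1 := size_modEq_le m a b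
  have e2 := size_modEq_le m b c
  have e3 := size_modEq_le m a c
  have e4 := size_smul_le m (var 0)
  have e4' := size_smul_le m (var 1)
  have e5 := size_smul_le m (add (var 1) (var 0))
  have e6 := size_smul_le m zero
  simp only [Term.size] at *
  refine (app₂ (m := 59 * K + 50) (by omega) ?_ h h').mono (by omega)
  have X : ∀ (Y : Fml) (p q : Term), p.size = b.size ∧ q.size = a.size ∨
        p.size = a.size ∧ q.size = b.size →
      Pf S 1 (Y :: (eq (add (smul m (var 0)) p) q ::
          [modEq m a b, modEq m b c].map lift).map lift)
        (eq (add (smul m (var 1)) p.lift) q.lift) := fun Y p q h =>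
    hyp (by simp) (by simp [Fml.size, Term.size]; omega)
  have Y : ∀ (Γ : List Fml) (p q : Term), p.size = b.size ∧ q.size = c.size ∨
        p.size = c.size ∧ q.size = b.size →
      Pf S 1 (eq (add (smul m (var 0)) p.lift.lift) q.lift.lift :: Γ)
        (eq (add (smul m (var 0)) p.lift.lift) q.lift.lift) := fun Γ p q h =>
    hyp (by simp) (by simp [Fml.size, Term.size]; omega)
  have M : ∀ (p q : Term), Pf S 1 (eq (add (smul m (var 0)) p) q ::
      [modEq m a b, modEq m b c].map lift) (modEq m b.lift c.lift) := fun p q =>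
    hyp (by simp) ((size_modEq_le _ _ _).trans (by simp; omega))
  have sX : 2 * (add (smul m (var 1)) b.lift.lift).size + 1 ≤ S := by
    simp [Term.size]; omega
  have sY : 2 * (add (smul m (var 0)) c.lift.lift).size + 1 ≤ S := by
    simp [Term.size]; omega
  have f11 := hc.lincomb₂ (X _ b.lift a.lift (by simp)) (Y _ c b (by simp))
    (t := add (smul m (add (var 1) (var 0))) c.lift.lift) (u := add (smul m zero) a.lift.lift)
    (fun ρ => by simp only [eval, eval_smul, eval_lift]; ring)
    (by simp [Term.size]; omega) (by simp [Term.size]; omega)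
  have f12 := hc.lincomb₂ (symm (X _ b.lift a.lift (by simp)) sX) (Y _ b c (by simp))
    (t := add (smul m (var 0)) a.lift.lift) (u := add (smul m (var 1)) c.lift.lift)
    (fun ρ => by simp only [eval, eval_smul, eval_lift]; ring)
    (by simp [Term.size]; omega) (by simp [Term.size]; omega)
  have f21 := hc.lincomb₂ (X _ a.lift b.lift (by simp)) (symm (Y _ c b (by simp)) sY)
    (t := add (smul m (var 1)) a.lift.lift) (u := add (smul m (var 0)) c.lift.lift)
    (fun ρ => by simp only [eval, eval_smul, eval_lift]; ring)
    (by simp [Term.size]; omega) (by simp [Term.size]; omega)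
  have f22 := hc.lincomb₂ (X _ a.lift b.lift (by simp)) (Y _ b c (by simp))
    (t := add (smul m (add (var 1) (var 0))) a.lift.lift) (u := add (smul m zero) c.lift.lift)
    (fun ρ => by simp only [eval, eval_smul, eval_lift]; ring)
    (by simp [Term.size]; omega) (by simp [Term.size]; omega)
  have h10 : m * (add (var 1) (var 0)).size = m * 3 := rfl
  have g11 := hc.modEq_of_eq (symm f11 (by simp [Term.size]; omega))
    (by simp [Term.size]; omega)
  have g12 := hc.modEq_of_eq f12 (by simp [Term.size]; omega)
  have g21 := hc.modEq_of_eq f21 (by simp [Term.size]; omega)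
  have g22 := hc.modEq_of_eq f22 (by simp [Term.size]; omega)
  have k1 := modEq_elim (A := modEq m a.lift c.lift) (M b.lift a.lift) (by simpa using g11)
    (by simpa using g12)
  have k2 := modEq_elim (A := modEq m a.lift c.lift) (M a.lift b.lift) (by simpa using g21)
    (by simpa using g22)
  exact (modEq_elim (A := modEq m a c) (hyp (A := modEq m a b) (by simp) (by omega))
    (by simpa using k1) (by simpa using k2)).mono (by omega)

theorem modEq_of_shift (hc : Calc B S K) (hD : m ∣ D) (hD0 : 0 < D) (h : Pf S n Γ (shift D y y'))
    (hB : 10 * (y.size + y'.size + 4 * D + 5) ≤ B) : Pf S (n + 3 * K) Γ (modEq m y y') := by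
  have hS := hc.formula
  have hK := hc.nodes
  obtain ⟨e, rfl⟩ := hD
  have hm : m ≤ m * e := Nat.le_of_dvd hD0 (Dvd.intro e rfl)
  have hm' : 0 < m := Nat.pos_of_ne_zero fun h => by simp [h] at hD0
  have hm'' : e ≤ m * e := Nat.le_of_dvd hD0 (Dvd.intro_left m rfl)
  have e1 := size_modEq_le m y y'
  have e2 := size_shift_le (m * e) y y'
  have e3 := size_smul_le (m * e) (var 0)
  have e4 := size_smul_le m (smul e (var 0))
  have e5 := size_smul_le e (var 0)
  have e6 : m * ((smul e (var 0)).size + 1) ≤ m * (2 * e + 2) := by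
    refine Nat.mul_le_mul_left _ ?_
    simp only [Term.size] at *; omega
  simp only [Term.size, mul_add, mul_left_comm m 2] at *
  refine (app₁ (m := 2 * K + 20) (by omega) ?_ h).mono (by omega)
  have f1 := hc.lincomb (hyp (S := S)
      (Γ := eq (add (smul (m * e) (var 0)) y'.lift) y.lift :: [shift (m * e) y y'].map lift)
      (A := eq (add (smul (m * e) (var 0)) y'.lift) y.lift) (by simp)
      (by simp [Fml.size, Term.size]; omega))
    (t := add (smul m (smul e (var 0))) y'.lift) (u := y.lift)
    (fun ρ => by simp only [eval, eval_smul]; ring) (by simp [Term.size]; omega)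
    (by simp [Term.size]; omega)
  have f2 := modEq_intro₁ _ (by simp; omega) f1
  exact (exE (B := modEq m y y') (hyp (A := shift (m * e) y y') (by simp) (by omega))
    (by simpa using f2)).mono (by omega)

theorem modEq_iff_of_shift (hc : Calc B S K) (hD : m ∣ D) (hD0 : 0 < D)
    (h : Pf S n Γ (shift D y y')) (hB : 100 * (y.size + y'.size + u.size + 4 * D + 5) ≤ B) :
    Pf S (2 * n + 200 * K) Γ (iff (modEq m y u) (modEq m y' u)) ∧
      Pf S (2 * n + 200 * K) Γ (iff (modEq m u y) (modEq m u y')) := by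
  have hS := hc.formula
  have hK := hc.nodes
  have hm : m ≤ D := Nat.le_of_dvd hD0 hD
  have e1 := size_modEq_le m y u
  have e2 := size_modEq_le m y' u
  have e3 := size_modEq_le m u y
  have e4 := size_modEq_le m u y'
  have M := hc.modEq_of_shift hD hD0 h (by omega)
  have M' := hc.modEq_symm M (by omega)
  have f : ∀ {A : Fml} {k : ℕ} {C : Fml}, Pf S k Γ C → Pf S (k + 1) (A :: Γ) C := fun h =>
    weaken (by simp) (by simp) h
  constructor
  · exact (andI (by simp only [Fml.size]; omega)
      (impI (by simp only [Fml.size]; omega) (hc.modEq_trans (f M') (hyp (by simp) (by omega))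
        (by omega)))
      (impI (by simp only [Fml.size]; omega) (hc.modEq_trans (f M) (hyp (by simp) (by omega))
        (by omega)))).mono (by omega)
  · exact (andI (by simp only [Fml.size]; omega)
      (impI (by simp only [Fml.size]; omega) (hc.modEq_trans (hyp (by simp) (by omega)) (f M)
        (by omega)))
      (impI (by simp only [Fml.size]; omega) (hc.modEq_trans (hyp (by simp) (by omega)) (f M')
        (by omega)))).mono (by omega)

/-! ## Equations and inequalities -/

/-- As `u` is strictly below both `y` and `y'`, the truth value of each atomic formula is known: `u
≤ y` is true, while `y ≤ u` and both equations are false, and likewise for `y'`. -/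
theorem rel_iff_of_lt (hc : Calc B S K) {R : Rel} (hR : ∀ m, R ≠ .mod m)
    (h : Pf S n Γ (le (add u one) y)) (h' : Pf S m Γ (le (add u one) y'))
    (hB : 100 * (u.size + y.size + y'.size + 5) ≤ B) :
    Pf S (n + m + 40 * K) Γ (iff (QF.rel R u y).toFml (QF.rel R u y').toFml) ∧
      Pf S (n + m + 40 * K) Γ (iff (QF.rel R y u).toFml (QF.rel R y' u).toFml) := by
  have hS := hc.formula
  have hK := hc.nodes
  have f : ∀ {A : Fml} {k : ℕ} {C : Fml}, Pf S k Γ C → Pf S (k + 1) (A :: Γ) C := fun h =>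
    weaken (by simp) (by simp) h
  have F : ∀ {y : Term} {l k : ℕ} {A : Fml}, 100 * (u.size + y.size + 5) ≤ B →
      Pf S l Γ (le (add u one) y) → Pf S k (A :: Γ) (le y u) →
      Pf S (k + l + 9 * K) (A :: Γ) bot := fun hy h h' =>
    (hc.false_of_le zero h' (f h) (fun ρ => by simp only [eval]; ring)
      (by simp only [Term.size]; omega)).mono (by omega)
  cases R with
  | mod m => exact absurd rfl (hR m)
  | eq =>
    refine ⟨iff_of_false ?_ (F ?_ h (hc.le_of_eq (symm (hyp (by simp [QF.toFml]) ?_) ?_) ?_))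
      (F ?_ h' (hc.le_of_eq (symm (hyp (by simp [QF.toFml]) ?_) ?_) ?_)) |>.mono ?_,
      iff_of_false ?_ (F ?_ h (hc.le_of_eq (hyp (by simp [QF.toFml]) ?_) ?_))
        (F ?_ h' (hc.le_of_eq (hyp (by simp [QF.toFml]) ?_) ?_)) |>.mono ?_⟩ <;>
    (try simp only [QF.toFml, Fml.size]) <;> omega
  | le =>
    refine ⟨iff_of_true ?_ (hc.le_lincomb one h (fun ρ => by simp only [eval]; ring) ?_)
      (hc.le_lincomb one h' (fun ρ => by simp only [eval]; ring) ?_) |>.mono ?_,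
      iff_of_false ?_ (F ?_ h (hyp (by simp [QF.toFml]) ?_))
        (F ?_ h' (hyp (by simp [QF.toFml]) ?_)) |>.mono ?_⟩ <;>
    (try simp only [QF.toFml, Fml.size_le, Term.size]) <;> omega

theorem rel_iff_of_gt (hc : Calc B S K) {R : Rel} (hR : ∀ m, R ≠ .mod m)
    (h : Pf S n Γ (le (add y one) u)) (h' : Pf S m Γ (le (add y' one) u))
    (hB : 100 * (u.size + y.size + y'.size + 5) ≤ B) :
    Pf S (n + m + 40 * K) Γ (iff (QF.rel R u y).toFml (QF.rel R u y').toFml) ∧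
      Pf S (n + m + 40 * K) Γ (iff (QF.rel R y u).toFml (QF.rel R y' u).toFml) := by
  have hS := hc.formula
  have hK := hc.nodes
  have f : ∀ {A : Fml} {k : ℕ} {C : Fml}, Pf S k Γ C → Pf S (k + 1) (A :: Γ) C := fun h =>
    weaken (by simp) (by simp) h
  have F : ∀ {y : Term} {l k : ℕ} {A : Fml}, 100 * (u.size + y.size + 5) ≤ B →
      Pf S l Γ (le (add y one) u) → Pf S k (A :: Γ) (le u y) →
      Pf S (k + l + 9 * K) (A :: Γ) bot := fun hy h h' =>
    (hc.false_of_le zero h' (f h) (fun ρ => by simp only [eval]; ring)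
      (by simp only [Term.size]; omega)).mono (by omega)
  cases R with
  | mod m => exact absurd rfl (hR m)
  | eq =>
    refine ⟨iff_of_false ?_ (F ?_ h (hc.le_of_eq (hyp (by simp [QF.toFml]) ?_) ?_))
        (F ?_ h' (hc.le_of_eq (hyp (by simp [QF.toFml]) ?_) ?_)) |>.mono ?_,
      iff_of_false ?_ (F ?_ h (hc.le_of_eq (symm (hyp (by simp [QF.toFml]) ?_) ?_) ?_))
      (F ?_ h' (hc.le_of_eq (symm (hyp (by simp [QF.toFml]) ?_) ?_) ?_)) |>.mono ?_⟩ <;>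
    (try simp only [QF.toFml, Fml.size]) <;> omega
  | le =>
    refine ⟨iff_of_false ?_ (F ?_ h (hyp (by simp [QF.toFml]) ?_))
        (F ?_ h' (hyp (by simp [QF.toFml]) ?_)) |>.mono ?_,
      iff_of_true ?_ (hc.le_lincomb one h (fun ρ => by simp only [eval]; ring) ?_)
      (hc.le_lincomb one h' (fun ρ => by simp only [eval]; ring) ?_) |>.mono ?_⟩ <;>
    (try simp only [QF.toFml, Fml.size_le, Term.size]) <;> omega

/-- If no bound `u` lies strictly between `s` and `y`, then equations and inequalities with `u` do
not distinguish `y` from any `y'` with `s < y' ≤ y`. -/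
theorem rel_iff_of_gap (hc : Calc B S K) {R : Rel} (hR : ∀ m, R ≠ .mod m)
    (h : Pf S n Γ (le (add s one) y')) (h' : Pf S m Γ (le y' y))
    (hu : Pf S k Γ (or (le u s) (le (add y one) u)))
    (hB : 200 * (s.size + u.size + y.size + y'.size + 5) ≤ B) :
    Pf S (4 * n + 4 * m + k + 200 * K) Γ (iff (QF.rel R u y).toFml (QF.rel R u y').toFml) ∧
      Pf S (4 * n + 4 * m + k + 200 * K) Γ (iff (QF.rel R y u).toFml (QF.rel R y' u).toFml) := by
  have hS := hc.formula
  have hK := hc.nodes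
  have f : ∀ {A : Fml} {k : ℕ} {C : Fml}, Pf S k Γ C → Pf S (k + 1) (A :: Γ) C := fun h =>
    weaken (by simp) (by simp) h
  have e1 := hc.le_lincomb₂ (t := add u one) (u := y') zero
    (hyp (S := S) (Γ := le u s :: Γ) (A := le u s) (by simp) (by simp; omega)) (f h)
    (fun ρ => by simp only [eval]; ring) (by simp only [Term.size]; omega)
  have e2 := hc.le_lincomb₂ (t := add u one) (u := y) zero e1 (f h')
    (fun ρ => by simp only [eval]; ring) (by simp only [Term.size]; omega)
  have e3 := hyp (S := S) (Γ := le (add y one) u :: Γ) (A := le (add y one) u) (by simp)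
    (by simp [Term.size]; omega)
  have e4 := hc.le_lincomb₂ (t := add y' one) (u := u) zero e3 (f h')
    (fun ρ => by simp only [eval]; ring) (by simp only [Term.size]; omega)
  have e5 := hc.rel_iff_of_lt hR e2 e1 (by omega)
  have e6 := hc.rel_iff_of_gt hR e3 e4 (by omega)
  exact ⟨(orE hu e5.1 e6.1).mono (by omega), (orE hu e5.2 e6.2).mono (by omega)⟩

/-! ## Multiplying atomic formulas by a factor -/

theorem modEq_smul (hc : Calc B S K) (h : Pf S n Γ (modEq m t u))
    (he : ∀ ρ, a.eval ρ + k * u.eval ρ = b.eval ρ + k * t.eval ρ) (hk : 0 < k)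
    (hB : 20 * (k * (t.size + u.size + 10) + a.size + b.size + 4 * (m * k) + 5) ≤ B) :
    Pf S (n + 10 * K) Γ (modEq (m * k) a b) := by
  have hS := hc.formula
  have hK := hc.nodes
  have hmk : m ≤ m * k := Nat.le_mul_of_pos_right _ hk
  have h0 : t.size + u.size + 10 ≤ k * (t.size + u.size + 10) := Nat.le_mul_of_pos_left _ hk
  have e1 := size_modEq_le m t u
  have e2 := size_modEq_le (m * k) a b
  have e3 := size_smul_le m (var 0)
  have e4 := size_smul_le (m * k) (var 0)
  have e5 := size_smul_le k (add (smul m (var 0)) u.lift)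
  have e6 := size_smul_le k (add (smul m (var 0)) t.lift)
  have e7 : k * (smul m (var 0)).size ≤ k * (2 * m + 1) := by
    refine Nat.mul_le_mul_left _ ?_
    simp only [Term.size] at *; omega
  have e8 := size_smul_le k t.lift
  have e9 := size_smul_le k u.lift
  simp only [Term.size, mul_add, mul_left_comm k 2, mul_comm k m] at *
  refine (app₁ (m := 8 * K + 50) (by omega) ?_ h).mono (by omega)
  have f1 := hc.lincomb_smul k (hyp (S := S)
      (Γ := eq (add (smul m (var 0)) u.lift) t.lift :: [modEq m t u].map lift)
      (A := eq (add (smul m (var 0)) u.lift) t.lift) (by simp)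
      (by simp [Fml.size, Term.size]; omega))
    (t := add (smul (m * k) (var 0)) b.lift) (u := a.lift)
    (fun ρ => by
      have := he fun i => ρ (i + 1)
      simp only [eval, eval_smul, eval_lift]; linarith) (by simp [Term.size, ← lift_smul] at *; omega)
    (by simp at *; omega)
  have f2 := hc.lincomb_smul k (hyp (S := S)
      (Γ := eq (add (smul m (var 0)) t.lift) u.lift :: [modEq m t u].map lift)
      (A := eq (add (smul m (var 0)) t.lift) u.lift) (by simp)
      (by simp [Fml.size, Term.size]; omega))
    (t := add (smul (m * k) (var 0)) a.lift) (u := b.lift)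
    (fun ρ => by
      have := he fun i => ρ (i + 1)
      simp only [eval, eval_smul, eval_lift]; linarith) (by simp [Term.size] at *; omega)
    (by simp at *; omega)
  have f3 := modEq_intro₁ _ (by simp; omega) f1
  have f4 := modEq_intro₂ _ (by simp; omega) f2
  exact (modEq_elim (A := modEq (m * k) a b) (hyp (A := modEq m t u) (by simp) (by omega))
    (by simpa using f3) (by simpa using f4)).mono (by omega)

/-- The same witness `z` serves: by `he` the equation `m k z + b = a` amounts to `k (m z + u) = k
t`, and `eq_of_smul` cancels `k`. The other orientation is alike. -/
theorem modEq_of_smul (hc : Calc B S K) (h : Pf S n Γ (modEq (m * k) a b))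
    (he : ∀ ρ, a.eval ρ + k * u.eval ρ = b.eval ρ + k * t.eval ρ) (hk : 0 < k)
    (hB : 50 * (k * (t.size + u.size + 10) + a.size + b.size + 4 * (m * k) + 5) ≤ B) :
    Pf S (n + 110 * K) Γ (modEq m t u) := by
  have hS := hc.formula
  have hK := hc.nodes
  have hmk : m ≤ m * k := Nat.le_mul_of_pos_right _ hk
  have h0 : t.size + u.size + 10 ≤ k * (t.size + u.size + 10) := Nat.le_mul_of_pos_left _ hk
  have e1 := size_modEq_le m t u
  have e2 := size_modEq_le (m * k) a b
  have e3 := size_smul_le m (var 0)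
  have e4 := size_smul_le (m * k) (var 0)
  have e7 : k * (smul m (var 0)).size ≤ k * (2 * m + 1) := by
    refine Nat.mul_le_mul_left _ ?_
    simp only [Term.size] at *; omega
  simp only [Term.size, mul_add, mul_left_comm k 2, mul_comm k m] at *
  refine (app₁ (m := 109 * K) (by omega) ?_ h).mono (by omega)
  have f1 := hc.eq_of_smul hk (hyp (S := S)
      (Γ := eq (add (smul (m * k) (var 0)) b.lift) a.lift :: [modEq (m * k) a b].map lift)
      (A := eq (add (smul (m * k) (var 0)) b.lift) a.lift) (by simp)
      (by simp [Fml.size, Term.size]; omega))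
    (t := add (smul m (var 0)) u.lift) (u := t.lift)
    (fun ρ => by
      have := he fun i => ρ (i + 1)
      simp only [eval, eval_smul, eval_lift]; linarith)
    (by simp only [Term.size, Term.size_lift, mul_add]; omega)
  have f2 := hc.eq_of_smul hk (hyp (S := S)
      (Γ := eq (add (smul (m * k) (var 0)) a.lift) b.lift :: [modEq (m * k) a b].map lift)
      (A := eq (add (smul (m * k) (var 0)) a.lift) b.lift) (by simp)
      (by simp [Fml.size, Term.size]; omega))
    (t := add (smul m (var 0)) t.lift) (u := u.lift)
    (fun ρ => by
      have := he fun i => ρ (i + 1)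
      simp only [eval, eval_smul, eval_lift]; linarith)
    (by simp only [Term.size, Term.size_lift, mul_add]; omega)
  have f3 := modEq_intro₁ _ (by simp; omega) f1
  have f4 := modEq_intro₂ _ (by simp; omega) f2
  exact (modEq_elim (A := modEq m t u) (hyp (A := modEq (m * k) a b) (by simp) (by omega))
    (by simpa using f3) (by simpa using f4)).mono (by omega)

/-- If `k t` and `k u` differ from `a` and `b` by the same summands, then the relations between
`t` and `u` are equivalent to the scaled relations between `a` and `b`. -/
theorem rel_scale_iff (hc : Calc B S K) {R : Rel} (hR : ∀ m, R = .mod m → m * k ≤ w) (hk : 0 < k)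
    (he : ∀ ρ, a.eval ρ + k * u.eval ρ = b.eval ρ + k * t.eval ρ)
    (hB : 100 * (k * (t.size + u.size + 10) + a.size + b.size + 4 * w + 5) ≤ B) :
    Pf S (200 * K) Γ (iff (QF.rel R t u).toFml (QF.rel (R.scale k) a b).toFml) := by
  have hS := hc.formula
  have hK := hc.nodes
  have h0 : t.size + u.size + 10 ≤ k * (t.size + u.size + 10) := Nat.le_mul_of_pos_left _ hk
  have h1 : k * (t.size + u.size + 10) = k * (t.size + u.size + 5) + k * 5 := by ring
  have := size_smul_le k t
  have := size_smul_le k u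
  simp only [mul_add] at *
  cases R with
  | eq =>
    refine (iffI (A := eq t u) (C := eq a b) (by simp only [Fml.size]; omega)
      (hc.lincomb_smul k (hyp (A := eq t u) (by simp) (by simp only [Fml.size]; omega)) he
        (by omega) (by omega))
      (hc.eq_of_smul hk (hyp (A := eq a b) (by simp) (by simp only [Fml.size]; omega)) he
        (by simp only [mul_add]; omega))).mono (by omega)
  | le =>
    refine (iffI (A := le t u) (C := le a b) (by simp only [Fml.size_le]; omega)
      (hc.le_smul (k := k) (hyp (A := le t u) (by simp) (by simp only [Fml.size_le]; omega)) he
        (by simp only [mul_add]; omega))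
      (hc.le_of_smul hk (hyp (A := le a b) (by simp) (by simp only [Fml.size_le]; omega)) he
        (by simp only [mul_add]; omega))).mono (by omega)
  | mod m =>
    have hw := hR m rfl
    have hmk : m ≤ m * k := Nat.le_mul_of_pos_right _ hk
    have e1 := size_modEq_le m t u
    have e2 := size_modEq_le (m * k) a b
    refine (iffI (A := modEq m t u) (C := modEq (m * k) a b) (by omega)
      (hc.modEq_smul (k := k) (hyp (A := modEq m t u) (by simp) (by omega)) he hk
        (by simp only [mul_add]; omega))
      (hc.modEq_of_smul (hyp (A := modEq (m * k) a b) (by simp) (by omega)) he hk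
        (by simp only [mul_add]; omega))).mono (by omega)

end Calc
end PrA

/-! ### Division with remainder by an arbitrary positive number -/

namespace PrA

/-- The formula stating that `v` can be divided by `D` with a remainder. -/
def Fml.division (D : ℕ) (v : Term) : Fml :=
  disj ((List.range D).map fun r => shift D v (.num r))

@[simp] theorem Fml.lift_division (D : ℕ) (v : Term) :
    (division D v).lift = division D v.lift := by
  simp [division, Function.comp_def]

theorem Fml.size_division_le (D : ℕ) (v : Term) :
    (division D v).size ≤ D * (4 * D + v.size + 10) + 1 := by
  have := size_disj_le (l := (List.range D).map fun r => shift D v (.num r))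
    (b := 4 * D + v.size + 9) (by
      simp only [List.mem_map, List.mem_range, forall_exists_index, and_imp]
      rintro _ r hr rfl
      have := size_shift_le D v (.num r)
      have := Term.size_num_le r
      omega)
  simpa [division] using this

namespace Calc

open Pf Fml Term

variable {B S K D M n m k w p : ℕ} {Γ : List Fml} {A C : Fml} {a b c d s t u v y y' z z' : Term}

theorem shift_intro (z : Term) (hS : y.size + y'.size + 2 * D + 5 ≤ S)
    (h : Pf S n Γ (eq (add (smul D z) y') y)) : Pf S (n + 1) Γ (shift D y y') := by
  have := size_smul_le D (var 0)
  exact exI z (by simp [Fml.size, Term.size] at *; omega) (by simpa using h)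

/-- This is the unwanted orientation of `v ≡ i`. If `z = 0`, then `v = i` and the quotient is `0`.
If `z = z₀ + 1`, then `p z₀ + v + (p - 1 - i) + 1 = 0`, which is absurd. -/
theorem shift_of_lt {i : ℕ} (hc : Calc B S K) (hi : i < p)
    (h : Pf S n Γ (eq (add (smul p z) v) (num i)))
    (hB : 20 * (p * (z.size + 5) + z.size + v.size + 2 * p + 10) ≤ B) :
    Pf S (n + 9 * K) Γ (shift p v (num i)) := by
  have hS := hc.formula
  have hK := hc.nodes
  have e1 := size_num_le i
  have e2 := size_num_le (p - 1 - i)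
  have e3 := size_smul_le p z
  have e4 := size_smul_le p (var 0)
  have e5 := size_smul_le p (add (var 0) one)
  have e6 := size_smul_le p zero
  have e7 := size_shift_le p v (num i)
  simp only [Term.size, mul_add] at *
  refine (app₁ (m := 8 * K + 50) (by simp only [Fml.size, Term.size]; omega) ?_ h).mono (by omega)
  let E := eq (add (smul p z) v) (num i)
  have f1 := em (S := S) (Γ := [E]) (A := eq z zero) (by simp [Fml.size, Term.size]; omega)
  have f2 := smul_congr p (hyp (S := S) (Γ := [eq z zero, E]) (A := eq z zero) (by simp)
    (by simp [Fml.size, Term.size]; omega)) (by omega) (by omega)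
  have f3 := hc.lincomb₂ f2 (symm (hyp (S := S) (Γ := [eq z zero, E]) (A := E) (by simp)
      (by simp [E, Fml.size, Term.size]; omega)) (by simp [Term.size]; omega))
    (t := add (smul p zero) (num i)) (u := v)
    (fun ρ => by simp only [eval, eval_smul, eval_num]; ring) (by simp only [Term.size]; omega)
    (by omega)
  have f4 := shift_intro _ (by omega) f3
  have f5 := exists_pred (S := S) (Γ := [(eq z zero).neg, E]) (a := z) (by omega)
    (hyp (by simp) (by simp [Fml.size, Term.size]; omega))
  let Δ := [eq z.lift (add (var 0) one), (eq z zero).neg.lift,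
    eq (add (smul p z.lift) v.lift) (num i)]
  have f6 := smul_congr p (hyp (S := S) (Γ := Δ) (A := eq z.lift (add (var 0) one)) (by simp [Δ])
    (by simp [Fml.size, Term.size]; omega)) (by simp [← lift_smul]; omega)
    (by simp [← lift_smul]; omega)
  have f7 := hc.lincomb₂ (symm f6 (by simp [← lift_smul]; omega)) (hyp (S := S) (Γ := Δ)
      (A := eq (add (smul p z.lift) v.lift) (num i)) (by simp [Δ])
      (by simp [Fml.size, Term.size, ← lift_smul]; omega))
    (t := add (add (add (smul p (var 0)) v.lift) (num (p - 1 - i))) one) (u := zero)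
    (fun ρ => by
      have : (p - 1 - i) + 1 + i = p := by omega
      simp only [eval, eval_smul, eval_num]
      linarith)
    (by simp [Term.size, ← lift_smul]; omega) (by simp [Term.size, ← lift_smul]; omega)
  have f7' := succ_ne_zero (by simp only [Term.size, Term.size_lift]; omega) f7
  have f8 := exE (B := bot) f5 (by simpa [Δ, E] using f7')
  exact (orE f1 f4 (exfalso (by omega) f8)).mono (by omega)

theorem division_prime (hc : Calc B S K) (hp : p.Prime)
    (hB : 20 * (10 * p + v.size + 10) ≤ B)
    (hS' : 10 * (p + 1) * (4 * p + v.size + 20) ≤ S) :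
    Pf S (p * (12 * K + p) + K) Γ (division p v) := by
  have hS := hc.formula
  have hK := hc.nodes
  have hv := v.size_pos
  have e1 := size_division_le p v
  have e2 : (axMod p).size ≤ p * (8 * p + 35) + 3 := by
    have := size_disj_le (l := (List.range p).map fun i => modEq p (var 0) (num i))
      (b := 8 * p + 34) (by
        simp only [List.mem_map, List.mem_range, forall_exists_index, and_imp]
        rintro _ i hi rfl
        have := size_modEq_le p (var 0) (num i)
        have := size_num_le i
        simp only [Term.size] at *
        omega)
    simp only [axMod, Fml.size]
    simpa using this
  have e3 : (disj ((List.range p).map fun i => modEq p v (num i))).size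
      ≤ p * (8 * p + 2 * v.size + 30) + 1 := by
    have := size_disj_le (l := (List.range p).map fun i => modEq p v (num i))
      (b := 8 * p + 2 * v.size + 29) (by
        simp only [List.mem_map, List.mem_range, forall_exists_index, and_imp]
        rintro _ i hi rfl
        have := size_modEq_le p v (num i)
        have := size_num_le i
        omega)
    simpa using this
  have e4 : ((disj ((List.range p).map fun i => modEq p (var 0) (num i))).inst v) =
      disj ((List.range p).map fun i => modEq p v (num i)) := by
    simp [Function.comp_def]
  have e5 : p * (8 * p + 2 * v.size + 30) + p * (4 * p + v.size + 10) + 20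
      ≤ 10 * (p + 1) * (4 * p + v.size + 20) := by nlinarith
  have e6 : p * (8 * p + 35) + 3 ≤ 10 * (p + 1) * (4 * p + v.size + 20) := by nlinarith
  have f0 := ax (S := S) (Γ := Γ) (A := axMod p) (.inr ⟨p, hp, rfl⟩) (by omega)
  have f1 := allE v (by rw [e4]; omega) f0
  rw [e4] at f1
  refine (disjE (m := 11 * K + p) (by omega) f1 ?_).mono ?_
  · simp only [List.mem_map, List.mem_range, forall_exists_index, and_imp]
    rintro _ i hi rfl
    have s1 := size_num_le i
    have s2 := size_smul_le p (var 0)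
    have s3 := size_shift_le p v (num i)
    simp only [Term.size] at s2
    have g1 := shift_intro (S := S) (y := v.lift) (y' := num i) (D := p)
      (Γ := eq (add (smul p (var 0)) (num i).lift) v.lift :: (modEq p v (num i) :: Γ).map lift)
      (var 0) (by simp; omega) (hyp (by simp) (by simp [Fml.size, Term.size]; omega))
    have g2 := hc.shift_of_lt (v := v.lift) (z := var 0) hi (hyp (S := S)
      (Γ := eq (add (smul p (var 0)) v.lift) (num i).lift :: (modEq p v (num i) :: Γ).map lift)
      (by simp) (by simp [Fml.size, Term.size]; omega)) (by simp only [Term.size, Term.size_lift]; omega)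
    have s4 := size_modEq_le p v (num i)
    have g3 := modEq_elim (A := shift p v (num i)) (hyp (S := S) (A := modEq p v (num i))
      (Γ := modEq p v (num i) :: Γ) (by simp) (by omega)) (by simpa using g1) (by simpa using g2)
    exact (disjI (l := (List.range p).map fun r => shift p v (num r))
      (List.mem_map.2 ⟨i, List.mem_range.2 hi, rfl⟩) (by rw [← division]; omega) g3).mono
      (by simp; omega)
  · simp only [List.length_map, List.length_range]
    have : p * (11 * K + p + 5) + 5 * p ≤ p * (12 * K + p) := by nlinarith
    omega

/-- From `v = p x + i` and `x = q z + j` one gets `v = p q z + (p j + i)`, with `p j + i < p q`.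
Only the variable `x` is divided by `q`, so terms do not grow from one factor to the next. That
division is repeated in each of the `p` branches, whence `p * N₂`. -/
theorem division_mul {q N₁ N₂ : ℕ} (hc : Calc B S K) (hp : 0 < p) (hq : 0 < q)
    (h₁ : Pf S N₁ Γ (division p v)) (h₂ : ∀ Γ, Pf S N₂ Γ (division q (var 0)))
    (hB : 20 * (10 * (p * q) + v.size + 10) ≤ B)
    (hS' : 10 * (p * q + 1) * (4 * (p * q) + v.size + 20) ≤ S) :
    Pf S (N₁ + p * (N₂ + q * (4 * K + p * q + 10) + 30) + 10) Γ (division (p * q) v) := by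
  have hS := hc.formula
  have hK := hc.nodes
  have hv := v.size_pos
  have hpq : p ≤ p * q := Nat.le_mul_of_pos_right _ hq
  have hqp : q ≤ p * q := Nat.le_mul_of_pos_left _ hp
  have e1 := size_division_le (p * q) v
  have e2 : (division p v).size ≤ (p * q) * (4 * (p * q) + v.size + 10) + 1 :=
    (size_division_le p v).trans (by gcongr)
  have e3 : (division q (var 0)).size ≤ (p * q) * (4 * (p * q) + v.size + 10) + 1 :=
    (size_division_le q (var 0)).trans (by gcongr; exact hv)
  have e4 : 10 * (p * q + 1) * (4 * (p * q) + v.size + 20) =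
      10 * ((p * q) * (4 * (p * q) + v.size + 10)) + 10 * (4 * (p * q) + v.size + 20) +
        100 * (p * q) := by ring
  rw [division] at h₁
  refine (disjE (m := N₂ + q * (4 * K + p * q + 10) + 25) (by rw [← division]; omega) h₁ ?_).mono ?_
  · simp only [List.mem_map, List.mem_range, forall_exists_index, and_imp]
    rintro _ i hi rfl
    have s1 := size_num_le i
    have s2 := size_shift_le p v (num i)
    have s3 := size_smul_le p (var 0)
    have s3' := size_smul_le p (var 1)
    simp only [Term.size] at s3 s3'
    let Δ := eq (add (smul p (var 0)) (num i)) v.lift :: (shift p v (num i) :: Γ).map lift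
    have g1 := h₂ Δ
    rw [division] at g1
    have g2 := disjE (m := 4 * K + p * q + 5) (C := division (p * q) v.lift)
      (by rw [← division, ← lift_division, Fml.size_lift]; omega) g1 ?_
    · have g3 := exE (B := division (p * q) v) (hyp (S := S) (A := shift p v (num i))
        (Γ := shift p v (num i) :: Γ) (by simp) (by omega)) (by simpa [Δ] using g2)
      exact g3.mono (by simp only [mul_add]; omega)
    · simp only [List.mem_map, List.mem_range, forall_exists_index, and_imp]
      rintro _ j hj rfl
      have hij : p * j + i < p * q := by nlinarith
      have s4 := size_num_le j
      have s5 := size_shift_le q (var 0) (num j)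
      have s6 := size_smul_le q (var 0)
      have s7 := size_num_le (p * j + i)
      have s8 := size_smul_le p (add (smul q (var 0)) (num j))
      have s9 := size_smul_le (p * q) (var 0)
      have s10 : p * ((add (smul q (var 0)) (num j)).size + 1) ≤ p * (4 * q + 5) := by
        refine Nat.mul_le_mul_left _ ?_
        simp only [Term.size] at *; omega
      simp only [Term.size, mul_add, mul_left_comm p 4] at s5 s6 s8 s9 s10
      let Δ' := eq (add (smul q (var 0)) (num j)) (var 1) :: (shift q (var 0) (num j) :: Δ).map lift
      have g3 := hyp (S := S) (Γ := Δ') (A := eq (add (smul q (var 0)) (num j)) (var 1))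
        (by simp [Δ']) (by simp [Fml.size, Term.size]; omega)
      have g4 := hyp (S := S) (Γ := Δ') (A := eq (add (smul p (var 1)) (num i)) v.lift.lift)
        (by simp [Δ', Δ]) (by simp [Fml.size, Term.size]; omega)
      have g5 := hc.lincomb₂ (smul_congr p g3 (by omega) (by omega)) g4
        (t := add (smul (p * q) (var 0)) (num (p * j + i))) (u := v.lift.lift)
        (fun ρ => by simp only [eval, eval_smul, eval_num, eval_lift]; ring)
        (by simp [Term.size]; omega) (by simp [Term.size]; omega)
      have g6 := shift_intro _ (by simp; omega) g5
      have g7 := exE (B := shift (p * q) v.lift (num (p * j + i)))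
        (hyp (S := S) (A := shift q (var 0) (num j)) (Γ := shift q (var 0) (num j) :: Δ) (by simp)
          (by omega)) (by simpa [Δ'] using g6)
      exact (disjI (l := (List.range (p * q)).map fun r => shift (p * q) v.lift (num r))
        (List.mem_map.2 ⟨_, List.mem_range.2 hij, rfl⟩)
        (by rw [← division, ← lift_division, Fml.size_lift]; omega) g7).mono (by simp; omega)
  · simp only [List.length_map, List.length_range, mul_add]
    omega

/-- Division with remainder has short derivations. -/
theorem division (hc : Calc B S K) (hD : 0 < D) (hDM : D ≤ M) (hv : v.size ≤ w)
    (hB : 20 * (10 * M + w + 10) ≤ B) (hS' : 10 * (M + 1) * (4 * M + w + 20) ≤ S) :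
    Pf S (3 * (15 * K + M) * (D * D)) Γ (division D v) := by
  have hS := hc.formula
  have hK := hc.nodes
  have hw : 1 ≤ w := v.size_pos.trans_le hv
  have hS'' : ∀ p ≤ M, ∀ u ≤ w, 10 * (p + 1) * (4 * p + u + 20) ≤ S := fun p hp u hu =>
    le_trans (by gcongr) hS'
  -- Repeating the division by `q` in `p` branches multiplies its cost by `p`, whereas the claimed
  -- quadratic bound grows by `p ^ 2`. As `p ≥ 2`, the difference absorbs the remaining costs of the
  -- step.
  induction D using induction_on_primes generalizing Γ v with
  | zero => omega
  | one =>
    have e1 := size_smul_le 1 v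
    have e2 := size_num_le 0
    have f1 := hc.eval_eq (Γ := Γ) (t := add (smul 1 v) (num 0)) (u := v)
      (fun ρ => by simp [eval]) (by simp only [Term.size]; omega) (by omega)
    have f2 := shift_intro v (by omega) f1
    exact (f2.mono (by omega) : Pf S (3 * (15 * K + M) * (1 * 1)) Γ (shift 1 v (num 0)))
  | prime_mul p q hp ih =>
    have hq : 0 < q := Nat.pos_of_ne_zero fun h => by simp [h] at hD
    have hpq : p ≤ p * q := Nat.le_mul_of_pos_right _ hq
    have hqp : q ≤ p * q := Nat.le_mul_of_pos_left _ hp.pos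
    have f1 := hc.division_prime (Γ := Γ) (v := v) hp (by omega) (hS'' p (by omega) _ hv)
    have f2 : ∀ Γ, _ := fun Γ => ih (Γ := Γ) (v := var 0) hq (by omega) hw
    refine (hc.division_mul hp.pos hq f1 f2 (by omega) (hS'' _ hDM _ hv)).mono ?_
    have h1 : p * (12 * K + p) + K + 10 ≤ p * (15 * K + M) := by
      have := hp.two_le
      nlinarith
    have h2 : q * (4 * K + p * q + 10) + 30 ≤ q * (15 * K + M) := by
      nlinarith
    have h3 : p * (15 * K + M) + p * (3 * (15 * K + M) * (q * q) + q * (15 * K + M)) ≤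
        3 * (15 * K + M) * (p * q * (p * q)) := by
      have h4 : 1 + 3 * (q * q) + q ≤ 3 * (p * (q * q)) := by nlinarith [hp.two_le]
      calc _ = p * (15 * K + M) * (1 + 3 * (q * q) + q) := by ring
        _ ≤ p * (15 * K + M) * (3 * (p * (q * q))) := Nat.mul_le_mul_left _ h4
        _ = _ := by ring
    have h5 := Nat.mul_le_mul_left p h2
    simp only [mul_add] at *
    omega

end Calc
end PrA

namespace PrA

/-! ## Replacing the eliminated variable -/

/-- The substitution `var 0 ↦ e` which fixes all other variables. -/
def Term.repl (e : Term) : ℕ → Term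
  | 0 => e
  | i + 1 => var (i + 1)

@[simp] theorem Term.repl_zero (e : Term) : repl e 0 = e := rfl
@[simp] theorem Term.repl_succ (e : Term) (i : ℕ) : repl e (i + 1) = var (i + 1) := rfl

theorem Term.subst_congr {t : Term} (ht : t.count = 0) {σ τ : ℕ → Term}
    (h : ∀ i, σ (i + 1) = τ (i + 1)) : t.subst σ = t.subst τ := by
  induction t with
  | var i =>
    cases i with
    | zero => simp [count] at ht
    | succ i => exact h i
  | zero | one => rfl
  | add t u h1 h2 =>
    simp only [count, Nat.add_eq_zero_iff] at ht
    simp [subst, h1 ht.1, h2 ht.2]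

theorem Term.subst_repl {t e : Term} (ht : t.count = 0) : t.subst (repl e) = t := by
  rw [subst_congr ht (τ := var) (by simp), subst_var]

namespace QF

theorem toFml_subst (A : QF) (σ : ℕ → Term) : (A.subst σ).toFml = A.toFml.subst σ := by
  induction A with
  | rel R t u => cases R <;> simp [subst, toFml, Fml.subst]
  | bot => rfl
  | imp A B h1 h2 | and A B h1 h2 | or A B h1 h2 => simp [subst, toFml, Fml.subst, h1, h2]

/-- The formula `A(e)`, where `A = A(var 0)` and `e` is in the scope of the same variables. -/
def repl (A : QF) (e : Term) : Fml := (A.subst (Term.repl e)).toFml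

theorem size_left_le (R : Rel) (t u : Term) : t.size + u.size ≤ (rel R t u).toFml.size := by
  cases R <;> simp only [toFml, Fml.size, Fml.size_le, Fml.modEq, Term.size, Term.size_lift] <;>
    omega

/-- In every atomic formula of `A`, the variable `var 0` does not occur or is one of the two sides
and does not occur in the other one, which belongs to `T` unless the relation is a congruence
modulo a divisor of `D`. -/
def Solved (T : List Term) (D : ℕ) : QF → Prop
  | rel R t u => (t.count = 0 ∧ u.count = 0) ∨
      ∃ s, s.count = 0 ∧ (t = .var 0 ∧ u = s ∨ t = s ∧ u = .var 0) ∧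
        ((∃ m, R = .mod m ∧ m ∣ D) ∨ (∀ m, R ≠ .mod m) ∧ s ∈ T)
  | bot => True
  | imp A B => A.Solved T D ∧ B.Solved T D
  | and A B => A.Solved T D ∧ B.Solved T D
  | or A B => A.Solved T D ∧ B.Solved T D

end QF

/-- The formula `s ≤ y ∧ ⋀ (u ≤ s ∨ y < u)`, where `u` ranges over the list `L`. -/
def Fml.gap (y : Term) (L : List Term) (s : Term) : Fml :=
  and (le s y) (conj (L.map fun u => or (le u s) (le (.add y .one) u)))

theorem Fml.size_gap_le {y s : Term} {L : List Term} {w : ℕ} (hy : y.size ≤ w) (hs : s.size ≤ w)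
    (hL : ∀ u ∈ L, u.size ≤ w) : (gap y L s).size ≤ (L.length + 1) * (4 * w + 14) := by
  have := size_conj_le (l := L.map fun u => or (le u s) (le (.add y .one) u)) (b := 4 * w + 13) (by
    simp only [List.mem_map, forall_exists_index, and_imp]
    rintro _ u hu rfl
    have := hL u hu
    simp only [size, size_le, Term.size]
    omega)
  rw [show 4 * w + 13 + 1 = 4 * w + 14 by rfl, List.length_map] at this
  simp only [gap, size, size_le, add_mul]
  omega

namespace Calc

open Pf Fml Term

variable {B S K D M n m k w Q : ℕ} {Γ : List Fml} {A C : Fml} {T L : List Term}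
  {a b c d s t u v y y' z z' : Term}

/-! ## The greatest lower bound in a list of terms -/

/-- The list `L` is processed term by term, with the disjunction over all possible current maxima
`s` as invariant; at the start `s` is `0`. A new term `v` above `y` or at most `s` leaves `s` in
place, otherwise it becomes the new maximum. There are about `T.length` cases for each member of
`L`, so the cost is polynomial. -/
theorem gap_exists (hc : Calc B S K) (hT : zero ∈ T) (hTM : T.length ≤ M) (hy : y.size ≤ w)
    (hTw : ∀ u ∈ T, u.size ≤ w) (hLM : L.length ≤ M) (hLT : ∀ u ∈ L, u ∈ T)
    (hB : 100 * (w + 5) ≤ B) (hS' : 10 * ((M + 1) * ((M + 2) * (4 * w + 20))) ≤ S) :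
    Pf S ((L.length + 1) * ((M + 1) * (40 * K + 10 * (M * K)))) Γ (disj (T.map (gap y L))) := by
  have hS := hc.formula
  have hK := hc.nodes
  have hMK : M * 100 ≤ M * K := Nat.mul_le_mul_left _ hK
  have h0 : ∀ L : List Term, L.length ≤ M → (∀ u ∈ L, u ∈ T) → ∀ s ∈ T,
      (gap y L s).size ≤ (M + 1) * (4 * w + 14) := fun L hL hLT s hs =>
    (size_gap_le hy (hTw s hs) fun u hu => hTw u (hLT u hu)).trans (by gcongr)
  have h1 : ∀ L : List Term, L.length ≤ M → (∀ u ∈ L, u ∈ T) →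
      (disj (T.map (gap y L))).size ≤ M * ((M + 1) * (4 * w + 14) + 1) + 1 := fun L hL hLT => by
    refine (size_disj_le (b := (M + 1) * (4 * w + 14)) ?_).trans ?_
    · simp only [List.mem_map, forall_exists_index, and_imp]
      rintro _ s hs rfl
      exact h0 L hL hLT s hs
    · rw [List.length_map]
      gcongr
  have h2 : 4 * (M * ((M + 1) * (4 * w + 14) + 1) + 1) + 4 * ((M + 1) * (4 * w + 14)) + 100 ≤
      10 * ((M + 1) * ((M + 2) * (4 * w + 20))) := by ring_nf; omega
  have h3 : 2 * (M * (4 * w + 13 + 1)) + 2 * (4 * w + 13) + 10 ≤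
      10 * ((M + 1) * ((M + 2) * (4 * w + 20))) := by ring_nf; omega
  induction L with
  | nil =>
    have := h1 [] (by simp) (by simp)
    have := h0 [] (by simp) (by simp) zero hT
    have e1 := hc.le_of_eval (Γ := Γ) (t := zero) (u := y) y (fun ρ => by simp only [eval]; ring)
      (by simp only [Term.size]; omega)
    have e2 := andI (by simp [gap, conj] at *; omega) e1 (impI (A := bot) (B := bot)
      (by simp only [Fml.size]; omega) (hyp (by simp) (by simp only [Fml.size]; omega)))
    refine (disjI (l := T.map (gap y [])) (List.mem_map.2 ⟨zero, hT, rfl⟩) (by omega) e2).mono ?_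
    simp only [List.length_map, List.length_nil, add_mul, mul_add, zero_add, one_mul]
    omega
  | cons v L ih =>
    simp only [List.length_cons] at hLM
    have hLT' : ∀ u ∈ L, u ∈ T := fun u hu => hLT u (by simp [hu])
    have hvT := hLT v (by simp)
    have hv := hTw v hvT
    have s1 := h1 L (by omega) hLT'
    have s2 := h1 (v :: L) (by simpa using hLM) hLT
    have hm : ∀ {Γ : List Fml} {s : Term} {n : ℕ}, s ∈ T → Pf S n Γ (gap y (v :: L) s) →
        Pf S (n + M) Γ (disj (T.map (gap y (v :: L)))) := fun hs h =>
      (disjI (List.mem_map.2 ⟨_, hs, rfl⟩) (by omega) h).mono (by simp; omega)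
    refine (disjE (m := 30 * K + 7 * (M * K) + M) (by omega)
      (ih (by omega) hLT') ?_).mono ?_
    · simp only [List.mem_map, forall_exists_index, and_imp]
      rintro _ s hs rfl
      have hsw := hTw s hs
      have s3 := h0 L (by omega) hLT' s hs
      have s4 := h0 (v :: L) (by simpa using hLM) hLT s hs
      have s5 := h0 (v :: L) (by simpa using hLM) hLT v hvT
      have s6 : (conj ((v :: L).map fun u => or (le u s) (le (.add y .one) u))).size < S := by
        simp only [gap, Fml.size] at s4; omega
      have s7 : (conj ((v :: L).map fun u => or (le u v) (le (.add y .one) u))).size < S := by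
        simp only [gap, Fml.size] at s5; omega
      have H : ∀ {Δ : List Fml}, gap y L s ∈ Δ → Pf S 1 Δ (gap y L s) := fun h => hyp h (by omega)
      have f1 := hc.le_or_lt (Γ := gap y L s :: Γ) (a := v) (b := y) (by omega)
      have f2 := hm hs (andI (by rw [← gap]; omega) (andE₁ (H (Δ := le (add y one) v ::
          gap y L s :: Γ) (by simp))) (andI (A := or (le v s) (le (add y one) v))
        (by simp only [conj, List.map_cons] at s6; omega)
        (orI₂ (by simp [Fml.size, Term.size]; omega) (hyp (by simp) (by simp [Term.size]; omega)))
        (andE₂ (H (by simp)))))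
      have f3 := Pf.le_total (S := S) (Γ := le v y :: gap y L s :: Γ) (a := v) (b := s) (by omega)
      have f4 := hm hs (andI (by rw [← gap]; omega) (andE₁ (H (Δ := le v s :: le v y ::
          gap y L s :: Γ) (by simp))) (andI (A := or (le v s) (le (add y one) v))
        (by simp only [conj, List.map_cons] at s6; omega)
        (orI₁ (by simp [Fml.size, Term.size]; omega) (hyp (by simp) (by simp; omega)))
        (andE₂ (H (by simp)))))
      -- Here `s ≤ v ≤ y`, so `v` replaces `s`. The old alternatives `u ≤ s` become `u ≤ v` by
      -- transitivity, and those of the form `y < u` are kept.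
      let Δ := le s v :: le v y :: gap y L s :: Γ
      have f5 := conj_map (S := S) (Γ := Δ) (m := 5 * K + 10) (l := L) (b := 4 * w + 13)
        (f := fun u => or (le u s) (le (add y one) u)) (g := fun u => or (le u v) (le (add y one) u))
        (fun u hu => by
          have := hTw u (hLT' u hu)
          simp [Fml.size, Term.size]; omega)
        (fun u hu => by
          have := hTw u (hLT' u hu)
          simp [Fml.size, Term.size]; omega)
        (by have : L.length * (4 * w + 13 + 1) ≤ M * (4 * w + 13 + 1) :=
              Nat.mul_le_mul_right _ (by omega)
            omega)
        (andE₂ (H (Δ := Δ) (by simp [Δ]))) (fun u hu => by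
          have := hTw u (hLT' u hu)
          have g1 := orI₁ (S := S) (B := le (add y one) u) (by simp [Fml.size, Term.size]; omega)
            (hc.le_lincomb₂ (t := u) (u := v) zero (hyp (S := S) (A := le u s)
              (Γ := le u s :: or (le u s) (le (add y one) u) :: Δ) (by simp)
              (by simp; omega)) (hyp (A := le s v) (by simp [Δ]) (by simp; omega))
              (fun ρ => by simp only [eval]; ring) (by simp only [Term.size]; omega))
          have g2 := orI₂ (S := S) (A := le u v) (by simp [Fml.size, Term.size]; omega)
            (hyp (S := S) (A := le (add y one) u)
              (Γ := le (add y one) u :: or (le u s) (le (add y one) u) :: Δ) (by simp)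
              (by simp [Term.size]; omega))
          exact (orE (hyp (by simp) (by simp [Fml.size, Term.size]; omega)) g1 g2).mono (by omega))
      have f6 := hm hvT (andI (by rw [← gap]; omega) (hyp (Γ := Δ) (A := le v y) (by simp [Δ])
          (by simp; omega)) (andI (A := or (le v v) (le (add y one) v))
        (by simp only [conj, List.map_cons] at s7; omega)
        (orI₁ (by simp [Fml.size, Term.size]; omega) (hc.le_of_eval zero (fun ρ => rfl)
          (by simp only [Term.size]; omega))) f5))
      refine (orE f1 (orE f3 f4 f6) f2).mono ?_
      have : L.length * (5 * K + 10 + 15) ≤ M * (5 * K + 25) := Nat.mul_le_mul (by omega) (by omega)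
      rw [show M * (5 * K + 25) = 5 * (M * K) + 25 * M by ring] at this
      omega
    · simp only [List.length_map, List.length_cons]
      have h4 : T.length * (30 * K + 7 * (M * K) + M + 5) ≤ M * (30 * K + 8 * (M * K) + 5) :=
        Nat.mul_le_mul hTM (by omega)
      have h5 : M * (30 * K + 8 * (M * K) + 5) + 10 ≤ (M + 1) * (40 * K + 10 * (M * K)) := by
        nlinarith
      rw [add_mul (L.length + 1), one_mul]
      omega

end Calc
end PrA

namespace PrA
namespace Calc

open Pf Fml Term

variable {B S K D M n m k w Q : ℕ} {Γ : List Fml} {A C : Fml} {T L : List Term}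
  {a b c d s t u v y y' z z' : Term}

/-! ## Completeness of the finite set of instances -/

/-- If `s < y' ≤ y` and `y' ≡ y` modulo `D`, and no term of `T` lies strictly between `s` and `y`,
then a solved formula does not distinguish `y` from `y'`. -/
theorem repl_iff (hc : Calc B S K) {A : QF} (hA : A.Solved T D) (hD : 0 < D)
    (h₁ : Pf S n Γ (le (add s one) y')) (h₂ : Pf S n Γ (le y' y)) (h₃ : Pf S n Γ (shift D y y'))
    (h₄ : ∀ u ∈ T, Pf S n Γ (or (le u s) (le (add y one) u)))
    (hQ : (A.repl y).size ≤ Q) (hQ' : (A.repl y').size ≤ Q)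
    (hB : 200 * (s.size + y.size + y'.size + Q + 4 * D + 5) ≤ B) :
    Pf S (A.toFml.size * (9 * n + 300 * K)) Γ (iff (A.repl y) (A.repl y')) := by
  have hS := hc.formula
  have hK := hc.nodes
  induction A with
  | bot =>
    exact (Pf.iff_refl (S := S) (A := bot) (by simp only [Fml.size]; omega)).mono
      (by simp only [QF.toFml, Fml.size]; omega)
  | imp A A' ih ih' =>
    simp only [QF.repl, QF.subst, QF.toFml, Fml.size] at *
    refine (Pf.imp_congr (by omega) (ih hA.1 (by omega) (by omega))
      (ih' hA.2 (by omega) (by omega))).mono ?_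
    simp only [add_mul]; omega
  | and A A' ih ih' =>
    simp only [QF.repl, QF.subst, QF.toFml, Fml.size] at *
    refine (Pf.and_congr (by omega) (ih hA.1 (by omega) (by omega))
      (ih' hA.2 (by omega) (by omega))).mono ?_
    simp only [add_mul]; omega
  | or A A' ih ih' =>
    simp only [QF.repl, QF.subst, QF.toFml, Fml.size] at *
    refine (Pf.or_congr (by omega) (ih hA.1 (by omega) (by omega))
      (ih' hA.2 (by omega) (by omega))).mono ?_
    simp only [add_mul]; omega
  | rel R t u =>
    have hpos : 9 * n + 300 * K ≤ (QF.rel R t u).toFml.size * (9 * n + 300 * K) :=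
      Nat.le_mul_of_pos_left _ (Fml.size_pos _)
    refine mono (n := 9 * n + 300 * K) ?_ hpos
    -- An atomic formula without `y` is unchanged, a congruence modulo a divisor of `D` is invariant
    -- under the shift, and any other atomic formula compares `y` with a bound from `T`, where the
    -- gap applies.
    rcases hA with ⟨ht, hu⟩ | ⟨v, hv, h, hR⟩
    · have e : ∀ y, (QF.rel R t u).repl y = (QF.rel R t u).toFml := fun y => by
        simp [QF.repl, QF.subst, subst_repl, ht, hu]
      simp only [e] at hQ ⊢
      exact (Pf.iff_refl (by omega)).mono (by omega)
    · have h5 : v.size ≤ Q := by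
        have e1 := QF.size_left_le R (t.subst (Term.repl y)) (u.subst (Term.repl y))
        simp only [QF.repl, QF.subst] at hQ
        rcases h with ⟨rfl, rfl⟩ | ⟨rfl, rfl⟩ <;> rw [subst_repl hv] at e1 hQ <;> omega
      rcases h with ⟨rfl, rfl⟩ | ⟨rfl, rfl⟩ <;>
        simp only [QF.repl, QF.subst, Term.subst, subst_repl hv, Term.repl_zero] <;>
        rcases hR with ⟨m, rfl, hm⟩ | ⟨hR, hv'⟩
      · exact (hc.modEq_iff_of_shift hm hD h₃ (by omega)).1.mono (by omega)
      · exact (hc.rel_iff_of_gap hR h₁ h₂ (h₄ _ hv') (by omega)).2.mono (by omega)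
      · exact (hc.modEq_iff_of_shift hm hD h₃ (by omega)).2.mono (by omega)
      · exact (hc.rel_iff_of_gap hR h₁ h₂ (h₄ _ hv') (by omega)).1.mono (by omega)

theorem repl_congr {A : QF} (h : Pf S n Γ (eq y y')) (h' : Pf S m Γ (A.repl y))
    (hS : (A.repl y').size ≤ S) : Pf S (n + m + 1) Γ (A.repl y') := by
  -- `eqE` needs a formula with `var 0` as a hole. The other variables are raised by one, so that
  -- `inst` lowers them back, and occurrences of `var 0` in the inserted term stay as they are.
  have e : ∀ y, (A.toFml.subst fun i => if i = 0 then var 0 else var (i + 1)).inst y =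
      A.repl y := fun y => by
    rw [QF.repl, QF.toFml_subst, Fml.inst, Fml.subst_subst]
    congr 1
    funext i
    cases i <;> simp [Term.subst]
  exact eqE' _ (e y) (e y') hS h h'

theorem le_of_shift (hc : Calc B S K) (h : Pf S n Γ (shift D y y'))
    (hB : 10 * (y.size + y'.size + 2 * D + 5) ≤ B) : Pf S (n + 3 * K) Γ (le y' y) := by
  have hS := hc.formula
  have hK := hc.nodes
  have e1 := size_shift_le D y y'
  have e2 := size_smul_le D (var 0)
  simp only [Term.size] at e2
  refine (app₁ (m := 2 * K + 20) (by simp only [Fml.size_le]; omega) ?_ h).mono (by omega)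
  have f1 := hc.lincomb (hyp (S := S)
      (Γ := eq (add (smul D (var 0)) y'.lift) y.lift :: [shift D y y'].map lift)
      (A := eq (add (smul D (var 0)) y'.lift) y.lift) (by simp)
      (by simp [Fml.size, Term.size]; omega))
    (t := add y'.lift (smul D (var 0))) (u := y.lift)
    (fun ρ => by simp only [eval, eval_smul]; ring) (by simp [Term.size]; omega)
    (by simp [Term.size]; omega)
  exact (exE (B := le y' y) (hyp (A := shift D y y') (by simp) (by omega))
    (by simpa using le_intro _ f1 (by simp; omega))).mono (by omega)

/-- If `s < y`, then `y ≡ s + r` modulo `D` for some `r` with `1 ≤ r ≤ D` and `s + r ≤ y`. -/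
theorem shift_exists (hc : Calc B S K) (hD : 0 < D) (hDM : D ≤ M) (hMK : M ≤ K)
    (h : Pf S n Γ (le (add s one) y)) (hs : s.size ≤ w) (hy : y.size ≤ w) (hw : 1 ≤ w)
    (hB : 20 * (10 * M + 2 * w + 10) ≤ B) (hS' : 10 * (M + 1) * (4 * M + 2 * w + 20) ≤ S) :
    Pf S (n + 60 * K * ((M + 1) * (M + 1))) Γ
      (disj ((List.range D).map fun r => shift D y (add s (num (r + 1))))) := by
  have hS := hc.formula
  have hK := hc.nodes
  have e1 : ∀ y s : Term, y.size ≤ w → s.size ≤ w →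
      (disj ((List.range D).map fun r => shift D y (add s (num (r + 1))))).size ≤
      M * (4 * M + 2 * w + 10) + 1 := fun y s hy hs => by
    have := size_disj_le (l := (List.range D).map fun r => shift D y (add s (num (r + 1))))
      (b := 4 * M + 2 * w + 9) (by
        simp only [List.mem_map, List.mem_range, forall_exists_index, and_imp]
        rintro _ r hr rfl
        have := size_shift_le D y (add s (num (r + 1)))
        have := size_num_le (r + 1)
        simp only [Term.size] at *
        omega)
    refine this.trans ?_
    rw [List.length_map, List.length_range]
    gcongr
  have e2 : (Fml.division D (var 0)).size ≤ M * (4 * M + 2 * w + 10) + 1 :=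
    (size_division_le D (var 0)).trans (by
      have : (var 0).size = 1 := rfl
      gcongr; omega)
  have e3 : 2 * (M * (4 * M + 2 * w + 10) + 1) + 20 * M + 10 * w + 60 ≤
    10 * (M + 1) * (4 * M + 2 * w + 20) := by ring_nf; omega
  have e4 := e1 y s hy hs
  have e5 := e1 y.lift s.lift (by simpa) (by simpa)
  refine (app₁ (m := 55 * K * ((M + 1) * (M + 1))) (by simp only [Fml.size_le, Term.size]; omega)
    ?_ h).mono (by nlinarith)
  let Δ := eq (add (add s one).lift (var 0)) y.lift :: [le (add s one) y].map lift
  have f1 := hc.division (Γ := Δ) (v := var 0) (w := 2 * w) hD hDM (by simp [Term.size]; omega)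
    hB hS'
  rw [Fml.division] at f1
  have f2 := disjE (m := 4 * K + M + 10)
    (C := disj ((List.range D).map fun r => shift D y.lift (add s.lift (num (r + 1)))))
    (by rw [← Fml.division]; omega) f1 (by
      simp only [List.mem_map, List.mem_range, forall_exists_index, and_imp]
      rintro _ r hr rfl
      have s1 := size_num_le r
      have s2 := size_num_le (r + 1)
      have s3 := size_shift_le D (var 0) (num r)
      have s4 := size_smul_le D (var 0)
      simp only [Term.size] at s3 s4
      let Δ' := eq (add (smul D (var 0)) (num r)) (var 1) :: (shift D (var 0) (num r) :: Δ).map lift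
      have g1 := hyp (S := S) (Γ := Δ') (A := eq (add (smul D (var 0)) (num r)) (var 1))
        (by simp [Δ']) (by simp [Fml.size, Term.size]; omega)
      have g2 := hyp (S := S) (Γ := Δ')
        (A := eq (add (add s.lift.lift one) (var 1)) y.lift.lift)
        (by simp [Δ', Δ]) (by simp [Fml.size, Term.size]; omega)
      -- What is divided by `D` is `y - (s + 1)`; the `1` from the strict inequality turns the
      -- remainder `r < D` into a summand between `1` and `D`.
      have g3 := hc.lincomb₂ g1 g2 (t := add (smul D (var 0)) (add s.lift.lift (num (r + 1))))
        (u := y.lift.lift) (fun ρ => by simp only [eval, eval_smul, eval_num]; ring)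
        (by simp [Term.size]; omega) (by simp [Term.size]; omega)
      have g4 := shift_intro _ (by simp [Term.size]; omega) g3
      have g5 := exE (B := shift D y.lift (add s.lift (num (r + 1))))
        (hyp (S := S) (A := shift D (var 0) (num r)) (Γ := shift D (var 0) (num r) :: Δ)
          (by simp) (by omega)) (by simpa [Δ'] using g4)
      exact (disjI (l := (List.range D).map fun r => shift D y.lift (add s.lift (num (r + 1))))
        (List.mem_map.2 ⟨r, List.mem_range.2 hr, rfl⟩) (by omega) g5).mono (by simp; omega))
  have f3 := exE (B := disj ((List.range D).map fun r => shift D y (add s (num (r + 1)))))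
    (hyp (S := S) (A := le (add s one) y) (Γ := [le (add s one) y]) (by simp)
      (by simp only [Fml.size_le, Term.size]; omega))
    (by simpa [Δ, Function.comp_def] using f2)
  refine f3.mono ?_
  have h1 : 3 * (15 * K + M) * (D * D) ≤ 3 * (15 * K + K) * (M * M) := by gcongr
  have h2 : D * (4 * K + M + 10 + 5) ≤ M * (6 * K) := Nat.mul_le_mul hDM (by omega)
  ring_nf at h1 h2 ⊢
  omega

/-- A solved formula which holds at `y` holds at one of the instances `s + r` with `s ∈ T` and
`r ≤ D`. -/
theorem disj_of_solved (hc : Calc B S K) {G : QF} (hG : G.Solved T D) (hD : 0 < D) (hDM : D ≤ M)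
    (hT : zero ∈ T) (hTM : T.length ≤ M) (hTs : ∀ s ∈ T, s.size ≤ M) (h : Pf S n Γ (G.repl y))
    (hGM : G.toFml.size ≤ M) (hy : y.size ≤ w) (hw : 4 * M + 5 ≤ w) (hQ : (G.repl y).size ≤ Q)
    (hMK : M ≤ K) (hM : (disj (T.map fun s =>
      disj ((List.range (D + 1)).map fun r => G.repl (add s (num r))))).size ≤ M)
    (hB : 200 * (3 * w + Q + 14 * M + 5) ≤ B)
    (hS' : 10 * ((M + 1) * ((M + 2) * (4 * w + 20))) ≤ S) :
    Pf S (1000 * K * ((n + 1) * (M + 1) ^ 4)) Γ (disj (T.map fun s =>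
      disj ((List.range (D + 1)).map fun r => G.repl (add s (num r))))) := by
  have hS := hc.formula
  have hK := hc.nodes
  have hS'' : 10 * (M + 1) * (4 * M + 2 * w + 20) ≤ S := by
    refine le_trans ?_ hS'
    have : 4 * M + 2 * w + 20 ≤ (M + 2) * (4 * w + 20) := by nlinarith
    rw [mul_assoc]
    gcongr
  have hM' : ∀ s ∈ T,
      (disj ((List.range (D + 1)).map fun r => G.repl (add s (num r)))).size ≤ M := fun s hs =>
    (size_le_size_disj (List.mem_map.2 ⟨s, hs, rfl⟩)).trans hM
  have hM'' : ∀ s ∈ T, ∀ r < D + 1, (G.repl (add s (num r))).size ≤ M := fun s hs r hr =>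
    (size_le_size_disj (List.mem_map.2 ⟨r, List.mem_range.2 hr, rfl⟩)).trans (hM' s hs)
  have I : ∀ {s : Term} {r k : ℕ} {Γ : List Fml}, s ∈ T → r < D + 1 →
      Pf S k Γ (G.repl (add s (num r))) → Pf S (k + 2 * M + 1) Γ (disj (T.map fun s =>
        disj ((List.range (D + 1)).map fun r => G.repl (add s (num r))))) := fun hs hr h =>
    (disjI (List.mem_map.2 ⟨_, hs, rfl⟩) (by omega) (disjI (List.mem_map.2
      ⟨_, List.mem_range.2 hr, rfl⟩) (by have := hM' _ hs; omega) h)).mono (by simp; omega)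
  have f1 := hc.gap_exists (Γ := Γ) (L := T) (y := y) hT hTM hy
    (fun u hu => (hTs u hu).trans (by omega)) hTM (fun _ h => h) (by omega) hS'
  have s0 : (disj (T.map (gap y T))).size ≤ M * ((M + 1) * (4 * w + 14) + 1) + 1 := by
    refine (size_disj_le (b := (M + 1) * (4 * w + 14)) ?_).trans ?_
    · simp only [List.mem_map, forall_exists_index, and_imp]
      rintro _ s hs rfl
      exact (size_gap_le hy ((hTs s hs).trans (by omega))
        fun u hu => (hTs u hu).trans (by omega)).trans (by gcongr)
    · rw [List.length_map]
      gcongr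
  have s1 : (M * ((M + 1) * (4 * w + 14) + 1) + 1) + M + 1 ≤
      10 * ((M + 1) * ((M + 2) * (4 * w + 20))) := by ring_nf; omega
  refine (disjE (m := 800 * K * ((n + 1) * (M + 1) ^ 3)) (by omega) f1 ?_).mono ?_
  · simp only [List.mem_map, forall_exists_index, and_imp]
    rintro _ s hs rfl
    have hsM := hTs s hs
    have s2 : (gap y T s).size ≤ S :=
      (size_le_size_disj (List.mem_map.2 ⟨s, hs, rfl⟩)).trans (by omega)
    have H : ∀ {Δ : List Fml}, gap y T s ∈ Δ → Pf S 1 Δ (gap y T s) := fun h => hyp h s2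
    -- If `y ≤ s`, then `y = s` and the instance with `r = 0` holds. If `s < y`, an instance with `1
    -- ≤ r ≤ D` is used.
    have g1 := hc.le_or_lt (Γ := gap y T s :: Γ) (a := y) (b := s) (by omega)
    have e0 : (num 0).size = 1 := rfl
    have g2 := hc.le_antisymm (hyp (S := S) (Γ := le y s :: gap y T s :: Γ) (A := le y s) (by simp)
      (by simp; omega)) (andE₁ (H (by simp))) (by omega)
    have g3 := hc.lincomb g2 (t := y) (u := add s (num 0))
      (fun ρ => by simp only [eval, eval_num]; ring) (by omega) (by simp only [Term.size]; omega)
    have g4 := I hs (by omega) (repl_congr (A := G) g3 (h.weaken (Δ := le y s :: gap y T s :: Γ)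
      (fun _ h => by simp [h]) (by simp; omega)) (by have := hM'' s hs 0 (by omega); omega))
    let Δ := le (add s one) y :: gap y T s :: Γ
    have g5 := hc.shift_exists (w := w) (M := M) hD hDM hMK (hyp (S := S) (Γ := Δ)
      (A := le (add s one) y) (by simp [Δ]) (by simp [Term.size]; omega)) (by omega) hy (by omega)
      (by omega) hS''
    have s3 : (disj ((List.range D).map fun r => shift D y (add s (num (r + 1))))).size ≤
        M * (2 * w + 4 * M + 10) + 1 := by
      have := size_disj_le (l := (List.range D).map fun r => shift D y (add s (num (r + 1))))
        (b := 2 * w + 4 * M + 9) (by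
          simp only [List.mem_map, List.mem_range, forall_exists_index, and_imp]
          rintro _ r hr rfl
          have := size_shift_le D y (add s (num (r + 1)))
          have := size_num_le (r + 1)
          simp only [Term.size] at *
          omega)
      refine this.trans ?_
      rw [List.length_map, List.length_range]
      gcongr
    have s4 : M * (2 * w + 4 * M + 10) + 1 + M + 1 ≤ 10 * (M + 1) * (4 * M + 2 * w + 20) := by
      ring_nf; omega
    have g6 := disjE (C := disj (T.map fun s =>
        disj ((List.range (D + 1)).map fun r => G.repl (add s (num r))))) (m := n + M * (9 * (M + 4 * K + 10) + 300 * K) + 2 * M + 10) (by omega) g5 (by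
      simp only [List.mem_map, List.mem_range, forall_exists_index, and_imp]
      rintro _ r hr rfl
      have t1 := size_num_le (r + 1)
      have t2 := size_num_le r
      have t3 := hM'' s hs (r + 1) (by omega)
      have t4 := size_shift_le D y (add s (num (r + 1)))
      simp only [Term.size] at t4
      let Δ' := shift D y (add s (num (r + 1))) :: Δ
      have k3 := hyp (S := S) (Γ := Δ') (A := shift D y (add s (num (r + 1)))) (by simp [Δ'])
        (by omega)
      have k1 := hc.le_of_eval (Γ := Δ') (t := add s one) (u := add s (num (r + 1))) (num r)
        (fun ρ => by simp only [eval, eval_num]; ring) (by simp only [Term.size]; omega)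
      have k2 := hc.le_of_shift k3 (by simp only [Term.size]; omega)
      have k4 : ∀ u ∈ T, Pf S (M + 4 * K + 10) Δ' (or (le u s) (le (add y one) u)) := fun u hu =>
        (conjE (List.mem_map.2 ⟨u, hu, rfl⟩) (andE₂ (H (Δ := Δ') (by simp [Δ', Δ])))).mono
          (by simp; omega)
      have k5 := hc.repl_iff (n := M + 4 * K + 10) (Q := Q + M) hG hD (k1.mono (by omega))
        (k2.mono (by omega)) (k3.mono (by omega)) k4 (by omega) (by omega)
        (by simp only [Term.size]; omega)
      have k6 := iff_mp k5 (h.weaken (Δ := Δ') (fun _ h => by simp [Δ', Δ, h]) (by simp [Δ', Δ]; omega))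
      refine (I hs (by omega) k6).mono ?_
      have : G.toFml.size * (9 * (M + 4 * K + 10) + 300 * K) ≤
        M * (9 * (M + 4 * K + 10) + 300 * K) := by gcongr
      omega)
    refine (orE g1 g4 g6).mono ?_
    simp only [List.length_map, List.length_range]
    have h1 : D * (n + M * (9 * (M + 4 * K + 10) + 300 * K) + 2 * M + 10 + 5) ≤
        M * (n * K + M * (346 * K) + 3 * K) := by
      have : M * (9 * (M + 4 * K + 10) + 300 * K) ≤ M * (346 * K) :=
        Nat.mul_le_mul_left _ (by omega)
      have : n ≤ n * K := Nat.le_mul_of_pos_right _ (by omega)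
      exact Nat.mul_le_mul hDM (by omega)
    have h2 : n ≤ K * n := Nat.le_mul_of_pos_left _ (by omega)
    ring_nf at h1 h2 ⊢
    omega
  · have h1 : (T.length + 1) * ((M + 1) * (40 * K + 10 * (M * K))) ≤
        (M + 1) * ((M + 1) * (40 * K + 10 * (M * K))) := by gcongr
    have h2 : T.length * (800 * K * ((n + 1) * (M + 1) ^ 3) + 5) ≤
        M * (800 * K * ((n + 1) * (M + 1) ^ 3) + 5) := by gcongr
    rw [List.length_map]
    ring_nf at h1 h2 ⊢
    omega

end Calc
end PrA

namespace PrA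

/-! ## The atomic formulas of the unified formula -/

namespace Term

theorem count_strip?_eq_zero (t : Term) : ∀ s ∈ t.strip?, s.count = 0 := by
  induction t with
  | var i => cases i <;> simp [strip?, count]
  | zero | one => simp [strip?, count]
  | add t u h1 h2 =>
    rcases ht : t.strip? with _ | a <;> rcases hu : u.strip? with _ | b <;>
      simp_all [strip?, count]

@[simp] theorem count_strip (t : Term) : t.strip.count = 0 := by
  rw [strip]
  cases h : t.strip? with
  | none => rfl
  | some s => exact t.count_strip?_eq_zero s h

theorem eval_eq_count_add_strip? (ρ : ℕ → ℕ) (t : Term) :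
    t.eval ρ = t.count * ρ 0 + (t.strip?.getD zero).eval ρ := by
  induction t with
  | var i => cases i <;> simp [strip?, count, eval]
  | zero | one => simp [strip?, count, eval]
  | add t u h1 h2 =>
    simp only [strip?, count, eval, add_mul]
    rw [h1, h2]
    split <;> simp_all [eval] <;> ring

theorem eval_eq_count_add_strip (ρ : ℕ → ℕ) (t : Term) :
    t.eval ρ = t.count * ρ 0 + t.strip.eval ρ := eval_eq_count_add_strip? ρ t

theorem count_sum {l : List Term} (h : ∀ t ∈ l, t.count = 0) : (sum l).count = 0 := by
  induction l with
  | nil => rfl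
  | cons a l ih => cases l <;> simp_all [sum, count]

theorem count_smul {t : Term} (k : ℕ) (h : t.count = 0) : (smul k t).count = 0 :=
  count_sum fun _ hs => (List.eq_of_mem_replicate hs).symm ▸ h

/-- `bounds` returns its terms as read outside the quantifier on `y`; lifting recovers the terms
that stand in the formula. -/
theorem lift_inst_of_count {t s : Term} (h : t.count = 0) : (t.inst s).lift = t := by
  rw [lift, inst, subst_subst]
  exact (subst_congr (σ := fun i => (single s i).lift) (τ := var) h fun _ => rfl).trans
    (subst_var t)

theorem size_inst_of_count {t : Term} (s : Term) (h : t.count = 0) : (t.inst s).size = t.size := by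
  rw [← size_lift, lift_inst_of_count h]

end Term

namespace QF

theorem toFml_disj (l : List QF) : (disj l).toFml = Fml.disj (l.map toFml) := by
  induction l with
  | nil => rfl
  | cons A l ih => cases l <;> simp_all [disj, Fml.disj, toFml]

theorem lift_toFml_inst (A : QF) (y : Term) : (A.inst y).toFml.lift = A.repl y.lift := by
  rw [repl, inst, toFml_subst, toFml_subst, Fml.lift, Fml.subst_subst]
  congr 1
  funext i
  cases i <;> rfl

theorem size_repl_le (A : QF) (e : Term) : (A.repl e).size ≤ A.toFml.size * e.size := by
  rw [repl, toFml_subst]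
  refine Fml.size_subst_le _ ?_
  rintro (_ | i)
  · rfl
  · exact e.size_pos

theorem size_toFml_le_inst (A : QF) (s : Term) : A.toFml.size ≤ (A.inst s).toFml.size := by
  rw [inst, toFml_subst]
  exact Fml.size_le_size_subst _ _

/-- A congruence spells out its modulus as a sum of `m` copies of a variable, so moduli may enter a
bound polynomially. -/
theorem le_size_mod (m : ℕ) (t u : Term) : m ≤ (rel (.mod m) t u).toFml.size := by
  have : m ≤ (Term.smul m (.var 0)).size := by
    induction m with
    | zero => exact Nat.zero_le _
    | succ m ih =>
      cases m with
      | zero => simp [Term.smul, Term.sum, Term.size]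
      | succ m =>
        simp only [Term.smul, List.replicate, Term.sum, Term.size] at *
        omega
  simp only [toFml, Fml.modEq, Fml.size, Term.size]
  omega

theorem count_rests {C : ℕ} {F : QF} : ∀ s ∈ F.rests C, s.count = 0 := by
  induction F with
  | rel R t u =>
    simp only [rests]
    split_ifs <;> simp [Term.count_smul]
  | bot => simp [rests]
  | imp A B h1 h2 | and A B h1 h2 | or A B h1 h2 =>
    simp only [rests, List.mem_append]
    rintro s (h | h)
    exacts [h1 s h, h2 s h]

theorem solved_left {R : Rel} {s : Term} {T : List Term} {D : ℕ} (hs : s.count = 0)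
    (hT : ∀ u ∈ (rel R (.var 0) s).bounds, u.lift ∈ T)
    (hD : ∀ m ∈ (rel R (.var 0) s).moduli, m ∣ D) : (rel R (.var 0) s).Solved T D := by
  refine Or.inr ⟨s, hs, .inl ⟨rfl, rfl⟩, ?_⟩
  cases R with
  | eq | le => exact .inr ⟨by simp, by simpa [bounds, Term.lift_inst_of_count hs] using hT⟩
  | mod m => exact .inl ⟨m, rfl, hD m (by simp [moduli])⟩

theorem solved_right {R : Rel} {s : Term} {T : List Term} {D : ℕ} (hs : s.count = 0)
    (hT : ∀ u ∈ (rel R s (.var 0)).bounds, u.lift ∈ T)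
    (hD : ∀ m ∈ (rel R s (.var 0)).moduli, m ∣ D) : (rel R s (.var 0)).Solved T D := by
  -- `bounds` tests the left side first, so `s` must not be mistaken for `y`.
  have hs' : s ≠ .var 0 := by rintro rfl; simp [Term.count] at hs
  refine Or.inr ⟨s, hs, .inr ⟨rfl, rfl⟩, ?_⟩
  cases R with
  | eq | le => exact .inr ⟨by simp, by simpa [bounds, hs', Term.lift_inst_of_count hs] using hT⟩
  | mod m => exact .inl ⟨m, rfl, hD m (by simp [moduli])⟩

theorem solved_unify {C D : ℕ} {T : List Term} {F : QF} {pre post : List Term}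
    (hpre : ∀ s ∈ pre, s.count = 0) (hpost : ∀ s ∈ post, s.count = 0)
    (hT : ∀ u ∈ (F.unify C pre post).bounds, u.lift ∈ T)
    (hD : ∀ m ∈ (F.unify C pre post).moduli, m ∣ D) : (F.unify C pre post).Solved T D := by
  induction F generalizing pre post with
  | rel R t u =>
    have hsum : ∀ k (v : Term), (Term.sum (.smul k v.strip :: (pre ++ post))).count = 0 := fun k v =>
      Term.count_sum (by
        simp only [List.mem_cons, List.mem_append]
        rintro s (rfl | h | h)
        exacts [Term.count_smul k v.count_strip, hpre s h, hpost s h])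
    simp only [unify] at *
    split_ifs at * with h1 h2
    · exact solved_left (hsum _ _) hT hD
    · exact solved_right (hsum _ _) hT hD
    · exact .inl ⟨t.count_strip, u.count_strip⟩
  | bot => exact trivial
  | imp A B h1 h2 | and A B h1 h2 | or A B h1 h2 =>
    simp only [unify, bounds, moduli, List.mem_append] at hT hD
    refine ⟨h1 hpre ?_ (fun u h => hT u (.inl h)) fun m h => hD m (.inl h),
      h2 ?_ hpost (fun u h => hT u (.inr h)) fun m h => hD m (.inr h)⟩ <;>
    · simp only [List.mem_append]
      rintro s (h | h)
      · first | exact hpre s h | exact count_rests s h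
      · first | exact hpost s h | exact count_rests s h

theorem solved_solved {C D : ℕ} {T : List Term} {F : QF}
    (hT : ∀ u ∈ (F.solved C).bounds, u.lift ∈ T) (hD : ∀ m ∈ (F.solved C).moduli, m ∣ D) :
    (F.solved C).Solved T D := by
  have ht : (Term.sum (F.rests C)).count = 0 := Term.count_sum count_rests
  simp only [solved, bounds, moduli, List.mem_append] at hT hD
  exact ⟨solved_right ht (fun u h => hT u (.inl h)) (by simp [moduli]),
    solved_left ht (by simp [bounds]) (fun m h => hD m (.inr (.inl h))),
    solved_unify (by simp) (by simp) (fun u h => hT u (.inr (.inr h)))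
      fun m h => hD m (.inr (.inr h))⟩

theorem moduli_unify_pos {C : ℕ} {F : QF} {pre post : List Term} (hC : 0 < C)
    (hF : ∀ m ∈ F.moduli, 0 < m) (hF' : ∀ c ∈ F.coeffs, c ∣ C) :
    ∀ m ∈ (F.unify C pre post).moduli, 0 < m := by
  induction F generalizing pre post with
  | rel R t u =>
    cases R with
    | eq | le => simp only [unify]; split_ifs <;> simp [moduli, Rel.scale]
    | mod m =>
      simp only [moduli, List.mem_singleton, forall_eq] at hF
      simp only [unify, coeffs] at *
      split_ifs at * with h1 h2
      all_goals simp only [moduli, Rel.scale, List.mem_singleton, forall_eq] at *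
      · exact Nat.mul_pos hF (Nat.div_pos (Nat.le_of_dvd hC hF') (by omega))
      · exact Nat.mul_pos hF (Nat.div_pos (Nat.le_of_dvd hC hF') (by omega))
      · exact hF
  | bot => simp [unify, moduli]
  | imp A B h1 h2 | and A B h1 h2 | or A B h1 h2 =>
    simp only [unify, moduli, coeffs, List.mem_append] at *
    rintro m (h | h)
    · exact h1 (fun m h => hF m (.inl h)) (fun c h => hF' c (.inl h)) m h
    · exact h2 (fun m h => hF m (.inr h)) (fun c h => hF' c (.inr h)) m h

end QF

theorem dvd_foldr_lcm {l : List ℕ} : ∀ m ∈ l, m ∣ l.foldr Nat.lcm 1 := by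
  induction l with
  | nil => simp
  | cons a l ih =>
    rintro m hm
    rcases List.mem_cons.1 hm with rfl | h
    · exact Nat.dvd_lcm_left _ _
    · exact (ih m h).trans (Nat.dvd_lcm_right _ _)

theorem foldr_lcm_pos {l : List ℕ} (h : ∀ m ∈ l, 0 < m) : 0 < l.foldr Nat.lcm 1 := by
  induction l with
  | nil => simp
  | cons a l ih =>
    exact Nat.lcm_pos (h a (by simp)) (ih fun m hm => h m (by simp [hm]))

namespace Calc

open Pf Fml Term

variable {B S K C M Q : ℕ} {Γ : List Fml} {F : QF} {e : Term}

/-- `F(x)` is equivalent to `F''(C x + t)`. -/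
theorem unify_iff (hc : Calc B S K) (hC : 0 < C) (hF : ∀ c ∈ F.coeffs, c ∣ C) {pre post : List Term}
    (he : ∀ ρ, e.eval ρ = C * ρ 0 + ((pre ++ (F.rests C ++ post)).map fun t => t.eval ρ).sum)
    (hpre : ∀ s ∈ pre, s.count = 0) (hpost : ∀ s ∈ post, s.count = 0)
    (hQ : F.toFml.size ≤ Q) (hQ' : ((F.unify C pre post).repl e).size ≤ Q)
    (hB : 100 * (C * (Q + 10) + 5 * Q + 5) ≤ B) :
    Pf S (F.toFml.size * (300 * K)) Γ (iff F.toFml ((F.unify C pre post).repl e)) := by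
  have hS := hc.formula
  have hK := hc.nodes
  have hCQ : Q + 10 ≤ C * (Q + 10) := Nat.le_mul_of_pos_left _ hC
  induction F generalizing pre post with
  | bot =>
    exact (Pf.iff_refl (S := S) (A := bot) (by simp only [Fml.size]; omega)).mono
      (by simp only [QF.toFml, Fml.size]; omega)
  | imp A A' ih ih' =>
    simp only [QF.coeffs, List.mem_append] at hF
    simp only [QF.unify, QF.repl, QF.subst, QF.toFml, Fml.size] at *
    refine (Pf.imp_congr (by omega)
      (ih (fun c h => hF c (.inl h)) (by simpa [QF.rests] using he) hpre
        (by simp only [List.mem_append]; rintro s (h | h); exacts [QF.count_rests s h, hpost s h])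
        (by omega) (by omega))
      (ih' (fun c h => hF c (.inr h)) (by simpa [QF.rests] using he)
        (by simp only [List.mem_append]; rintro s (h | h); exacts [hpre s h, QF.count_rests s h])
        hpost (by omega) (by omega))).mono ?_
    simp only [add_mul]; omega
  | and A A' ih ih' =>
    simp only [QF.coeffs, List.mem_append] at hF
    simp only [QF.unify, QF.repl, QF.subst, QF.toFml, Fml.size] at *
    refine (Pf.and_congr (by omega)
      (ih (fun c h => hF c (.inl h)) (by simpa [QF.rests] using he) hpre
        (by simp only [List.mem_append]; rintro s (h | h); exacts [QF.count_rests s h, hpost s h])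
        (by omega) (by omega))
      (ih' (fun c h => hF c (.inr h)) (by simpa [QF.rests] using he)
        (by simp only [List.mem_append]; rintro s (h | h); exacts [hpre s h, QF.count_rests s h])
        hpost (by omega) (by omega))).mono ?_
    simp only [add_mul]; omega
  | or A A' ih ih' =>
    simp only [QF.coeffs, List.mem_append] at hF
    simp only [QF.unify, QF.repl, QF.subst, QF.toFml, Fml.size] at *
    refine (Pf.or_congr (by omega)
      (ih (fun c h => hF c (.inl h)) (by simpa [QF.rests] using he) hpre
        (by simp only [List.mem_append]; rintro s (h | h); exacts [QF.count_rests s h, hpost s h])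
        (by omega) (by omega))
      (ih' (fun c h => hF c (.inr h)) (by simpa [QF.rests] using he)
        (by simp only [List.mem_append]; rintro s (h | h); exacts [hpre s h, QF.count_rests s h])
        hpost (by omega) (by omega))).mono ?_
    simp only [add_mul]; omega
  | rel R t u =>
    have hpos : 300 * K ≤ (QF.rel R t u).toFml.size * (300 * K) :=
      Nat.le_mul_of_pos_left _ (Fml.size_pos _)
    refine mono (n := 200 * K) ?_ (by omega)
    have s1 := QF.size_left_le R t u
    have hsum : ∀ k (v : Term), (sum (smul k v.strip :: (pre ++ post))).subst (repl e) =
        sum (smul k v.strip :: (pre ++ post)) := fun k v => subst_repl (count_sum (by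
      simp only [List.mem_cons, List.mem_append]
      rintro s (rfl | h | h)
      exacts [count_smul k v.count_strip, hpre s h, hpost s h]))
    have hk : ∀ {c}, 0 < c → c ∣ C → 0 < C / c ∧ C / c ≤ C ∧ C / c * c = C := fun hc0 h =>
      ⟨Nat.div_pos (Nat.le_of_dvd hC h) hc0, Nat.div_le_self _ _, Nat.div_mul_cancel h⟩
    have hmul : ∀ {k c p q x : ℕ}, k * c = C → p = q + c → C * x + k * (q * x) = k * (p * x) := by
      rintro k c p q x rfl rfl
      ring
    -- The scaled modulus `m * k` is written out in the unified formula, whose size is at most `Q`.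
    have hw : ∀ {R : Rel} {k : ℕ} {a b : Term}, (QF.rel (R.scale k) a b).toFml.size ≤ Q →
        ∀ m, R = .mod m → m * k ≤ Q := by
      rintro R k a b h m rfl
      exact (QF.le_size_mod _ _ _).trans h
    have main : ∀ {k : ℕ} {a b : Term}, 0 < k → k ≤ C →
        (∀ ρ, a.eval ρ + k * u.eval ρ = b.eval ρ + k * t.eval ρ) →
        (QF.rel (R.scale k) a b).toFml.size ≤ Q →
        Pf S (200 * K) Γ (iff (QF.rel R t u).toFml (QF.rel (R.scale k) a b).toFml) :=
      fun {k a b} h1 h2 h3 h4 => by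
        refine hc.rel_scale_iff (hw h4) h1 h3 ?_
        have s2 := QF.size_left_le (R.scale k) a b
        have : k * (t.size + u.size + 10) ≤ C * (Q + 10) := Nat.mul_le_mul h2 (by omega)
        omega
    simp only [QF.unify, QF.rests, QF.coeffs] at *
    split_ifs at * with h1 h2
    all_goals simp only [List.mem_singleton, forall_eq, QF.repl, QF.subst, hsum, Term.subst, repl_zero,
      List.map_append, List.map_cons, List.map_nil, List.sum_append, List.sum_cons, List.sum_nil,
      eval_smul, subst_repl (count_strip _)] at *
    · obtain ⟨k1, k2, k3⟩ := hk (by omega) hF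
      refine main k1 k2 (fun ρ => ?_) hQ'
      have := hmul (x := ρ 0) k3 (p := t.count) (q := u.count) (by omega)
      simp only [t.eval_eq_count_add_strip, u.eval_eq_count_add_strip, he ρ, eval_sum, eval_smul,
        List.map_append, List.map_cons, List.sum_append, List.sum_cons]
      linarith
    · obtain ⟨k1, k2, k3⟩ := hk (by omega) hF
      refine main k1 k2 (fun ρ => ?_) hQ'
      have := hmul (x := ρ 0) k3 (p := u.count) (q := t.count) (by omega)
      simp only [t.eval_eq_count_add_strip, u.eval_eq_count_add_strip, he ρ, eval_sum, eval_smul,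
        List.map_append, List.map_cons, List.sum_append, List.sum_cons]
      linarith
    -- Here `x` occurs equally often on both sides; taking it off is the case `k = 1`.
    · have e1 : R.scale 1 = R := by cases R <;> simp [Rel.scale]
      have := main (k := 1) (a := t.strip) (b := u.strip) (by omega) (by omega) (fun ρ => ?_)
        (by rwa [e1])
      · rwa [e1] at this
      · rw [t.eval_eq_count_add_strip, u.eval_eq_count_add_strip,
          show t.count = u.count by omega]
        ring

end Calc
end PrA

/-! ### The output of the algorithm and the sizes of its ingredients -/

namespace PrA

namespace QF

/-- The list of the terms `s` for which the instances `s + r` are used. -/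
def candidates (C : ℕ) (F : QF) : List Term := (Term.zero :: (F.solved C).bounds).dedup

/-- The least common multiple of the moduli of the solved formula. -/
def modulus (C : ℕ) (F : QF) : ℕ := (F.solved C).moduli.foldr Nat.lcm 1

theorem toFml_cooper (C : ℕ) (F : QF) : (F.cooper C).toFml =
    Fml.disj ((F.candidates C).map fun s => Fml.disj ((List.range (F.modulus C + 1)).map fun r =>
      ((F.solved C).inst (.add s (.num r))).toFml)) := by
  simp only [cooper, toFml_disj, List.map_map, Function.comp_def, candidates, modulus]

/-- Deriving the output from `∃ x, F(x)` takes place in the scope of `x`. There the candidates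
appear lifted, and instances become values of `repl`. -/
theorem lift_toFml_cooper (C : ℕ) (F : QF) : (F.cooper C).toFml.lift =
    Fml.disj (((F.candidates C).map Term.lift).map fun s =>
      Fml.disj ((List.range (F.modulus C + 1)).map fun r =>
        (F.solved C).repl (.add s (.num r)))) := by
  simp only [toFml_cooper, Fml.lift_disj, List.map_map, Function.comp_def, lift_toFml_inst,
    Term.lift_add, Term.lift_num]

theorem zero_mem_candidates (C : ℕ) (F : QF) : Term.zero ∈ F.candidates C := by
  simp [candidates]

theorem modulus_pos {C : ℕ} {F : QF} (hC : 0 < C) (hF : ∀ m ∈ F.moduli, 0 < m)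
    (hF' : ∀ c ∈ F.coeffs, c ∣ C) : 0 < F.modulus C :=
  foldr_lcm_pos (by
    simp only [solved, moduli, List.nil_append, List.singleton_append, List.mem_cons]
    rintro m (rfl | h)
    exacts [hC, moduli_unify_pos hC hF hF' m h])

theorem solved_candidates (C : ℕ) (F : QF) :
    (F.solved C).Solved ((F.candidates C).map Term.lift) (F.modulus C) :=
  solved_solved (fun u hu => List.mem_map_of_mem (by simp [candidates, hu])) dvd_foldr_lcm

section Size

variable {C r : ℕ} {F : QF} {s : Term}

theorem size_block_le (hs : s ∈ F.candidates C) :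
    (Fml.disj ((List.range (F.modulus C + 1)).map fun r =>
      ((F.solved C).inst (.add s (.num r))).toFml)).size ≤ (F.cooper C).toFml.size := by
  rw [toFml_cooper]
  exact Fml.size_le_size_disj (List.mem_map.2 ⟨s, hs, rfl⟩)

theorem size_inst_le (hs : s ∈ F.candidates C) (hr : r < F.modulus C + 1) :
    ((F.solved C).inst (.add s (.num r))).toFml.size ≤ (F.cooper C).toFml.size :=
  (Fml.size_le_size_disj (List.mem_map.2 ⟨r, List.mem_range.2 hr, rfl⟩)).trans (size_block_le hs)

theorem size_solved_le : (F.solved C).toFml.size ≤ (F.cooper C).toFml.size :=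
  (size_toFml_le_inst _ _).trans (size_inst_le (zero_mem_candidates C F) (Nat.succ_pos _))

theorem size_candidate_le (hs : s ∈ F.candidates C) (hr : r < F.modulus C + 1) :
    (Term.add s (.num r)).size ≤ (F.cooper C).toFml.size := by
  refine le_trans ?_ (size_inst_le hs hr)
  simp only [solved, inst, subst, toFml, Fml.size, Fml.size_le, Term.subst, Term.single_zero]
  omega

theorem length_candidates_le : (F.candidates C).length ≤ (F.cooper C).toFml.size := by
  rw [toFml_cooper]
  simpa using Fml.length_le_size_disj ((F.candidates C).map fun s =>
    Fml.disj ((List.range (F.modulus C + 1)).map fun r =>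
      ((F.solved C).inst (.add s (.num r))).toFml))

/-- The output lists an instance for each `r` from `0` to the modulus, so a case distinction over
all residues is affordable. -/
theorem modulus_lt : F.modulus C < (F.cooper C).toFml.size := by
  refine lt_of_lt_of_le (Nat.lt_succ_self _) (le_trans ?_ (size_block_le (zero_mem_candidates C F)))
  simpa using Fml.length_le_size_disj ((List.range (F.modulus C + 1)).map fun r =>
      ((F.solved C).inst (.add .zero (.num r))).toFml)

/-- The conjunct `y ≡ t` modulo `C` contains `C` summands. -/
theorem le_size_solved : C ≤ (F.solved C).toFml.size := by
  have := le_size_mod C (.var 0) (.sum (F.rests C))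
  simp only [solved, toFml, Fml.size] at *
  omega

theorem size_sum_rests_le : (Term.sum (F.rests C)).size ≤ (F.solved C).toFml.size := by
  simp only [solved, toFml, Fml.size, Fml.size_le]
  omega

end Size

end QF

/-! ### The two implications of the equivalence -/

namespace Calc

open Pf Fml Term

variable {B S K C M : ℕ} {F : QF}

/-- The term `C x + t`, where `t` is the sum of all `tᵢ`. -/
def _root_.PrA.QF.side (C : ℕ) (F : QF) : Term := add (smul C (var 0)) (sum (F.rests C))

theorem size_side_le (h : (F.solved C).toFml.size ≤ M) : (F.side C).size ≤ 3 * M + 2 := by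
  have h1 := QF.le_size_solved (C := C) (F := F)
  have h2 := QF.size_sum_rests_le (C := C) (F := F)
  have h3 := size_smul_le C (var 0)
  simp only [QF.side, Term.size] at *
  omega

theorem repl_solved (e : Term) : (F.solved C).repl e = and (le (sum (F.rests C)) e)
    (and (modEq C e (sum (F.rests C))) ((F.unify C [] []).repl e)) := by
  simp only [QF.solved, QF.repl, QF.subst, QF.toFml, subst_repl (count_sum QF.count_rests),
    Term.subst, repl_zero]

/-- The exponent `3` in the budget: `C x + t` has size linear in `M`, inserting it into the unified
formula makes the bound quadratic, and the factors, which are at most `C ≤ M`, contribute one more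
degree. -/
theorem unify_side_iff (hc : Calc B S K) (hC : 0 < C) (hF : ∀ c ∈ F.coeffs, c ∣ C)
    (hM : F.toFml.size ≤ M) (hM' : (F.cooper C).toFml.size ≤ M) (hB : 2000 * (M + 2) ^ 3 ≤ B)
    {Γ : List Fml} :
    Pf S (M * (300 * K)) Γ (iff F.toFml ((F.unify C [] []).repl (F.side C))) := by
  have h1 := QF.size_repl_le (F.solved C) (F.side C)
  have h2 := QF.size_solved_le (C := C) (F := F)
  have h3 := size_side_le (h2.trans hM')
  have h4 := QF.le_size_solved (C := C) (F := F)
  have h5 : (F.solved C).toFml.size * (F.side C).size ≤ M * (3 * M + 2) :=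
    Nat.mul_le_mul (h2.trans hM') h3
  have h6 : C * (M * (3 * M + 2) + M + 10) ≤ M * (M * (3 * M + 2) + M + 10) :=
    Nat.mul_le_mul_right _ (by omega)
  rw [repl_solved] at h1
  simp only [Fml.size] at h1
  refine (hc.unify_iff (Q := M * (3 * M + 2) + M) hC hF (pre := []) (post := [])
    (fun ρ => by simp [QF.side, eval]) (by simp) (by simp) (by omega) (by omega) ?_).mono
      (by gcongr)
  refine le_trans ?_ hB
  ring_nf at h6 ⊢
  omega

/-- A solution `x` makes the solved formula true at `y = C x + t`: the difference `C x` witnesses `t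
≤ y`, `x` itself witnesses the congruence, and the rest is `unify_side_iff`. Then `disj_of_solved`
applies. -/
theorem cooper_of_ex (hc : Calc B S K) (hC : 0 < C) (hF : ∀ m ∈ F.moduli, 0 < m)
    (hF' : ∀ c ∈ F.coeffs, c ∣ C) (hM : F.toFml.size ≤ M) (hM' : (F.cooper C).toFml.size ≤ M)
    (hB : 2000 * (M + 2) ^ 3 ≤ B) (hMK : M ≤ K) :
    Pf S (1000 * K * ((400 * K * (M + 1) + 1) * (M + 1) ^ 4) + 2) [ex F.toFml]
      (F.cooper C).toFml := by
  have hS := hc.formula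
  have hK := hc.nodes
  have hB' : 200 * (3 * (4 * M + 5) + M * (3 * M + 2) + 14 * M + 5) + 100 * M + 100 ≤ B := by
    refine le_trans ?_ hB
    ring_nf
    omega
  have h1 := QF.size_repl_le (F.solved C) (F.side C)
  have h2 := QF.size_solved_le (C := C) (F := F)
  have h3 := size_side_le (h2.trans hM')
  have h4 := QF.le_size_solved (C := C) (F := F)
  have h5 : (F.solved C).toFml.size * (F.side C).size ≤ M * (3 * M + 2) :=
    Nat.mul_le_mul (h2.trans hM') h3
  have h6 := QF.modulus_lt (C := C) (F := F)
  have h7 := QF.length_candidates_le (C := C) (F := F)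
  have h8 := QF.size_sum_rests_le (C := C) (F := F)
  have h9 := size_smul_le C (var 0)
  simp only [Term.size] at h9
  let Γ := F.toFml :: [ex F.toFml].map Fml.lift
  have f1 := hc.le_of_eval (Γ := Γ) (t := sum (F.rests C)) (u := F.side C) (smul C (var 0))
    (fun ρ => by simp only [QF.side, eval]; ring) (by omega)
  have f2 := modEq_intro₁ (S := S) (Γ := Γ) (m := C) (t := F.side C) (u := sum (F.rests C)) (var 0)
    (by omega) (eqI _ (by simp only [QF.side, Fml.size, Term.size] at *; omega))
  have f3 := iff_mp (hc.unify_side_iff (Γ := Γ) hC hF' hM hM' hB)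
    (hyp (S := S) (A := F.toFml) (by simp [Γ]) (by omega))
  have e := repl_solved (C := C) (F := F) (F.side C)
  have f4 := andI (by rw [e] at h1; simp only [Fml.size] at *; omega) f2 f3
  have f5 := andI (by rw [← e]; omega) f1 f4
  rw [← e] at f5
  have hn : K + 1 + (1 + 2 + (M * (300 * K) + 1 + 2) + 1) + 1 ≤ 400 * K * (M + 1) := by
    ring_nf
    omega
  have f6 := hc.disj_of_solved (w := 4 * M + 5) (Q := M * (3 * M + 2)) (M := M)
    (F.solved_candidates C) (QF.modulus_pos hC hF hF') (by omega)
    (List.mem_map.2 ⟨_, QF.zero_mem_candidates C F, rfl⟩) (by rw [List.length_map]; omega)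
    (by
      simp only [List.mem_map]
      rintro _ ⟨s, hs, rfl⟩
      have := QF.size_candidate_le hs (Nat.succ_pos _)
      simp only [Term.size, Term.size_lift] at *
      omega)
    (f5.mono hn) (by omega) (by omega) le_rfl (by omega) hMK
    (by rw [← QF.lift_toFml_cooper, Fml.size_lift]; exact hM') (by omega)
    (by
      refine le_trans ?_ hS
      have : 10 * ((M + 1) * ((M + 2) * (4 * (4 * M + 5) + 20))) ≤ 2000 * (M + 2) ^ 3 := by
        ring_nf
        omega
      omega)
  rw [← QF.lift_toFml_cooper] at f6
  exact (exE (hyp (A := ex F.toFml) (by simp) (by simp only [Fml.size]; omega)) f6).mono (by omega)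

/-- If the congruence holds in the orientation `C z + y = t`, then `y ≤ t`, so `y = t` and the
quotient `0` works. The other orientation is the claim itself. -/
theorem shift_of_modEq (hc : Calc B S K) {n m : ℕ} {Γ : List Fml} {t y : Term}
    (h : Pf S n Γ (modEq C y t)) (h' : Pf S m Γ (le t y))
    (hB : 100 * (t.size + y.size + 2 * C + 5) ≤ B) :
    Pf S (n + m + 30 * K) Γ (shift C y t) := by
  have hS := hc.formula
  have hK := hc.nodes
  have h1 := size_smul_le C (var 0)
  have h2 := size_smul_le C zero
  have h3 := size_modEq_le C y t
  have h4 := size_shift_le C y t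
  simp only [Term.size] at h1 h2
  let A₁ := eq (add (smul C (var 0)) t.lift) y.lift
  let A₂ := eq (add (smul C (var 0)) y.lift) t.lift
  let Δ := [modEq C y t, le t y].map Fml.lift
  have f1 : Pf S 2 (A₁ :: Δ) (shift C y t).lift := by
    rw [lift_shift]
    exact shift_intro (var 0) (by simp only [Term.size_lift]; omega)
      (hyp (by simp [A₁]) (by simp only [Fml.size, Term.size, Term.size_lift]; omega))
  have g1 : Pf S 1 (A₂ :: Δ) A₂ :=
    hyp (by simp) (by simp only [A₂, Fml.size, Term.size, Term.size_lift]; omega)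
  have g2 := hc.lincomb g1 (t := add y.lift (smul C (var 0))) (u := t.lift)
    (fun ρ => by simp only [eval]; ring) (by simp only [Term.size, Term.size_lift]; omega)
    (by simp only [Term.size, Term.size_lift]; omega)
  have g3 := le_intro _ g2 (by simp only [Term.size_lift]; omega)
  have g4 := hc.le_antisymm (hyp (A := le t.lift y.lift) (by simp [Δ])
    (by simp only [Fml.size_le, Term.size_lift]; omega)) g3 (by simp only [Term.size_lift]; omega)
  have g5 := hc.lincomb g4 (t := add (smul C zero) t.lift) (u := y.lift)
    (fun ρ => by simp only [eval, eval_smul]; ring) (by simp only [Term.size, Term.size_lift]; omega)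
    (by simp only [Term.size_lift]; omega)
  have f2 : Pf S (20 * K) (A₂ :: Δ) (shift C y t).lift := by
    rw [lift_shift]
    exact (shift_intro _ (by simp only [Term.size_lift]; omega) g5).mono (by omega)
  have f3 := modEq_elim (hyp (A := modEq C y t) (by simp) (by omega)) f1 f2
  exact (app₂ (by simp only [Fml.size_le]; omega) f3 h h').mono (by omega)

/-- The first two conjuncts of the solved formula allow `y` to be written as `C x + t`. Then the
third one is the unified formula at `C x + t`, hence `F(x)`. -/
theorem ex_of_inst (hc : Calc B S K) (hC : 0 < C) (hF : ∀ c ∈ F.coeffs, c ∣ C)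
    (hM : F.toFml.size ≤ M) (hM' : (F.cooper C).toFml.size ≤ M) (hB : 2000 * (M + 2) ^ 3 ≤ B)
    {y : Term} (hy : ((F.solved C).inst y).toFml.size ≤ M) :
    Pf S (400 * K * (M + 1)) [((F.solved C).inst y).toFml] (ex F.toFml) := by
  have hS := hc.formula
  have hK := hc.nodes
  have hB' : 200 * (3 * (4 * M + 5) + M * (3 * M + 2) + 14 * M + 5) + 100 * M + 100 ≤ B := by
    refine le_trans ?_ hB
    ring_nf
    omega
  have h1 := QF.size_repl_le (F.solved C) (F.side C)
  have h2 := QF.size_solved_le (C := C) (F := F)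
  have h3 := size_side_le (h2.trans hM')
  have h4 := QF.le_size_solved (C := C) (F := F)
  have h5 : (F.solved C).toFml.size * (F.side C).size ≤ M * (3 * M + 2) :=
    Nat.mul_le_mul (h2.trans hM') h3
  have h8 := QF.size_sum_rests_le (C := C) (F := F)
  have ht : (sum (F.rests C)).count = 0 := count_sum QF.count_rests
  set t := (sum (F.rests C)).inst y with htdef
  have ht' : t.lift = sum (F.rests C) := lift_inst_of_count ht
  have ht'' : t.size = (sum (F.rests C)).size := size_inst_of_count y ht
  have e : ((F.solved C).inst y).toFml =
      and (le t y) (and (modEq C y t) ((F.unify C [] []).inst y).toFml) := rfl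
  have hyM : y.size ≤ M := by
    rw [e] at hy
    simp only [Fml.size, Fml.size_le] at hy
    omega
  have f0 : Pf S 1 [((F.solved C).inst y).toFml] ((F.solved C).inst y).toFml :=
    hyp (by simp) (by omega)
  have f2 : Pf S (1 + 1 + 1 + (1 + 1) + 30 * K) [((F.solved C).inst y).toFml] (shift C y t) := by
    have := f0
    rw [e] at this ⊢
    exact hc.shift_of_modEq (andE₁ (andE₂ this)) (andE₁ this) (by omega)
  -- The quotient introduced by eliminating `shift C y t` is `var 0`, so it takes the place of `x`,
  -- and the eliminated equation is literally `F.side C = y`.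
  let Δ := eq (F.side C) y.lift :: [((F.solved C).inst y).toFml].map Fml.lift
  have g1 : Pf S 1 Δ (eq (F.side C) y.lift) := hyp (by simp [Δ])
    (by simp only [Fml.size, Term.size_lift]; omega)
  have g2 : Pf S 1 Δ ((F.solved C).repl y.lift) := hyp (by simp [Δ, QF.lift_toFml_inst])
    (by rw [← QF.lift_toFml_inst, Fml.size_lift]; omega)
  have g3 := repl_congr (g1.symm (by omega)) g2 (by omega)
  rw [repl_solved] at g3
  have g4 := iff_mpr (hc.unify_side_iff (Γ := Δ) hC hF hM hM' hB) (andE₂ (andE₂ g3))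
  have g5 : Pf S (M * (300 * K) + 20) Δ (ex F.toFml).lift := by
    refine (exI (var 0) ?_ (n := M * (300 * K) + 15) ?_).mono (by omega)
    · have := Fml.size_lift (ex F.toFml)
      simp only [Fml.lift, Fml.subst, Fml.size] at this
      omega
    · have e' : (F.toFml.subst (up fun i => var (i + 1))).inst (var 0) = F.toFml := by
        rw [Fml.inst, Fml.subst_subst]
        refine (congrArg (F.toFml.subst ·) (funext fun i => ?_)).trans F.toFml.subst_var
        cases i <;> rfl
      rw [e']
      exact g4.mono (by omega)
  refine (exE f2 (m := M * (300 * K) + 20) ?_).mono ?_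
  · rw [ht']
    exact g5
  · ring_nf
    omega

theorem iff_cooper (hc : Calc B S K) (hC : 0 < C) (hF : ∀ m ∈ F.moduli, 0 < m)
    (hF' : ∀ c ∈ F.coeffs, c ∣ C) (hM : F.toFml.size ≤ M) (hM' : (F.cooper C).toFml.size ≤ M)
    (hB : 2000 * (M + 2) ^ 3 ≤ B) (hMK : M ≤ K) :
    Pf S (10 ^ 6 * K ^ 2 * (M + 1) ^ 5) [] (iff (ex F.toFml) (F.cooper C).toFml) := by
  have hS := hc.formula
  have hK := hc.nodes
  have hBM : M + 2 ≤ (M + 2) ^ 3 := Nat.le_self_pow (by omega) _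
  have f1 := hc.cooper_of_ex hC hF hF' hM hM' hB hMK
  have h6 := QF.modulus_lt (C := C) (F := F)
  have h7 := QF.length_candidates_le (C := C) (F := F)
  have f2 : Pf S (1 + M * (1 + M * (400 * K * (M + 1) + 1 + 5) + 10 + 5) + 10)
      [(F.cooper C).toFml] (ex F.toFml) := by
    have g1 : ∀ A, (F.cooper C).toFml = A → Pf S 1 [(F.cooper C).toFml] A := by
      rintro _ rfl
      exact hyp (by simp) (by omega)
    have h := QF.toFml_cooper C F
    refine (disjE (m := 1 + M * (400 * K * (M + 1) + 1 + 5) + 10)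
      (by rw [← h]; simp only [Fml.size]; omega) (g1 _ h) ?_).mono ?_
    · simp only [List.mem_map]
      rintro _ ⟨s, hs, rfl⟩
      have h8 := QF.size_block_le hs
      refine (disjE (m := 400 * K * (M + 1) + 1) (by simp only [Fml.size]; omega)
        (hyp (S := S) (A := Fml.disj ((List.range (F.modulus C + 1)).map fun r =>
          ((F.solved C).inst (.add s (.num r))).toFml)) (by simp) (by omega)) ?_).mono ?_
      · simp only [List.mem_map, List.mem_range]
        rintro _ ⟨r, hr, rfl⟩
        exact weaken (by simp) (by simp)
          (hc.ex_of_inst hC hF' hM hM' hB ((QF.size_inst_le hs hr).trans hM'))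
      · rw [List.length_map, List.length_range]
        gcongr
        omega
    · rw [List.length_map]
      gcongr
      omega
  refine (iffI (by simp only [Fml.size]; omega) f1 f2).mono ?_
  have hX : K * (M + 1) ^ 3 ≤ K ^ 2 * (M + 1) ^ 5 :=
    Nat.mul_le_mul (Nat.le_self_pow (by omega) _) (Nat.pow_le_pow_right (by omega) (by omega))
  have e1 : (400 * K * (M + 1) + 1) * (M + 1) ^ 4 ≤ 401 * K * (M + 1) * (M + 1) ^ 4 := by
    gcongr
    nlinarith
  have e2 : 1000 * K * ((400 * K * (M + 1) + 1) * (M + 1) ^ 4) ≤ 401000 * (K ^ 2 * (M + 1) ^ 5) :=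
    (Nat.mul_le_mul_left _ e1).trans (by ring_nf; rfl)
  have e3 : M * (1 + M * (400 * K * (M + 1) + 1 + 5) + 10 + 5) + 100 ≤
      1000 * (K * (M + 1) ^ 3) := by
    have : M ≤ M * K := Nat.le_mul_of_pos_right _ (by omega)
    have : M ^ 2 ≤ M ^ 2 * K := Nat.le_mul_of_pos_right _ (by omega)
    ring_nf
    omega
  rw [mul_assoc (10 ^ 6)]
  omega

end Calc
end PrA

/-- There is a polynomial `P` such that for every quantifier-free formula `F(x)` of the signature
`0, 1, +, =, ≤, ≡ₘ` (`m ≥ 1`), and every choice of the common number `C` of occurrences of `x` in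
the algorithm, the formula `∃ x, F(x) ↔ F'` has a proof in `PrA_alt` of size at most `P` of the size
of this formula, where `F'` is the output of the algorithm. -/
theorem mainTheorem4 :
    ∃ P : Polynomial ℕ, ∀ (F : PrA.QF) (C : ℕ),
      (∀ m ∈ F.moduli, 0 < m) → 0 < C → (∀ c ∈ F.coeffs, c ∣ C) →
        ∃ d : PrA.Derivation PrA.PrAalt []
            (PrA.Fml.iff (PrA.Fml.ex F.toFml) (F.cooper C).toFml),
          d.size ≤
            P.eval (PrA.Fml.iff (PrA.Fml.ex F.toFml) (F.cooper C).toFml).size := by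
  let B : Polynomial ℕ := 2000 * (Polynomial.X + 2) ^ 3
  let K : Polynomial ℕ := 200 * B * B
  let N : Polynomial ℕ := 10 ^ 6 * K ^ 2 * (Polynomial.X + 1) ^ 5
  -- `N` bounds the number of nodes and `100 * B` the formulas on the right. With an empty initial
  -- context there are at most `N` assumptions, so each sequent has at most `(N + 1) * (100 * B +
  -- 3)` symbols.
  refine ⟨N * ((N + 1) * (100 * B + 3)), fun F C hF hC hF' => ?_⟩
  set M := (PrA.Fml.iff (PrA.Fml.ex F.toFml) (F.cooper C).toFml).size with hM
  have hB : B.eval M = 2000 * (M + 2) ^ 3 := by simp [B]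
  have hK : K.eval M = 200 * (B.eval M) * (B.eval M) := by simp [K]
  have hN : N.eval M = 10 ^ 6 * (K.eval M) ^ 2 * (M + 1) ^ 5 := by simp [N]
  have hBM : M + 2 ≤ (M + 2) ^ 3 := Nat.le_self_pow (by omega) _
  have hc : PrA.Calc (B.eval M) (100 * B.eval M) (K.eval M) :=
    hK ▸ PrA.calc_of_le (by omega) le_rfl
  simp only [PrA.Fml.iff, PrA.Fml.size] at hM
  have h := hc.iff_cooper (F := F) (M := M) hC hF hF' (by omega) (by omega) hB.ge (by
    rw [hK, mul_assoc]
    have := Nat.le_mul_self (B.eval M)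
    omega)
  rw [← hN] at h
  simpa using h.exists_derivation (N.eval M) (by simp) (by simp)
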